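/- Let $\lambda$ be an infinite regular cardinal and let $\mathcal V=(\mathcal V_0,\otimes,I)$ be a symmetric monoidal closed category that is locally $\lambda$-presentable as a closed category: $\mathcal V_0$ is locally $\lambda$-presentable and its $\lambda$-presentable objects (forming $\mathcal V_\lambda$) contain $I$ and are closed under $\otimes$. Write $A^X=[X,A]$. Let $(\mathcal E,\mathcal M)$ be an enriched orthogonal factorization system on $\mathcal V$ (so $\mathcal E$ is closed under tensoring with objects of $\mathcal V$) that is proper, i.e. $\mathcal E$ consists of epimorphisms and $\mathcal M$ of monomorphisms (equivalently, $\mathcal M$ consists of monomorphisms and contains the regular ones), and suppose that $\mathcal M$ is closed in $\mathcal V^{\to}$ under $\lambda$-filtered colimits. Let $\mathbb L$ be a $\lambda$-ary language over $\mathcal V$: a set of function symbols $f:(X,Y)$ and relation symbols $R:X$ with arities in $\mathcal V_\lambda$. An $\mathbb L$-structure is an object $A$ with maps $f_A\colon A^X\to A^Y$ and $\mathcal M$-subobjects $R_A\rightarrowtail A^X$; $\mathbf{Str}(\mathbb L)$ is the $\mathcal V$-category of $\mathbb L$-structures, and an $\mathbb L$-structure $A$ is $\lambda$-presentable if $\mathbf{Str}(\mathbb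 L)(A,-)$ preserves $\lambda$-filtered colimits. Terms are built from maps $Y\to X$ of $\mathcal V_\lambda$ (as $(X,Y)$-ary terms) and function symbols by composition, powers $t^Z$ with $Z\in\mathcal V_\lambda$, and tuples of fewer than $\lambda$ terms. Atomic formulas are $s(x)=t(x)$ and $R^Y(t(x))$, with $Y\in\mathcal V_\lambda$. An $X$-ary formula $\varphi$ is interpreted in $A$ as an $\mathcal M$-subobject $\varphi_A\rightarrowtail A^X$: equations by the $(\mathcal E,\mathcal M)$-image of the equalizer, $R^Y(t(x))$ by pulling back $R_A^Y\rightarrowtail A^{X'\otimes Y}$ (where $R:X'$) along $t_A$, conjunctions by intersection, $(\exists y)\psi$ by the $(\mathcal E,\mathcal M)$-image of $\psi_A\to A^{X+Y}\to A^X$, and disjunctions $\bigvee_j\varphi_j$ by the $(\mathcal E,\mathcal M)$-image of $\sum_j(\varphi_j)_A\to A^X$. A structure satisfies $(\forall x)(\varphi\vdash\psi)$ if $\varphi_A\subseteq\psi_A$. Let $\kappa$ be a cardinal or $\kappa=\infty$ (no bound). For a full subcategory $\mathcal A$ of $\mathbf{Str}(\mathbb L)$ consider: 1. $\mathcal A$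 is a $(\lambda,\mathcal E)$-cone-injectivity class for cones with fewer than $\kappa$ members: there is a set $\mathcal H$ of cones $(h_j\colon A\to B_j)_{j\in J}$ of $\lambda$-presentable $\mathbb L$-structures with $|J|<\kappa$ such that $K\in\mathcal A$ if and only if for every such cone in $\mathcal H$ the induced map $\sum_{j\in J}\mathbf{Str}(\mathbb L)(B_j,K)\to\mathbf{Str}(\mathbb L)(A,K)$ is in $\mathcal E$. 2. $\mathcal A=\mathrm{Mod}(\mathbb T)$ for a set $\mathbb T$ of axioms of the form $$(\forall x)\Bigl(\varphi(x)\vdash\bigvee_{j\in J}(\exists y_j)\bigl(\psi_j(x,y_j)\wedge\varphi(x)\bigr)\Bigr),$$ where $\varphi$ and all $\psi_j$ are conjunctions of fewer than $\lambda$ atomic formulas, all variables have arities in $\mathcal V_\lambda$, and $|J|<\kappa$. (For $\kappa=\lambda$ these are the $\mathbb L_{\lambda\lambda}$-theories of this form.) Then $(2)\Rightarrow(1)$ always holds, and $(1)\Rightarrow(2)$ holds under the following assumption: there is a proper enriched factorization system $(\mathcal E_0,\mathcal M_0)$ on $\mathcal V$ with $\mathcal M_0$ closed in $\mathcal V^\to$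 under $\lambda$-filtered colimits and $\mathcal E_0\subseteq\mathcal E$, such that (i) either $\mathbb L$ has no function symbols, or the input arities of the function symbols and the arities of the relation symbols of $\mathbb L$ are $\mathcal E_0$-stable ($X$ is $\mathcal E_0$-stable if $(-)^X$ preserves $\mathcal E_0$) and $\mathcal V_\lambda$ has an $\mathcal E_0$-generator of $\mathcal E_0$-projective objects (a set $\mathcal G$ of $\mathcal E_0$-projective objects of $\mathcal V_\lambda$ such that every $X\in\mathcal V_\lambda$ admits a map $Y\to X$ in $\mathcal E_0$ with $Y\in\mathcal G$); and (ii) the inclusion of $\mathbf{Str}(\mathbb L)$ into the $\mathcal V$-category $\mathbf{Str}(\mathbb L)^0$ of $\mathbb L$-structures formed with respect to $(\mathcal E_0,\mathcal M_0)$ preserves $\lambda$-presentable objects. -/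

import Mathlib

open CategoryTheory CategoryTheory.Limits CategoryTheory.MonoidalCategory

universe w u

namespace EnrLogic

/-! ## The base of enrichment and its factorization systems -/

section Base

/-- `V` is locally `lam`-presentable as a closed category: `V` is locally `lam`-presentable, and
its `lam`-presentable objects contain the unit and are closed under the tensor product. -/
structure LocPresentableAsClosed (V : Type u) [Category.{w} V] [MonoidalCategory V]
    (lam : Cardinal.{w}) [Fact lam.IsRegular] : Prop where
  locallyPresentable : IsCardinalLocallyPresentable V lam
  unit : IsCardinalPresentable (𝟙_ V) lam
  tensor : ∀ X Y : V, IsCardinalPresentable X lam → IsCardinalPresentable Y lam →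
    IsCardinalPresentable (X ⊗ Y) lam

/-- An enriched orthogonal factorization system `(E, M)` on `V` whose right class consists of
monomorphisms. -/
structure FactSystem (V : Type u) [Category.{w} V] [MonoidalCategory V] where
  E : MorphismProperty V
  M : MorphismProperty V
  E_respectsIso : E.RespectsIso
  M_respectsIso : M.RespectsIso
  fac : ∀ {X Y : V} (f : X ⟶ Y), ∃ (Z : V) (e : X ⟶ Z) (m : Z ⟶ Y), E e ∧ M m ∧ e ≫ m = f
  orth : ∀ {A B C D : V} (e : A ⟶ B) (m : C ⟶ D), E e → M m →
    ∀ (a : A ⟶ C) (b : B ⟶ D), a ≫ m = e ≫ b → ∃! d : B ⟶ C, e ≫ d = a ∧ d ≫ m = b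
  /-- `E` is closed under tensoring with objects of `V`. -/
  E_tensor : ∀ (Z : V) {X Y : V} (e : X ⟶ Y), E e → E (Z ◁ e)
  M_mono : ∀ {X Y : V} (m : X ⟶ Y), M m → Mono m

namespace FactSystem

variable {V : Type u} [Category.{w} V] [MonoidalCategory V] (S : FactSystem V)

/-- The factorization system is proper (the right class always consists of monomorphisms here). -/
def IsProper : Prop := ∀ ⦃X Y : V⦄ (e : X ⟶ Y), S.E e → Epi e

/-- `M` is closed in the arrow category under `lam`-filtered colimits. -/
def ClosedUnderFiltered (lam : Cardinal.{w}) [Fact lam.IsRegular] : Prop :=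
  ∀ (J : Type w) [SmallCategory J] [IsCardinalFiltered J lam], S.M.IsStableUnderColimitsOfShape J

/-- The middle object of the `(E, M)`-factorization. -/
noncomputable def im {X Y : V} (f : X ⟶ Y) : V := (S.fac f).choose

/-- The `M`-part of the `(E, M)`-factorization. -/
noncomputable def imι {X Y : V} (f : X ⟶ Y) : S.im f ⟶ Y :=
  (S.fac f).choose_spec.choose_spec.choose

/-- The `E`-part of the `(E, M)`-factorization. -/
noncomputable def toIm {X Y : V} (f : X ⟶ Y) : X ⟶ S.im f :=
  (S.fac f).choose_spec.choose

lemma im_spec {X Y : V} (f : X ⟶ Y) :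
    S.E (S.toIm f) ∧ S.M (S.imι f) ∧ S.toIm f ≫ S.imι f = f :=
  (S.fac f).choose_spec.choose_spec.choose_spec

/-- A larger left class has a smaller right class. -/
lemma right_le {S₀ S : FactSystem V} (h : S₀.E ≤ S.E) : S.M ≤ S₀.M := by
  intro X Y m hm
  obtain ⟨he, hi, hf⟩ := S₀.im_spec m
  obtain ⟨d, ⟨h1, h2⟩, -⟩ := S.orth (S₀.toIm m) m (h _ he) hm (𝟙 X) (S₀.imι m) (by simp [hf])
  have : Mono (S₀.imι m) := S₀.M_mono _ hi
  have h3 : d ≫ S₀.toIm m = 𝟙 _ := by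
    rw [← cancel_mono (S₀.imι m), Category.assoc, hf, h2, Category.id_comp]
  have : IsIso (S₀.toIm m) := ⟨d, h1, h3⟩
  have := S₀.M_respectsIso
  have h4 := (S₀.M.cancel_left_of_respectsIso (S₀.toIm m) (S₀.imι m)).2 hi
  rwa [hf] at h4

/-- `X` is `E`-projective: `V(X, -)` sends maps in `E` to surjections. -/
def Projective (X : V) : Prop :=
  ∀ ⦃A B : V⦄ (e : A ⟶ B), S.E e → ∀ b : X ⟶ B, ∃ a : X ⟶ A, a ≫ e = b

/-- `X` is `E`-stable: the internal hom `[X, -]` sends maps in `E` to maps in `E`. -/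
def Stable [MonoidalClosed V] (X : V) : Prop :=
  ∀ ⦃A B : V⦄ (e : A ⟶ B), S.E e → S.E ((ihom X).map e)

/-- `V_lam` has an `E`-generator consisting of `E`-projective objects. -/
def HasProjectiveGenerator (lam : Cardinal.{w}) [Fact lam.IsRegular] : Prop :=
  ∃ G : Set V, (∀ Y ∈ G, IsCardinalPresentable Y lam ∧ S.Projective Y) ∧
    ∀ X : V, IsCardinalPresentable X lam → ∃ Y ∈ G, ∃ e : Y ⟶ X, S.E e

end FactSystem

end Base

/-! ## Some canonical maps between internal homs -/

section Maps

variable {V : Type u} [Category.{w} V] [MonoidalCategory V] [MonoidalClosed V]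

/-- The action `[A, B] ⟶ [A^X, B^X]` of the `V`-functor `(-)^X = [X, -]` on hom-objects. -/
noncomputable def powAct (X A B : V) :
    (ihom A).obj B ⟶ (ihom ((ihom X).obj A)).obj ((ihom X).obj B) :=
  MonoidalClosed.curry (MonoidalClosed.comp X A B)

/-- The canonical map `A^(X ⊗ Z) ⟶ (A^X)^Z`. -/
noncomputable def powCurry (X Z A : V) :
    (ihom (X ⊗ Z)).obj A ⟶ (ihom Z).obj ((ihom X).obj A) :=
  MonoidalClosed.curry (MonoidalClosed.curry
    ((α_ X Z ((ihom (X ⊗ Z)).obj A)).inv ≫ (ihom.ev (X ⊗ Z)).app A))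

/-- The canonical map `(A^X)^Z ⟶ A^(X ⊗ Z)`, inverse to `powCurry`. -/
noncomputable def powUncurry (X Z A : V) :
    (ihom Z).obj ((ihom X).obj A) ⟶ (ihom (X ⊗ Z)).obj A :=
  MonoidalClosed.curry ((α_ X Z _).hom ≫
    X ◁ (ihom.ev Z).app ((ihom X).obj A) ≫ (ihom.ev X).app A)

/-- The bijection `V(X, [Y, A]) → V(Y, [X, A])` given by the symmetry. -/
noncomputable def swapHom [SymmetricCategory V] {X Y A : V} (f : X ⟶ (ihom Y).obj A) :
    Y ⟶ (ihom X).obj A :=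
  MonoidalClosed.curry ((β_ X Y).hom ≫ MonoidalClosed.uncurry f)

/-- The map `W ⟶ A^(∐ Y)` with components `t j : W ⟶ A^(Y j)`. -/
noncomputable def powTuple [SymmetricCategory V] [HasColimits V] {J : Type w} (Y : J → V)
    {W A : V} (t : ∀ j, W ⟶ (ihom (Y j)).obj A) : W ⟶ (ihom (∐ Y)).obj A :=
  swapHom (Sigma.desc fun j => swapHom (t j))

lemma ihom_map_powAct (X : V) {A B C : V} (k : B ⟶ C) :
    (ihom A).map k ≫ powAct X A C = powAct X A B ≫ (ihom _).map ((ihom X).map k) := by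
  unfold powAct
  rw [← MonoidalClosed.curry_natural_left, ← MonoidalClosed.curry_natural_right]
  congr 1
  unfold MonoidalClosed.comp
  rw [← MonoidalClosed.curry_natural_left, ← MonoidalClosed.curry_natural_right]
  congr 1
  simp only [MonoidalClosed.compTranspose, Category.assoc]
  rw [associator_inv_naturality_right_assoc, whisker_exchange_assoc]
  dsimp only [Functor.id_obj]
  rw [ihom.ev_naturality]

lemma pre_powAct (X : V) {A B : V} (g : A ⟶ B) (C : V) :
    (MonoidalClosed.pre g).app C ≫ powAct X A C =
      powAct X B C ≫ (MonoidalClosed.pre ((ihom X).map g)).app ((ihom X).obj C) := by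
  unfold powAct
  rw [← MonoidalClosed.curry_natural_left, MonoidalClosed.curry_pre_app]
  congr 1
  unfold MonoidalClosed.comp
  rw [← MonoidalClosed.curry_natural_left, ← MonoidalClosed.curry_natural_left]
  congr 1
  simp only [MonoidalClosed.compTranspose]
  rw [associator_inv_naturality_right_assoc, whisker_exchange_assoc]
  dsimp only [Functor.id_obj]
  rw [MonoidalClosed.id_tensor_pre_app_comp_ev, associator_inv_naturality_middle_assoc,
    ← comp_whiskerRight_assoc, ← comp_whiskerRight_assoc, ihom.ev_naturality]

end Maps
/-! ## Languages and structures -/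

/-- A (single-sorted) language over `V`: function symbols `f : (dom f, cod f)` and relation
symbols `R : ar R`. -/
structure Language (V : Type u) [Category.{w} V] where
  Func : Type w
  dom : Func → V
  cod : Func → V
  Rel : Type w
  ar : Rel → V

/-- The language is `lam`-ary: all arities are `lam`-presentable. -/
structure Language.IsAry {V : Type u} [Category.{w} V] (L : Language V)
    (lam : Cardinal.{w}) [Fact lam.IsRegular] : Prop where
  dom : ∀ f, IsCardinalPresentable (L.dom f) lam
  cod : ∀ f, IsCardinalPresentable (L.cod f) lam
  ar : ∀ R, IsCardinalPresentable (L.ar R) lam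

/-- An `L`-structure, with relations interpreted as `M`-subobjects. -/
structure Str {V : Type u} [Category.{w} V] [MonoidalCategory V] [MonoidalClosed V]
    (S : FactSystem V) (L : Language V) where
  carrier : V
  func : ∀ f : L.Func, (ihom (L.dom f)).obj carrier ⟶ (ihom (L.cod f)).obj carrier
  rel : L.Rel → V
  relι : ∀ R : L.Rel, rel R ⟶ (ihom (L.ar R)).obj carrier
  relι_mem : ∀ R : L.Rel, S.M (relι R)

namespace Str

variable {V : Type u} [Category.{w} V] [MonoidalCategory V] [MonoidalClosed V]
  {S : FactSystem V} {L : Language V}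

/-- A morphism of `L`-structures. -/
@[ext]
structure Hom (A B : Str S L) where
  map : A.carrier ⟶ B.carrier
  func_comm : ∀ f : L.Func,
    A.func f ≫ (ihom (L.cod f)).map map = (ihom (L.dom f)).map map ≫ B.func f
  rel_comm : ∀ R : L.Rel, ∃ l : A.rel R ⟶ B.rel R,
    l ≫ B.relι R = A.relι R ≫ (ihom (L.ar R)).map map

/-- The underlying ordinary category of the `V`-category of `L`-structures. -/
instance : Category (Str S L) where
  Hom A B := Hom A B
  id A := ⟨𝟙 _, by simp, fun R => ⟨𝟙 _, by simp⟩⟩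
  comp g h := ⟨g.map ≫ h.map, fun f => by
      rw [Functor.map_comp, Functor.map_comp, ← Category.assoc, g.func_comm, Category.assoc,
        h.func_comm, Category.assoc], fun R => by
      obtain ⟨l, hl⟩ := g.rel_comm R
      obtain ⟨l', hl'⟩ := h.rel_comm R
      exact ⟨l ≫ l', by rw [Category.assoc, hl', reassoc_of% hl, Functor.map_comp]⟩⟩
  id_comp _ := Hom.ext (Category.id_comp _)
  comp_id _ := Hom.ext (Category.comp_id _)
  assoc _ _ _ := Hom.ext (Category.assoc _ _ _)

@[simp] lemma id_map (A : Str S L) : Hom.map (𝟙 A) = 𝟙 A.carrier := rfl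

@[simp] lemma comp_map {A B C : Str S L} (g : A ⟶ B) (h : B ⟶ C) :
    Hom.map (g ≫ h) = Hom.map g ≫ Hom.map h := rfl

/-! ### The hom-objects of the `V`-category of structures -/

variable [HasLimits V]

/-- The subobjects of `[A, B]` expressing compatibility with one symbol of the language. For a
function symbol it is the equalizer of the two evident maps `[A, B] ⟶ [A^X, B^Y]`; for a relation
symbol it is the pullback of `[R_A, R_B] ⟶ [R_A, B^X]` along `[A, B] ⟶ [R_A, B^X]`. -/
noncomputable def homCond (A B : Str S L) :
    L.Func ⊕ L.Rel → Over ((ihom A.carrier).obj B.carrier)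
  | Sum.inl f => Over.mk (equalizer.ι
      (powAct (L.dom f) A.carrier B.carrier ≫ (ihom _).map (B.func f))
      (powAct (L.cod f) A.carrier B.carrier ≫ (MonoidalClosed.pre (A.func f)).app _))
  | Sum.inr R => Over.mk (pullback.fst
      (powAct (L.ar R) A.carrier B.carrier ≫ (MonoidalClosed.pre (A.relι R)).app _)
      ((ihom (A.rel R)).map (B.relι R)))

/-- The hom-object `Str(L)(A, B)`: the intersection of all the subobjects `homCond A B c`. -/
noncomputable def homObj (A B : Str S L) : V :=
  widePullback ((ihom A.carrier).obj B.carrier) (fun c => (homCond A B c).left)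
    (fun c => (homCond A B c).hom)

/-- The inclusion `Str(L)(A, B) ⟶ [A, B]`. -/
noncomputable def homι (A B : Str S L) : homObj A B ⟶ (ihom A.carrier).obj B.carrier :=
  WidePullback.base _

instance (A B : Str S L) (c : L.Func ⊕ L.Rel) : Mono (homCond A B c).hom := by
  cases c with
  | inl f => exact inferInstanceAs (Mono (equalizer.ι _ _))
  | inr R =>
    have : Mono (B.relι R) := S.M_mono _ (B.relι_mem R)
    exact inferInstanceAs (Mono (pullback.fst _ _))

/-- The projections from `Str(L)(A, B)` to the subobjects `homCond A B c`. -/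
noncomputable def homπ (A B : Str S L) (c : L.Func ⊕ L.Rel) :
    homObj A B ⟶ (homCond A B c).left :=
  WidePullback.π _ c

lemma homπ_hom (A B : Str S L) (c : L.Func ⊕ L.Rel) :
    homπ A B c ≫ (homCond A B c).hom = homι A B :=
  WidePullback.π_arrow _ _

instance (A B : Str S L) : Mono (homι A B) := by
  refine ⟨fun g h e => WidePullback.hom_ext _ _ _ (fun c => ?_) e⟩
  change g ≫ homπ A B c = h ≫ homπ A B c
  have e' : (g ≫ homπ A B c) ≫ (homCond A B c).hom = (h ≫ homπ A B c) ≫ (homCond A B c).hom := by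
    rw [Category.assoc, Category.assoc]
    exact (congrArg (g ≫ ·) (homπ_hom A B c)).trans
      (e.trans (congrArg (h ≫ ·) (homπ_hom A B c)).symm)
  exact (cancel_mono (homCond A B c).hom).1 e'

/-- A map `t : W ⟶ [A, B]` is compatible with the symbols of the language. -/
structure Compat (A B : Str S L) {W : V} (t : W ⟶ (ihom A.carrier).obj B.carrier) : Prop where
  func : ∀ f : L.Func, t ≫ powAct (L.dom f) A.carrier B.carrier ≫ (ihom _).map (B.func f) =
    t ≫ powAct (L.cod f) A.carrier B.carrier ≫ (MonoidalClosed.pre (A.func f)).app _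
  rel : ∀ R : L.Rel, ∃ l : W ⟶ (ihom (A.rel R)).obj (B.rel R),
    l ≫ (ihom (A.rel R)).map (B.relι R) =
      t ≫ powAct (L.ar R) A.carrier B.carrier ≫ (MonoidalClosed.pre (A.relι R)).app _

lemma homι_compat (A B : Str S L) : Compat A B (homι A B) where
  func f := by
    let p : homObj A B ⟶ equalizer _ _ := homπ A B (Sum.inl f)
    have h : p ≫ equalizer.ι _ _ = homι A B := homπ_hom A B (Sum.inl f)
    rw [← h, Category.assoc, Category.assoc, equalizer.condition]
  rel R := by
    let p : homObj A B ⟶ pullback _ _ := homπ A B (Sum.inr R)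
    have h : p ≫ pullback.fst _ _ = homι A B := homπ_hom A B (Sum.inr R)
    exact ⟨p ≫ pullback.snd _ _, by
      rw [← h, Category.assoc, Category.assoc, pullback.condition]⟩

lemma Compat.exists_lift {A B : Str S L} {W : V} {t : W ⟶ (ihom A.carrier).obj B.carrier}
    (h : Compat A B t) : ∃ s : W ⟶ homObj A B, s ≫ homι A B = t := by
  have key : ∀ c, ∃ p : W ⟶ (homCond A B c).left, p ≫ (homCond A B c).hom = t := by
    rintro (f | R)
    · exact ⟨equalizer.lift t (h.func f), equalizer.lift_ι _ _⟩
    · obtain ⟨l, hl⟩ := h.rel R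
      exact ⟨pullback.lift t l hl.symm, pullback.lift_fst _ _ _⟩
  choose p hp using key
  exact ⟨WidePullback.lift t p hp, WidePullback.lift_base _ _ _ _⟩

/-- The map into `Str(L)(A, B)` induced by a compatible map into `[A, B]`. -/
noncomputable def Compat.lift {A B : Str S L} {W : V} {t : W ⟶ (ihom A.carrier).obj B.carrier}
    (h : Compat A B t) : W ⟶ homObj A B := h.exists_lift.choose

@[simp]
lemma Compat.lift_ι {A B : Str S L} {W : V} {t : W ⟶ (ihom A.carrier).obj B.carrier}
    (h : Compat A B t) : h.lift ≫ homι A B = t := h.exists_lift.choose_spec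

lemma compat_post (A : Str S L) {B C : Str S L} (k : B ⟶ C) :
    Compat A C (homι A B ≫ (ihom A.carrier).map (Hom.map k)) where
  func f := by
    have := (homι_compat A B).func f
    simp only [Category.assoc]
    rw [← Category.assoc ((ihom A.carrier).map (Hom.map k)),
      ← Category.assoc ((ihom A.carrier).map (Hom.map k)), ihom_map_powAct, ihom_map_powAct]
    simp only [Category.assoc]
    rw [← Functor.map_comp, ← Hom.func_comm, Functor.map_comp,
      ← MonoidalClosed.pre_comm_ihom_map, reassoc_of% this]
  rel R := by
    obtain ⟨l, hl⟩ := (homι_compat A B).rel R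
    obtain ⟨m, hm⟩ := Hom.rel_comm k R
    refine ⟨l ≫ (ihom _).map m, ?_⟩
    simp only [Category.assoc]
    rw [← Category.assoc ((ihom A.carrier).map (Hom.map k)), ihom_map_powAct, Category.assoc,
      ← MonoidalClosed.pre_comm_ihom_map, ← Functor.map_comp, hm, Functor.map_comp,
      reassoc_of% hl]

lemma compat_pre {A B : Str S L} (g : A ⟶ B) (C : Str S L) :
    Compat A C (homι B C ≫ (MonoidalClosed.pre (Hom.map g)).app C.carrier) where
  func f := by
    have := (homι_compat B C).func f
    simp only [Category.assoc]
    rw [← Category.assoc ((MonoidalClosed.pre (Hom.map g)).app _),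
      ← Category.assoc ((MonoidalClosed.pre (Hom.map g)).app _), pre_powAct, pre_powAct]
    simp only [Category.assoc]
    rw [← NatTrans.comp_app, ← MonoidalClosed.pre_map, Hom.func_comm, MonoidalClosed.pre_map,
      NatTrans.comp_app, MonoidalClosed.pre_comm_ihom_map, reassoc_of% this]
  rel R := by
    obtain ⟨l, hl⟩ := (homι_compat B C).rel R
    obtain ⟨m, hm⟩ := Hom.rel_comm g R
    refine ⟨l ≫ (MonoidalClosed.pre m).app _, ?_⟩
    simp only [Category.assoc]
    rw [← Category.assoc ((MonoidalClosed.pre (Hom.map g)).app _), pre_powAct, Category.assoc,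
      ← NatTrans.comp_app, ← MonoidalClosed.pre_map, ← hm, MonoidalClosed.pre_map,
      NatTrans.comp_app, MonoidalClosed.pre_comm_ihom_map, reassoc_of% hl]

/-- Precomposition `Str(L)(g, C) : Str(L)(B, C) ⟶ Str(L)(A, C)`. -/
noncomputable def homPre {A B : Str S L} (g : A ⟶ B) (C : Str S L) : homObj B C ⟶ homObj A C :=
  (compat_pre g C).lift

/-- The functor `Str(L)(A, -)`, with values in `V`. -/
@[simps]
noncomputable def homFunctor (A : Str S L) : Str S L ⥤ V where
  obj B := homObj A B
  map k := (compat_post A k).lift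
  map_id B := by
    rw [← cancel_mono (homι A B)]
    simp
  map_comp k k' := by
    rw [← cancel_mono (homι A _), Category.assoc, Compat.lift_ι, Compat.lift_ι, ← Category.assoc,
      Compat.lift_ι, comp_map, Functor.map_comp, Category.assoc]

/-- `A` is a `lam`-presentable object of the `V`-category of `L`-structures: `Str(L)(A, -)`
preserves `lam`-filtered colimits. -/
def IsPresentable (lam : Cardinal.{w}) [Fact lam.IsRegular] (A : Str S L) : Prop :=
  (homFunctor A).IsCardinalAccessible lam

/-- The inclusion of `L`-structures with respect to `(E, M)` into `L`-structures with respect to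
`(E₀, M₀)`, when `E₀ ⊆ E`. -/
def incl {S₀ S : FactSystem V} (h : S₀.E ≤ S.E) (A : Str S L) : Str S₀ L where
  carrier := A.carrier
  func := A.func
  rel := A.rel
  relι := A.relι
  relι_mem R := FactSystem.right_le h _ (A.relι_mem R)

end Str

/-! ## Terms and formulas -/

/-- `lam`-ary terms of the language `L`; a member of `Term L lam X Y` is an `(X, Y)`-ary term. -/
inductive Term {V : Type u} [Category.{w} V] [MonoidalCategory V] [HasColimits V]
    (L : Language V) (lam : Cardinal.{w}) [Fact lam.IsRegular] : V → V → Type (max u (w + 1))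
  /-- every morphism `Y ⟶ X` of `V_lam` is an `(X, Y)`-ary term -/
  | ofHom {X Y : V} (hX : IsCardinalPresentable X lam) (hY : IsCardinalPresentable Y lam)
      (g : Y ⟶ X) : Term L lam X Y
  /-- every function symbol is a term -/
  | symb (f : L.Func) : Term L lam (L.dom f) (L.cod f)
  /-- the power `t^Z` of a term -/
  | pow {X Y : V} (Z : V) (hZ : IsCardinalPresentable Z lam) (t : Term L lam X Y) :
      Term L lam (X ⊗ Z) (Y ⊗ Z)
  /-- superposition `s(t)` -/
  | comp {X Y Z : V} (t : Term L lam X Y) (s : Term L lam Y Z) : Term L lam X Z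
  /-- tuples of fewer than `lam` terms -/
  | tuple {X : V} {J : Type w} (hJ : Cardinal.mk J < lam) (Y : J → V)
      (t : ∀ j, Term L lam X (Y j)) : Term L lam X (∐ Y)

/-- Formulas built from atomic formulas by conjunctions of fewer than `lam` formulas, existential
quantification over variables of `lam`-presentable arity, and disjunctions of fewer than `kap`
formulas (`kap = ⊤` means no bound). A member of `Formula L lam kap X` has arity `X`. For
`kap = lam` and `lam`-ary `L` these are the formulas of `L_{lam lam}`. -/
inductive Formula {V : Type u} [Category.{w} V] [MonoidalCategory V] [HasColimits V]
    (L : Language V) (lam : Cardinal.{w}) [Fact lam.IsRegular] (kap : WithTop Cardinal.{w}) :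
    V → Type (max u (w + 1))
  /-- `s(x) = t(x)` -/
  | eq {X Y : V} (s t : Term L lam X Y) : Formula L lam kap X
  /-- `R^Y(t(z))` -/
  | rel {Z : V} (R : L.Rel) (Y : V) (hY : IsCardinalPresentable Y lam)
      (t : Term L lam Z (L.ar R ⊗ Y)) : Formula L lam kap Z
  | conj {X : V} {J : Type w} (hJ : Cardinal.mk J < lam) (φ : J → Formula L lam kap X) :
      Formula L lam kap X
  /-- `(∃ y : Y) ψ(x, y)` -/
  | ex {X : V} (Y : V) (hY : IsCardinalPresentable Y lam) (ψ : Formula L lam kap (X ⨿ Y)) :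
      Formula L lam kap X
  | disj {X : V} {J : Type w} (hJ : (Cardinal.mk J : WithTop Cardinal.{w}) < kap)
      (φ : J → Formula L lam kap X) : Formula L lam kap X

section Presentable

variable {V : Type u} [Category.{w} V] [HasColimits V] {lam : Cardinal.{w}} [Fact lam.IsRegular]

lemma presentable_coprod {X Y : V} (hX : IsCardinalPresentable X lam)
    (hY : IsCardinalPresentable Y lam) : IsCardinalPresentable (X ⨿ Y) lam := by
  have h : lam.IsRegular := Fact.out
  have (k : Discrete WalkingPair) : IsCardinalPresentable ((pair X Y).obj k) lam := by
    rcases k with ⟨_ | _⟩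
    · exact hX
    · exact hY
  exact isCardinalPresentable_of_isColimit _ (coprodIsCoprod X Y) lam
    (hasCardinalLT_of_finite _ _ h.aleph0_le)

lemma mk_bool_lt : Cardinal.mk (ULift.{w} Bool) < lam := by
  have h : lam.IsRegular := Fact.out
  exact lt_of_lt_of_le (Cardinal.lt_aleph0_of_finite _) h.aleph0_le

end Presentable

namespace Formula

variable {V : Type u} [Category.{w} V] [MonoidalCategory V] [HasColimits V]
  {L : Language V} {lam : Cardinal.{w}} [Fact lam.IsRegular] {kap : WithTop Cardinal.{w}}

/-- Substitution along `f : X ⟶ X'`: the formula `φ(f(x'))`, where `φ(x)` is a formula in the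
variable `x : X`, as a formula in the variable `x' : X'`. -/
noncomputable def subst : {X : V} → Formula L lam kap X → {X' : V} →
    IsCardinalPresentable X lam → IsCardinalPresentable X' lam → (X ⟶ X') → Formula L lam kap X'
  | _, eq s t, _, hX, hX', f => eq (.comp (.ofHom hX' hX f) s) (.comp (.ofHom hX' hX f) t)
  | _, rel R Y hY t, _, hX, hX', f => rel R Y hY (.comp (.ofHom hX' hX f) t)
  | _, conj hJ φ, _, hX, hX', f => conj hJ fun j => (φ j).subst hX hX' f
  | _, ex Y hY ψ, _, hX, hX', f => ex Y hY
      (ψ.subst (presentable_coprod hX hY) (presentable_coprod hX' hY) (coprod.map f (𝟙 Y)))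
  | _, disj hJ φ, _, hX, hX', f => disj hJ fun j => (φ j).subst hX hX' f

/-- Binary conjunction. -/
def and {X : V} (φ ψ : Formula L lam kap X) : Formula L lam kap X :=
  conj (J := ULift.{w} Bool) mk_bool_lt fun b => cond b.down φ ψ

/-- `φ` is a conjunction of atomic formulas. -/
inductive IsConjAtomic : {X : V} → Formula L lam kap X → Prop
  | eq {X Y : V} (s t : Term L lam X Y) : IsConjAtomic (Formula.eq s t)
  | rel {Z : V} (R : L.Rel) (Y : V) (hY : IsCardinalPresentable Y lam)
      (t : Term L lam Z (L.ar R ⊗ Y)) : IsConjAtomic (Formula.rel R Y hY t)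
  | conj {X : V} {J : Type w} (hJ : Cardinal.mk J < lam) (φ : J → Formula L lam kap X)
      (h : ∀ j, IsConjAtomic (φ j)) : IsConjAtomic (Formula.conj hJ φ)

end Formula

/-! ## Interpretation and satisfaction -/

section Interp

variable {V : Type u} [Category.{w} V] [MonoidalCategory V] [SymmetricCategory V]
  [MonoidalClosed V] [HasLimits V] [HasColimits V] {S : FactSystem V}
  {L : Language V} {lam : Cardinal.{w}} [Fact lam.IsRegular] {kap : WithTop Cardinal.{w}}

/-- The interpretation `t_A : A^X ⟶ A^Y` of an `(X, Y)`-ary term. -/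
noncomputable def Term.eval (A : Str S L) : {X Y : V} → Term L lam X Y →
    ((ihom X).obj A.carrier ⟶ (ihom Y).obj A.carrier)
  | _, _, .ofHom _ _ g => (MonoidalClosed.pre g).app A.carrier
  | _, _, .symb f => A.func f
  | _, _, .pow Z _ t => powCurry _ Z A.carrier ≫ (ihom Z).map (t.eval A) ≫
      powUncurry _ Z A.carrier
  | _, _, .comp t s => t.eval A ≫ s.eval A
  | _, _, .tuple _ Y t => powTuple Y fun j => (t j).eval A

/-- The interpretation `φ_A ⟶ A^X` of an `X`-ary formula. -/
noncomputable def Formula.interp (A : Str S L) : {X : V} → Formula L lam kap X →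
    Over ((ihom X).obj A.carrier)
  | _, .eq s t => Over.mk (S.imι (equalizer.ι (s.eval A) (t.eval A)))
  | _, .rel R Y _ t => Over.mk (pullback.fst (t.eval A)
      ((ihom Y).map (A.relι R) ≫ powUncurry (L.ar R) Y A.carrier))
  | _, .conj _ φ => Over.mk (WidePullback.base fun j => ((φ j).interp A).hom)
  | _, .ex _ _ ψ => Over.mk (S.imι ((ψ.interp A).hom ≫
      (MonoidalClosed.pre coprod.inl).app A.carrier))
  | _, .disj _ φ => Over.mk (S.imι (Sigma.desc fun j => ((φ j).interp A).hom))

/-- `A` satisfies the sequent `(∀ x)(φ(x) ⊢ ψ(x))`: `φ_A ⊆ ψ_A` as subobjects of `A^X`. -/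
def Str.Satisfies (A : Str S L) {X : V} (φ ψ : Formula L lam kap X) : Prop :=
  Nonempty (φ.interp A ⟶ ψ.interp A)

end Interp

/-! ## The axioms, cone-injectivity, and the assumption for the converse -/

section Main

variable {V : Type u} [Category.{w} V] [MonoidalCategory V] [SymmetricCategory V]
  [MonoidalClosed V] [HasLimits V] [HasColimits V]

/-- The data of a sequent `(∀ x)(φ(x) ⊢ ⋁_j (∃ y_j)(ψ_j(x, y_j) ∧ φ(x)))`, where `φ` and the `ψ_j`
are conjunctions of atomic formulas. -/
structure ConeAxiom (L : Language V) (lam : Cardinal.{w}) [Fact lam.IsRegular]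
    (kap : WithTop Cardinal.{w}) where
  X : V
  hX : IsCardinalPresentable X lam
  φ : Formula L lam kap X
  hφ : φ.IsConjAtomic
  J : Type w
  hJ : (Cardinal.mk J : WithTop Cardinal.{w}) < kap
  Y : J → V
  hY : ∀ j, IsCardinalPresentable (Y j) lam
  ψ : ∀ j, Formula L lam kap (X ⨿ Y j)
  hψ : ∀ j, (ψ j).IsConjAtomic

/-- The right-hand side `⋁_j (∃ y_j)(ψ_j(x, y_j) ∧ φ(x))`. -/
noncomputable def ConeAxiom.rhs {L : Language V} {lam : Cardinal.{w}} [Fact lam.IsRegular]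
    {kap : WithTop Cardinal.{w}} (a : ConeAxiom L lam kap) : Formula L lam kap a.X :=
  .disj a.hJ fun j => .ex (a.Y j) (a.hY j)
    ((a.ψ j).and (a.φ.subst a.hX (presentable_coprod a.hX (a.hY j)) coprod.inl))

/-- A class of structures (a full subcategory) is the class `Mod(T)` of models of a theory `T`, a
small set of axioms of the above form. -/
def IsConeAxiomatizable {S : FactSystem V} {L : Language V} (lam : Cardinal.{w})
    [Fact lam.IsRegular] (kap : WithTop Cardinal.{w}) (𝒜 : ObjectProperty (Str S L)) : Prop :=
  ∃ (ι : Type w) (T : ι → ConeAxiom L lam kap),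
    ∀ K : Str S L, 𝒜 K ↔ ∀ i, K.Satisfies (T i).φ (T i).rhs

/-- A cone `(h_j : A ⟶ B_j)_{j ∈ J}` of `lam`-presentable structures, with `|J| < kap`. -/
structure StrCone (S : FactSystem V) (L : Language V) (lam : Cardinal.{w}) [Fact lam.IsRegular]
    (kap : WithTop Cardinal.{w}) where
  A : Str S L
  hA : A.IsPresentable lam
  J : Type w
  hJ : (Cardinal.mk J : WithTop Cardinal.{w}) < kap
  B : J → Str S L
  hB : ∀ j, (B j).IsPresentable lam
  h : ∀ j, A ⟶ B j

/-- `K` is injective with respect to the cone `c`: the induced map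
`∑_j Str(L)(B_j, K) ⟶ Str(L)(A, K)` is in `E`. -/
def StrCone.Injective {S : FactSystem V} {L : Language V} {lam : Cardinal.{w}}
    [Fact lam.IsRegular] {kap : WithTop Cardinal.{w}} (c : StrCone S L lam kap)
    (K : Str S L) : Prop :=
  S.E (Sigma.desc fun j => Str.homPre (c.h j) K)

/-- A class of structures is a `(lam, E)`-cone-injectivity class, for a small set of cones
with fewer than `kap` members each. -/
def IsConeInjectivityClass {S : FactSystem V} {L : Language V} (lam : Cardinal.{w})
    [Fact lam.IsRegular] (kap : WithTop Cardinal.{w}) (𝒜 : ObjectProperty (Str S L)) : Prop :=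
  ∃ (ι : Type w) (H : ι → StrCone S L lam kap),
    ∀ K : Str S L, 𝒜 K ↔ ∀ i, (H i).Injective K

/-- The assumption under which presentable structures have presentation formulas. There is a proper
enriched factorization system `(E₀, M₀)` with `M₀` closed under `lam`-filtered colimits such that:
either `L` is relational, or the function symbols of `L` have `E₀`-stable input arities, the
relation symbols have `E₀`-stable arities, and `V_lam` has an `E₀`-generator of `E₀`-projective
objects; moreover `E₀ ⊆ E`, and the inclusion of the structures for `(E, M)` into those for
`(E₀, M₀)` preserves `lam`-presentable objects. -/
def PresentationAssumption (S : FactSystem V) (L : Language V) (lam : Cardinal.{w})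
    [Fact lam.IsRegular] : Prop :=
  ∃ S₀ : FactSystem V, S₀.IsProper ∧ S₀.ClosedUnderFiltered lam ∧
    (IsEmpty L.Func ∨
      ((∀ f, S₀.Stable (L.dom f)) ∧ (∀ R, S₀.Stable (L.ar R)) ∧ S₀.HasProjectiveGenerator lam)) ∧
    ∃ h : S₀.E ≤ S.E, ∀ A : Str S L, A.IsPresentable lam → (A.incl h).IsPresentable lam

end Main

end EnrLogic

/-! The two sides meet in presentations. A conjunction of atomic formulas `φ` in a variable of arity
`X` presents a structure `B` with generic element `x` when morphisms from `B` to `K` correspond to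
`X`-ary elements of `K` satisfying `φ`. This universal property concerns ordinary morphisms only,
but structures have powers `K^W` in which formulas are evaluated pointwise. Applying it to all `K^W`
identifies `Str(L)(B, K)` with the interpretation of `φ` in `K`, as a subobject of `K^X`
(`IsPres.exists_iso`).

If `B` is presented by `φ` and `B_j` by `ψ_j ∧ φ`, the cone map from the sum of the `Str(L)(B_j, K)`
to `Str(L)(B, K)` becomes the projection from the sum of the interpretations of `ψ_j ∧ φ` to that of
`φ`. By orthogonality it is in `E` exactly when the interpretation of `φ` is contained in the image
of that sum in `K^X`, which is the right-hand side of the axiom (`FactSystem.E_iff_factors`,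
`ConeAxiom.injective_iff`). What remains is to translate between presentable structures and
formulas.

From formulas to structures: structures are reflective in a cocomplete category of partial
structures, so free structures and colimits exist, and every conjunction of atomic formulas presents
some structure (`Formula.IsConjAtomic.exists_isPres`). It is presentable because the truth of such a
formula in a filtered colimit is witnessed at a stage (`IsPres.isPresentable`).

From structures to formulas: the presentable structures form the closure under small enough colimits
of a strong generator whose members have presentations. A colimit of presented structures is
presented once the transition maps can be written as equations, that is, once enough elements of a
presented structure are values of terms at its generic element (`IsTermCover`). In the relational
case the carrier itself can serve as the variable. Otherwise the image of all term values is a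
substructure containing the generic element, so its inclusion splits, and projectivity lifts
elements to term values (`IsPres.exists_term`). -/

namespace EnrLogic

open MonoidalClosed (curry uncurry curry_natural_right)

/-! ### Calculus of orthogonal factorization systems -/

namespace FactSystem

variable {V : Type u} [Category.{w} V] [MonoidalCategory V] (S : FactSystem V)

/-- A monomorphism with the right lifting property against `E` belongs to `M`. -/
lemma M_of_lift {C D : V} (m : C ⟶ D) [Mono m]
    (h : ∀ {A B : V} (e : A ⟶ B), S.E e → ∀ (a : A ⟶ C) (b : B ⟶ D), a ≫ m = e ≫ b →
      ∃ d : B ⟶ C, d ≫ m = b) : S.M m := by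
  obtain ⟨he, hi, hf⟩ := S.im_spec m
  -- Lifting `m` against the `E`-part of its own factorization inverts that part, so `m` is
  -- isomorphic to its `M`-part.
  obtain ⟨d, hd⟩ := h (S.toIm m) he (𝟙 C) (S.imι m) (by simp [hf])
  have : Mono (S.imι m) := S.M_mono _ hi
  have h1 : S.toIm m ≫ d = 𝟙 _ := by
    rw [← cancel_mono m, Category.assoc, hd, hf, Category.id_comp]
  have h2 : d ≫ S.toIm m = 𝟙 _ := by
    rw [← cancel_mono (S.imι m), Category.assoc, hf, hd, Category.id_comp]
  have : IsIso (S.toIm m) := ⟨d, h1, h2⟩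
  have := S.M_respectsIso
  have h4 := (S.M.cancel_left_of_respectsIso (S.toIm m) (S.imι m)).2 hi
  rwa [hf] at h4

/-- A morphism with the left lifting property against `M` belongs to `E`. -/
lemma E_of_lift {A B : V} (e : A ⟶ B)
    (h : ∀ {C D : V} (m : C ⟶ D), S.M m → ∀ (a : A ⟶ C) (b : B ⟶ D), a ≫ m = e ≫ b →
      ∃ d : B ⟶ C, d ≫ m = b) : S.E e := by
  obtain ⟨he, hi, hf⟩ := S.im_spec e
  obtain ⟨d, hd⟩ := h (S.imι e) hi (S.toIm e) (𝟙 B) (by simp [hf])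
  have : Mono (S.imι e) := S.M_mono _ hi
  have h2 : S.imι e ≫ d = 𝟙 _ := by
    rw [← cancel_mono (S.imι e), Category.assoc, hd, Category.id_comp, Category.comp_id]
  have : IsIso (S.imι e) := ⟨d, h2, hd⟩
  have := S.E_respectsIso
  have h4 := (S.E.cancel_right_of_respectsIso (S.toIm e) (S.imι e)).2 he
  rwa [hf] at h4

lemma exists_lift {A B C D : V} {e : A ⟶ B} {m : C ⟶ D} (he : S.E e) (hm : S.M m)
    (a : A ⟶ C) (b : B ⟶ D) (h : a ≫ m = e ≫ b) : ∃ d : B ⟶ C, e ≫ d = a ∧ d ≫ m = b :=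
  (S.orth e m he hm a b h).exists

lemma E_of_isIso {A B : V} (e : A ⟶ B) [IsIso e] : S.E e :=
  S.E_of_lift e fun m _ a b h => ⟨inv e ≫ a, by simp [h]⟩

lemma M_of_isIso {A B : V} (m : A ⟶ B) [IsIso m] : S.M m :=
  S.M_of_lift m fun _ _ _ b _ => ⟨b ≫ inv m, by simp⟩

lemma E_comp {A B C : V} {e : A ⟶ B} {e' : B ⟶ C} (he : S.E e) (he' : S.E e') :
    S.E (e ≫ e') := by
  refine S.E_of_lift _ fun m hm a b h => ?_
  obtain ⟨d, -, hd⟩ := S.exists_lift he hm a (e' ≫ b) (by simpa using h)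
  obtain ⟨d', -, hd'⟩ := S.exists_lift he' hm d b hd
  exact ⟨d', hd'⟩

lemma E_sigmaMap {J : Type w} {A B : J → V} [HasCoproduct A] [HasCoproduct B]
    (e : ∀ j, A j ⟶ B j) (he : ∀ j, S.E (e j)) : S.E (Limits.Sigma.map e) := by
  refine S.E_of_lift _ fun m hm a b h => ?_
  have (j : J) : ∃ d, d ≫ m = Sigma.ι B j ≫ b := by
    obtain ⟨d, -, hd⟩ := S.exists_lift (he j) hm (Sigma.ι A j ≫ a) (Sigma.ι B j ≫ b)
      (by rw [Category.assoc, h]; simp)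
    exact ⟨d, hd⟩
  choose d hd using this
  exact ⟨Sigma.desc d, by ext j; simp [hd]⟩

lemma M_comp {A B C : V} {m : A ⟶ B} {m' : B ⟶ C} (hm : S.M m) (hm' : S.M m') :
    S.M (m ≫ m') := by
  have := S.M_mono _ hm
  have := S.M_mono _ hm'
  refine S.M_of_lift _ fun e he a b h => ?_
  obtain ⟨d, hd, hd2⟩ := S.exists_lift he hm' (a ≫ m) b (by simpa using h)
  obtain ⟨d', -, hd'⟩ := S.exists_lift he hm a d hd.symm
  exact ⟨d', by rw [reassoc_of% hd', hd2]⟩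

lemma M_pullback_fst [HasPullbacks V] {A B C : V} (f : A ⟶ C) {m : B ⟶ C} (hm : S.M m) :
    S.M (pullback.fst f m) := by
  have := S.M_mono _ hm
  refine S.M_of_lift _ fun e he a b h => ?_
  obtain ⟨d, -, hd⟩ := S.exists_lift he hm (a ≫ pullback.snd f m) (b ≫ f)
    (by rw [Category.assoc, ← pullback.condition, reassoc_of% h])
  exact ⟨pullback.lift b d hd.symm, pullback.lift_fst _ _ _⟩

lemma M_widePullback_base [HasLimits V] {J : Type w} {B : V} (A : J → V) (m : ∀ j, A j ⟶ B)
    (hm : ∀ j, S.M (m j)) : S.M (WidePullback.base m) := by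
  have (j : J) := S.M_mono _ (hm j)
  have : Mono (WidePullback.base m) := by
    refine ⟨fun g h e => WidePullback.hom_ext _ _ _ (fun j => ?_) e⟩
    rw [← cancel_mono (m j), Category.assoc, Category.assoc, WidePullback.π_arrow, e]
  refine S.M_of_lift _ fun e he a b h => ?_
  have (j : J) : ∃ d, d ≫ m j = b := by
    obtain ⟨d, -, hd⟩ := S.exists_lift he (hm j) (a ≫ WidePullback.π m j) b
      (by rw [Category.assoc, WidePullback.π_arrow, h])
    exact ⟨d, hd⟩
  choose d hd using this
  exact ⟨WidePullback.lift b d hd, WidePullback.lift_base _ _ _ _⟩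

/-- Properness is what makes this work: maps in `E` are epi, so if `e ≫ b` equalizes `f` and `g`,
then so does `b`. -/
lemma M_equalizer (hS : S.IsProper) {A B : V} (f g : A ⟶ B) [HasEqualizer f g] :
    S.M (equalizer.ι f g) := by
  refine S.M_of_lift _ fun e he a b h => ?_
  have := hS e he
  refine ⟨equalizer.lift b ?_, equalizer.lift_ι _ _⟩
  rw [← cancel_epi e, ← reassoc_of% h, ← reassoc_of% h, equalizer.condition]

/-- By transposition, a lifting problem for `e` against `[X, m]` is one for `X ◁ e` against `m`. -/
lemma M_ihom_map [MonoidalClosed V] (X : V) {A B : V} {m : A ⟶ B} (hm : S.M m) :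
    S.M ((ihom X).map m) := by
  have := S.M_mono _ hm
  refine S.M_of_lift _ fun e he a b h => ?_
  obtain ⟨d, -, hd⟩ := S.exists_lift (S.E_tensor X e he) hm (MonoidalClosed.uncurry a)
    (MonoidalClosed.uncurry b) (by
      rw [← MonoidalClosed.uncurry_natural_right, h, MonoidalClosed.uncurry_natural_left])
  exact ⟨MonoidalClosed.curry d, by
    rw [← MonoidalClosed.curry_natural_right, hd, MonoidalClosed.curry_uncurry]⟩

lemma isIso_toIm {A B : V} {f : A ⟶ B} (hf : S.M f) : IsIso (S.toIm f) := by
  obtain ⟨he, hi, h⟩ := S.im_spec f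
  have := S.M_mono _ hf
  have := S.M_mono _ hi
  obtain ⟨d, hd, hd'⟩ := S.exists_lift he hf (𝟙 _) (S.imι f) (by simp [h])
  exact ⟨d, hd, by rw [← cancel_mono (S.imι f), Category.assoc, h, hd', Category.id_comp]⟩

/-- If `p ≫ m = e ≫ r` with `m`, `r` in `M` and `e` in `E`, then `p` is in `E` if and only if
`m` factors through `r`. -/
lemma E_iff_factors {Q A B T : V} {p : Q ⟶ A} {m : A ⟶ T} {e : Q ⟶ B} {r : B ⟶ T}
    (hm : S.M m) (he : S.E e) (hr : S.M r) (h : p ≫ m = e ≫ r) :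
    S.E p ↔ ∃ d : A ⟶ B, d ≫ r = m := by
  have := S.M_mono _ hm
  have := S.M_mono _ hr
  constructor
  · intro hp
    obtain ⟨d, -, hd⟩ := S.exists_lift hp hr e m h.symm
    exact ⟨d, hd⟩
  · rintro ⟨d, hd⟩
    refine S.E_of_lift _ fun n hn a b hab => ?_
    have hdp : p ≫ d = e := by rw [← cancel_mono r, Category.assoc, hd, h]
    -- The lift `x` of `e` against `m` is a retraction of `d`, so lifts for `e` against `n` yield
    -- lifts for `p` after precomposition with `d`.
    obtain ⟨x, hx, hx'⟩ := S.exists_lift he hm p r h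
    have hdx : d ≫ x = 𝟙 _ := by rw [← cancel_mono m, Category.assoc, hx', hd, Category.id_comp]
    obtain ⟨y, -, hy⟩ := S.exists_lift he hn a (x ≫ b) (by rw [hab, reassoc_of% hx])
    exact ⟨d ≫ y, by rw [Category.assoc, hy, reassoc_of% hdx]⟩

end FactSystem

/-! ## Parametrised elements -/

section Param

variable {V : Type u} [Category.{w} V] [MonoidalCategory V] [MonoidalClosed V]

/-- The action of a map `A^X ⟶ A^Y` on `X`-ary elements of `A` with parameters in `U`. -/
noncomputable def actOf {X Y A : V} (k : (ihom X).obj A ⟶ (ihom Y).obj A) {U : V}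
    (a : X ⊗ U ⟶ A) : Y ⊗ U ⟶ A :=
  uncurry (curry a ≫ k)

lemma curry_actOf {X Y A : V} (k : (ihom X).obj A ⟶ (ihom Y).obj A) {U : V}
    (a : X ⊗ U ⟶ A) : curry (actOf k a) = curry a ≫ k :=
  MonoidalClosed.curry_uncurry _

lemma actOf_whisker {X Y A : V} (k : (ihom X).obj A ⟶ (ihom Y).obj A) {U U' : V}
    (u : U' ⟶ U) (a : X ⊗ U ⟶ A) : actOf k (X ◁ u ≫ a) = Y ◁ u ≫ actOf k a := by
  unfold actOf
  rw [MonoidalClosed.curry_natural_left, Category.assoc, MonoidalClosed.uncurry_natural_left]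

lemma actOf_comp {X Y Z A : V} (k : (ihom X).obj A ⟶ (ihom Y).obj A)
    (k' : (ihom Y).obj A ⟶ (ihom Z).obj A) {U : V} (a : X ⊗ U ⟶ A) :
    actOf (k ≫ k') a = actOf k' (actOf k a) := by
  simp [actOf, MonoidalClosed.curry_uncurry]

lemma actOf_pre {X Y A : V} (g : Y ⟶ X) {U : V} (a : X ⊗ U ⟶ A) :
    actOf ((MonoidalClosed.pre g).app A) a = g ▷ U ≫ a := by
  rw [actOf, MonoidalClosed.uncurry_pre_app, MonoidalClosed.uncurry_curry]

/-- The evaluation `X ⊗ A^X ⟶ A`, as the generic `X`-ary element of `A`. -/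
noncomputable def evE (X A : V) : X ⊗ (ihom X).obj A ⟶ A := uncurry (𝟙 _)

lemma curry_evE (X A : V) : curry (evE X A) = 𝟙 _ := MonoidalClosed.curry_uncurry _

lemma whisker_evE {X U A : V} (w : U ⟶ (ihom X).obj A) : X ◁ w ≫ evE X A = uncurry w := by
  rw [evE, ← MonoidalClosed.uncurry_natural_left, Category.comp_id]

lemma whisker_curry_evE {X U A : V} (a : X ⊗ U ⟶ A) : X ◁ curry a ≫ evE X A = a := by
  rw [whisker_evE, MonoidalClosed.uncurry_curry]

lemma actOf_evE {X Y A : V} (k : (ihom X).obj A ⟶ (ihom Y).obj A) :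
    actOf k (evE X A) = uncurry k := by
  rw [actOf, curry_evE, Category.id_comp]

/-- Yoneda: an operation is determined by its value at the generic element `evE X A`. -/
lemma actOf_eq {X Y A : V} (k : (ihom X).obj A ⟶ (ihom Y).obj A) {U : V}
    (a : X ⊗ U ⟶ A) : actOf k a = Y ◁ curry a ≫ actOf k (evE X A) := by
  rw [← actOf_whisker, whisker_curry_evE]

lemma curry_comp_map {X A B U : V} (a : X ⊗ U ⟶ A) (g : A ⟶ B) :
    curry (a ≫ g) = curry a ≫ (ihom X).map g :=
  MonoidalClosed.curry_natural_right _ _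

lemma actOf_natural {X Y A B : V} {k : (ihom X).obj A ⟶ (ihom Y).obj A}
    {k' : (ihom X).obj B ⟶ (ihom Y).obj B} {g : A ⟶ B}
    (h : k ≫ (ihom Y).map g = (ihom X).map g ≫ k') {U : V} (a : X ⊗ U ⟶ A) :
    actOf k' (a ≫ g) = actOf k a ≫ g := by
  rw [actOf, curry_comp_map, Category.assoc, ← h, ← Category.assoc,
    MonoidalClosed.uncurry_natural_right, actOf]

lemma comm_of_actOf {X Y A B : V} {k : (ihom X).obj A ⟶ (ihom Y).obj A}
    {k' : (ihom X).obj B ⟶ (ihom Y).obj B} {g : A ⟶ B}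
    (h : actOf k' (evE X A ≫ g) = actOf k (evE X A) ≫ g) :
    k ≫ (ihom Y).map g = (ihom X).map g ≫ k' := by
  have h2 := congrArg curry h
  rw [curry_comp_map, curry_actOf, curry_actOf, curry_comp_map, curry_evE, Category.id_comp,
    Category.id_comp] at h2
  exact h2.symm

lemma comp_powCurry {X Z A W : V} (t : W ⟶ (ihom (X ⊗ Z)).obj A) :
    t ≫ powCurry X Z A = curry (curry ((α_ X Z W).inv ≫ uncurry t)) := by
  unfold powCurry
  rw [← MonoidalClosed.curry_natural_left, ← MonoidalClosed.curry_natural_left,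
    associator_inv_naturality_right_assoc, MonoidalClosed.uncurry_eq]

lemma comp_powUncurry {X Z A W : V} (t : W ⟶ (ihom Z).obj ((ihom X).obj A)) :
    t ≫ powUncurry X Z A = curry ((α_ X Z W).hom ≫ uncurry (uncurry t)) := by
  unfold powUncurry
  rw [← MonoidalClosed.curry_natural_left, associator_naturality_right_assoc,
    MonoidalClosed.uncurry_eq, MonoidalClosed.uncurry_eq]
  simp

/-- Raising an operation to the power `Z` only moves `Z` into the parameters. -/
lemma actOf_pow {X Y A : V} (Z : V) (k : (ihom X).obj A ⟶ (ihom Y).obj A) {U : V}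
    (a : (X ⊗ Z) ⊗ U ⟶ A) :
    actOf (powCurry X Z A ≫ (ihom Z).map k ≫ powUncurry Y Z A) a =
      (α_ Y Z U).hom ≫ actOf k ((α_ X Z U).inv ≫ a) := by
  rw [actOf, ← Category.assoc, comp_powCurry, ← Category.assoc, comp_powUncurry,
    MonoidalClosed.uncurry_curry, ← curry_comp_map, MonoidalClosed.uncurry_curry,
    MonoidalClosed.uncurry_curry, actOf]

section App

variable {X U W A B : V}

/-- Application of a `W`-parametrised map `A ⟶ B` to an `X`-ary element of `A`. -/
noncomputable def app (t : W ⟶ (ihom A).obj B) (a : X ⊗ U ⟶ A) : X ⊗ (U ⊗ W) ⟶ B :=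
  (α_ X U W).inv ≫ a ▷ W ≫ uncurry t

/-- Translates the enriched action on hom-objects into application at the generic element, so that
compatibility with symbols can be checked on elements. -/
lemma uncurry_comp_powAct (X : V) (t : W ⟶ (ihom A).obj B) :
    uncurry (t ≫ powAct X A B) = curry (app t (evE X A)) := by
  rw [MonoidalClosed.uncurry_natural_left, powAct, MonoidalClosed.uncurry_curry,
    MonoidalClosed.comp, ← MonoidalClosed.curry_natural_left, app, MonoidalClosed.uncurry_eq]
  congr 1
  simp only [MonoidalClosed.compTranspose]
  rw [associator_inv_naturality_right_assoc, whisker_exchange_assoc, evE,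
    MonoidalClosed.uncurry_id_eq_ev]
  rfl

lemma app_whiskerLeft {U' : V} (t : W ⟶ (ihom A).obj B) (u : U' ⟶ U) (a : X ⊗ U ⟶ A) :
    app t (X ◁ u ≫ a) = X ◁ (u ▷ W) ≫ app t a := by
  simp [app]

end App

variable [SymmetricCategory V]

lemma uncurry_swapHom {X Y A : V} (f : X ⟶ (ihom Y).obj A) :
    uncurry (swapHom f) = (β_ X Y).hom ≫ uncurry f :=
  MonoidalClosed.uncurry_curry _

lemma swapHom_swapHom {X Y A : V} (f : X ⟶ (ihom Y).obj A) : swapHom (swapHom f) = f := by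
  rw [swapHom, uncurry_swapHom, SymmetricCategory.symmetry_assoc, MonoidalClosed.curry_uncurry]

/-- Closedness makes tensoring preserve coproducts; the symmetry moves the coproduct to the side on
which one can curry. -/
lemma tensor_sigma_hom_ext [HasColimits V] {J : Type w} {Y : J → V} {U A : V}
    {a b : (∐ Y) ⊗ U ⟶ A} (h : ∀ j, Sigma.ι Y j ▷ U ≫ a = Sigma.ι Y j ▷ U ≫ b) : a = b := by
  rw [← cancel_epi (β_ U (∐ Y)).hom]
  apply MonoidalClosed.curry_injective
  ext j
  rw [← MonoidalClosed.curry_natural_left, ← MonoidalClosed.curry_natural_left,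
    BraidedCategory.braiding_naturality_right_assoc,
    BraidedCategory.braiding_naturality_right_assoc, h]

lemma ι_actOf_powTuple [HasColimits V] {J : Type w} (Y : J → V) {X A : V}
    (t : ∀ j, (ihom X).obj A ⟶ (ihom (Y j)).obj A) {U : V} (a : X ⊗ U ⟶ A) (j : J) :
    Sigma.ι Y j ▷ U ≫ actOf (powTuple Y t) a = actOf (t j) a := by
  rw [actOf, actOf, MonoidalClosed.uncurry_natural_left, powTuple, uncurry_swapHom,
    ← whisker_exchange_assoc, BraidedCategory.braiding_naturality_left_assoc,
    ← MonoidalClosed.uncurry_natural_left, Sigma.ι_desc, uncurry_swapHom,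
    SymmetricCategory.symmetry_assoc, ← MonoidalClosed.uncurry_natural_left]

end Param

/-! ### Elements of a power, read as elements with more parameters -/

section Swap

variable {V : Type u} [Category.{w} V] [MonoidalCategory V] [SymmetricCategory V]

/-- The symmetry `X ⊗ (W ⊗ U) ⟶ W ⊗ (X ⊗ U)`. -/
def midSwap (X W U : V) : X ⊗ (W ⊗ U) ⟶ W ⊗ (X ⊗ U) :=
  (α_ X W U).inv ≫ (β_ X W).hom ▷ U ≫ (α_ W X U).hom

lemma midSwap_midSwap (X W U : V) : midSwap X W U ≫ midSwap W X U = 𝟙 _ := by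
  simp [midSwap, ← comp_whiskerRight_assoc]

instance (X W U : V) : IsIso (midSwap X W U) :=
  ⟨midSwap W X U, midSwap_midSwap _ _ _, midSwap_midSwap _ _ _⟩

lemma midSwap_natural_left {X X' : V} (f : X ⟶ X') (W U : V) :
    f ▷ (W ⊗ U) ≫ midSwap X' W U = midSwap X W U ≫ W ◁ (f ▷ U) := by
  simp only [midSwap, Category.assoc]
  rw [associator_inv_naturality_left_assoc, ← comp_whiskerRight_assoc,
    BraidedCategory.braiding_naturality_left, comp_whiskerRight_assoc,
    associator_naturality_middle]

lemma midSwap_natural_right (X W : V) {U U' : V} (u : U ⟶ U') :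
    X ◁ (W ◁ u) ≫ midSwap X W U' = midSwap X W U ≫ W ◁ (X ◁ u) := by
  simp only [midSwap, Category.assoc]
  rw [associator_inv_naturality_right_assoc, whisker_exchange_assoc,
    associator_naturality_right]

lemma midSwap_assoc (X Z W U : V) :
    (α_ X Z (W ⊗ U)).inv ≫ midSwap (X ⊗ Z) W U ≫ W ◁ (α_ X Z U).hom =
      X ◁ midSwap Z W U ≫ midSwap X W (Z ⊗ U) := by
  simp only [midSwap, BraidedCategory.braiding_tensor_left_hom]
  monoidal

lemma midSwap_braiding (X W U : V) :
    midSwap X W U ≫ (β_ W (X ⊗ U)).hom = X ◁ (β_ W U).hom ≫ (α_ X U W).inv := by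
  simp only [midSwap, BraidedCategory.braiding_tensor_right_hom, Category.assoc]
  rw [Iso.hom_inv_id_assoc, ← comp_whiskerRight_assoc, SymmetricCategory.symmetry]
  simp

variable [MonoidalClosed V] {X Y W U A B : V}

/-- An `X`-ary element of `A^W` with parameters in `U`, as an element of `A` with parameters
in `W ⊗ U`. -/
noncomputable def flat (a : X ⊗ U ⟶ (ihom W).obj A) : X ⊗ (W ⊗ U) ⟶ A :=
  midSwap X W U ≫ uncurry a

/-- The inverse of `flat`. -/
noncomputable def unflat (b : X ⊗ (W ⊗ U) ⟶ A) : X ⊗ U ⟶ (ihom W).obj A :=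
  curry (midSwap W X U ≫ b)

lemma flat_unflat (b : X ⊗ (W ⊗ U) ⟶ A) : flat (unflat b) = b := by
  rw [flat, unflat, MonoidalClosed.uncurry_curry, ← Category.assoc, midSwap_midSwap,
    Category.id_comp]

lemma unflat_flat (a : X ⊗ U ⟶ (ihom W).obj A) : unflat (flat a) = a := by
  rw [flat, unflat, ← Category.assoc, midSwap_midSwap,
    Category.id_comp, MonoidalClosed.curry_uncurry]

lemma flat_injective {a a' : X ⊗ U ⟶ (ihom W).obj A} (h : flat a = flat a') : a = a' := by
  rw [← unflat_flat a, h, unflat_flat]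

lemma flat_whiskerRight {X' : V} (f : X' ⟶ X) (a : X ⊗ U ⟶ (ihom W).obj A) :
    flat (f ▷ U ≫ a) = f ▷ (W ⊗ U) ≫ flat a := by
  rw [flat, flat, MonoidalClosed.uncurry_natural_left, ← Category.assoc, ← Category.assoc,
    midSwap_natural_left]

lemma flat_whiskerLeft {U' : V} (u : U' ⟶ U) (a : X ⊗ U ⟶ (ihom W).obj A) :
    flat (X ◁ u ≫ a) = X ◁ (W ◁ u) ≫ flat a := by
  rw [flat, flat, MonoidalClosed.uncurry_natural_left, ← Category.assoc, ← Category.assoc,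
    midSwap_natural_right]

lemma flat_assoc_inv {Z : V} (a : (X ⊗ Z) ⊗ U ⟶ (ihom W).obj A) :
    X ◁ midSwap Z W U ≫ flat ((α_ X Z U).inv ≫ a) = (α_ X Z (W ⊗ U)).inv ≫ flat a := by
  rw [flat, flat, MonoidalClosed.uncurry_natural_left, ← Category.assoc, ← midSwap_assoc]
  simp [← whiskerLeft_comp_assoc]

lemma flat_assoc_hom {Z : V} (a : X ⊗ (Z ⊗ U) ⟶ (ihom W).obj A) :
    flat ((α_ X Z U).hom ≫ a) = (α_ X Z (W ⊗ U)).hom ≫ X ◁ midSwap Z W U ≫ flat a := by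
  have := flat_assoc_inv ((α_ X Z U).hom ≫ a)
  rw [Iso.inv_hom_id_assoc] at this
  rw [this, Iso.hom_inv_id_assoc]

lemma unflat_whiskerLeft {U' : V} (u : U' ⟶ U) (b : X ⊗ (W ⊗ U) ⟶ A) :
    unflat (X ◁ (W ◁ u) ≫ b) = X ◁ u ≫ unflat b := by
  apply flat_injective
  rw [flat_unflat, flat_whiskerLeft, flat_unflat]

/-- Relates the two readings of a `W`-indexed family of maps: as a single map `A ⟶ B^W`, and as the
application `app t`. -/
lemma flat_comp_swapHom (t : W ⟶ (ihom A).obj B) (a : X ⊗ U ⟶ A) :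
    flat (a ≫ swapHom t) = X ◁ (β_ W U).hom ≫ app t a := by
  rw [flat, MonoidalClosed.uncurry_natural_left, uncurry_swapHom, app,
    BraidedCategory.braiding_naturality_right_assoc, ← Category.assoc, midSwap_braiding,
    Category.assoc]

lemma swapHom_comp_pre {X B K W : V} (t : W ⟶ (ihom B).obj K) (x : X ⟶ B) :
    swapHom (t ≫ (MonoidalClosed.pre x).app K) = x ≫ swapHom t := by
  rw [swapHom, MonoidalClosed.uncurry_pre_app, ← BraidedCategory.braiding_naturality_right_assoc,
    MonoidalClosed.curry_natural_left]
  rfl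

end Swap

/-! ## Semantics of terms and conjunctions of atomic formulas -/

section Atomic

variable {V : Type u} [Category.{w} V] [MonoidalCategory V] [HasColimits V]
  {L : Language V} {lam : Cardinal.{w}} [Fact lam.IsRegular] {kap : WithTop Cardinal.{w}}

namespace Formula

lemma IsConjAtomic.and {X : V} {φ ψ : Formula L lam kap X} (hφ : φ.IsConjAtomic)
    (hψ : ψ.IsConjAtomic) : (φ.and ψ).IsConjAtomic := by
  refine .conj _ _ ?_
  rintro ⟨_ | _⟩
  · exact hψ
  · exact hφ

lemma IsConjAtomic.subst {X : V} {φ : Formula L lam kap X} (hφ : φ.IsConjAtomic) {X' : V}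
    (hX : IsCardinalPresentable X lam) (hX' : IsCardinalPresentable X' lam) (f : X ⟶ X') :
    (φ.subst hX hX' f).IsConjAtomic := by
  induction hφ with
  | eq s t => exact .eq _ _
  | rel R Y hY t => exact .rel _ _ _ _
  | conj hJ φ h ih => exact .conj _ _ fun j => ih j

end Formula

/-- Lets an equation between terms that holds in a filtered colimit be found at a stage. -/
lemma Term.isCardinalPresentable (hL : L.IsAry lam)
    (hT : ∀ X Y : V, IsCardinalPresentable X lam → IsCardinalPresentable Y lam →
      IsCardinalPresentable (X ⊗ Y) lam) {X Y : V} (t : Term L lam X Y) :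
    IsCardinalPresentable Y lam := by
  induction t with
  | ofHom hX hY f => exact hY
  | symb f => exact hL.cod f
  | pow Z hZ t ih => exact hT _ _ ih hZ
  | comp t s iht ihs => exact ihs
  | tuple hJ Y t ih =>
    rename_i J
    have (k : Discrete J) : IsCardinalPresentable ((Discrete.functor Y).obj k) lam := ih k.as
    exact isCardinalPresentable_of_isColimit _ (coproductIsCoproduct Y) lam (by
      rwa [hasCardinalLT_arrow_discrete_iff, hasCardinalLT_iff_cardinal_mk_lt])

end Atomic

section Sem

variable {V : Type u} [Category.{w} V] [MonoidalCategory V] [MonoidalClosed V]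
  {S : FactSystem V} {L : Language V}

namespace Str

/-- The relation `R` holds at a parametrised element. -/
def RelHolds (A : Str S L) (R : L.Rel) {U : V} (a : L.ar R ⊗ U ⟶ A.carrier) : Prop :=
  ∃ l : U ⟶ A.rel R, l ≫ A.relι R = curry a

lemma RelHolds.map {A B : Str S L} (g : A ⟶ B) {R : L.Rel} {U : V}
    {a : L.ar R ⊗ U ⟶ A.carrier} (h : A.RelHolds R a) : B.RelHolds R (a ≫ Hom.map g) := by
  obtain ⟨l, hl⟩ := h
  obtain ⟨m, hm⟩ := Hom.rel_comm g R
  exact ⟨l ≫ m, by rw [Category.assoc, hm, reassoc_of% hl, curry_comp_map]⟩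

lemma RelHolds.whisker {A : Str S L} {R : L.Rel} {U U' : V} (u : U' ⟶ U)
    {a : L.ar R ⊗ U ⟶ A.carrier} (h : A.RelHolds R a) : A.RelHolds R (L.ar R ◁ u ≫ a) := by
  obtain ⟨l, hl⟩ := h
  exact ⟨u ≫ l, by rw [Category.assoc, hl, MonoidalClosed.curry_natural_left]⟩

lemma relHolds_whisker_iff {A : Str S L} {R : L.Rel} {U U' : V} (u : U' ⟶ U) [IsIso u]
    {a : L.ar R ⊗ U ⟶ A.carrier} : A.RelHolds R (L.ar R ◁ u ≫ a) ↔ A.RelHolds R a := by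
  refine ⟨fun h => ?_, RelHolds.whisker u⟩
  have := h.whisker (inv u)
  rwa [← whiskerLeft_comp_assoc, IsIso.inv_hom_id, whiskerLeft_id, Category.id_comp] at this

end Str

variable [SymmetricCategory V] [HasColimits V] {lam : Cardinal.{w}} [Fact lam.IsRegular]
  {kap : WithTop Cardinal.{w}}

/-- The value of a term at a parametrised element. -/
noncomputable def Term.act {X Y : V} (t : Term L lam X Y) (A : Str S L) {U : V}
    (a : X ⊗ U ⟶ A.carrier) : Y ⊗ U ⟶ A.carrier :=
  actOf (t.eval A) a

namespace Term

lemma act_whisker {X Y : V} (t : Term L lam X Y) (A : Str S L) {U U' : V} (u : U' ⟶ U)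
    (a : X ⊗ U ⟶ A.carrier) : t.act A (X ◁ u ≫ a) = Y ◁ u ≫ t.act A a :=
  actOf_whisker _ _ _

@[simp]
lemma act_ofHom {X Y : V} (hX : IsCardinalPresentable X lam) (hY : IsCardinalPresentable Y lam)
    (g : Y ⟶ X) (A : Str S L) {U : V} (a : X ⊗ U ⟶ A.carrier) :
    (ofHom hX hY g : Term L lam X Y).act A a = g ▷ U ≫ a :=
  actOf_pre _ _

@[simp]
lemma act_symb (f : L.Func) (A : Str S L) {U : V} (a : L.dom f ⊗ U ⟶ A.carrier) :
    (symb f : Term L lam _ _).act A a = actOf (A.func f) a := rfl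

@[simp]
lemma act_pow {X Y : V} (Z : V) (hZ : IsCardinalPresentable Z lam) (t : Term L lam X Y)
    (A : Str S L) {U : V} (a : (X ⊗ Z) ⊗ U ⟶ A.carrier) :
    (pow Z hZ t).act A a = (α_ Y Z U).hom ≫ t.act A ((α_ X Z U).inv ≫ a) :=
  actOf_pow _ _ _

@[simp]
lemma act_comp {X Y Z : V} (t : Term L lam X Y) (s : Term L lam Y Z)
    (A : Str S L) {U : V} (a : X ⊗ U ⟶ A.carrier) :
    (comp t s).act A a = s.act A (t.act A a) :=
  actOf_comp _ _ _

@[simp]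
lemma ι_act_tuple {X : V} {J : Type w} (hJ : Cardinal.mk J < lam) (Y : J → V)
    (t : ∀ j, Term L lam X (Y j)) (A : Str S L) {U : V} (a : X ⊗ U ⟶ A.carrier) (j : J) :
    Sigma.ι Y j ▷ U ≫ (tuple hJ Y t).act A a = (t j).act A a :=
  ι_actOf_powTuple _ _ _ _

lemma act_map {X Y : V} (t : Term L lam X Y) {A B : Str S L} (g : A ⟶ B) {U : V}
    (a : X ⊗ U ⟶ A.carrier) : t.act B (a ≫ Str.Hom.map g) = t.act A a ≫ Str.Hom.map g := by
  induction t generalizing U with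
  | ofHom hX hY f => simp
  | symb f => exact actOf_natural (Str.Hom.func_comm g f) a
  | pow Z hZ t ih => simp [← ih]
  | comp t s iht ihs => simp [iht, ihs]
  | tuple hJ Y t ih =>
    refine tensor_sigma_hom_ext fun j => ?_
    rw [ι_act_tuple, ← Category.assoc, ι_act_tuple, ih]

end Term

variable [HasLimits V]

namespace Formula

/-- Satisfaction of a formula at a parametrised element. -/
def SatP {X : V} (φ : Formula L lam kap X) (A : Str S L) {U : V}
    (a : X ⊗ U ⟶ A.carrier) : Prop :=
  ∃ l : U ⟶ (φ.interp A).left, l ≫ (φ.interp A).hom = curry a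

lemma SatP.whisker {X : V} {φ : Formula L lam kap X} {A : Str S L} {U U' : V} (u : U' ⟶ U)
    {a : X ⊗ U ⟶ A.carrier} (h : φ.SatP A a) : φ.SatP A (X ◁ u ≫ a) := by
  obtain ⟨l, hl⟩ := h
  exact ⟨u ≫ l, by rw [Category.assoc, hl, MonoidalClosed.curry_natural_left]⟩

lemma satP_whisker_iff {X : V} {φ : Formula L lam kap X} {A : Str S L} {U U' : V} (u : U' ⟶ U)
    [IsIso u] {a : X ⊗ U ⟶ A.carrier} : φ.SatP A (X ◁ u ≫ a) ↔ φ.SatP A a := by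
  refine ⟨fun h => ?_, SatP.whisker u⟩
  have := h.whisker (inv u)
  rwa [← whiskerLeft_comp_assoc, IsIso.inv_hom_id, whiskerLeft_id, Category.id_comp] at this

/-- For a proper system the equalizer is already in `M`, so the image in the interpretation changes
nothing. -/
lemma satP_eq (hS : S.IsProper) {X Y : V} (s t : Term L lam X Y) (A : Str S L) {U : V}
    (a : X ⊗ U ⟶ A.carrier) :
    (eq s t : Formula L lam kap X).SatP A a ↔ s.act A a = t.act A a := by
  have hm := S.M_equalizer hS (s.eval A) (t.eval A)
  obtain ⟨d, -, hd⟩ := S.isIso_toIm hm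
  obtain ⟨-, -, hi⟩ := S.im_spec (equalizer.ι (s.eval A) (t.eval A))
  constructor
  · rintro ⟨l, hl⟩
    change l ≫ S.imι _ = _ at hl
    let p : U ⟶ S.im (equalizer.ι (s.eval A) (t.eval A)) := l
    have hp : p ≫ S.imι (equalizer.ι (s.eval A) (t.eval A)) = curry a := hl
    have hd' : d ≫ equalizer.ι (s.eval A) (t.eval A) = S.imι _ :=
      (congrArg (d ≫ ·) hi.symm).trans (by rw [← Category.assoc, hd, Category.id_comp])
    have : curry a = (p ≫ d) ≫ equalizer.ι (s.eval A) (t.eval A) := by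
      rw [← hp, Category.assoc, hd']
    apply MonoidalClosed.curry_injective
    rw [Term.act, Term.act, curry_actOf, curry_actOf, this]
    simp only [Category.assoc]
    exact congrArg (fun z => p ≫ d ≫ z) (equalizer.condition _ _)
  · intro h
    have h' : curry a ≫ s.eval A = curry a ≫ t.eval A := by
      rw [← curry_actOf, ← curry_actOf]
      exact congrArg curry h
    refine ⟨equalizer.lift _ h' ≫ S.toIm _, ?_⟩
    change (_ ≫ _) ≫ S.imι _ = _
    rw [Category.assoc, hi]
    exact equalizer.lift_ι _ _

/-- Under currying, the power `R^Y` with parameters in `U` is `R` itself with parameters in `Y ⊗ U`.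
-/
lemma satP_rel {Z : V} (R : L.Rel) (Y : V) (hY : IsCardinalPresentable Y lam)
    (t : Term L lam Z (L.ar R ⊗ Y)) (A : Str S L) {U : V} (a : Z ⊗ U ⟶ A.carrier) :
    (rel R Y hY t : Formula L lam kap Z).SatP A a ↔
      A.RelHolds R ((α_ (L.ar R) Y U).inv ≫ t.act A a) := by
  have key (l : U ⟶ (ihom Y).obj (A.rel R)) :
      curry a ≫ t.eval A = l ≫ (ihom Y).map (A.relι R) ≫ powUncurry (L.ar R) Y A.carrier ↔
      uncurry l ≫ A.relι R = curry ((α_ (L.ar R) Y U).inv ≫ t.act A a) := by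
    rw [← Category.assoc, comp_powUncurry, MonoidalClosed.uncurry_natural_right,
      ← curry_actOf, MonoidalClosed.curry_injective.eq_iff,
      ← Iso.inv_comp_eq, ← MonoidalClosed.curry_eq_iff]
    exact eq_comm
  constructor
  · rintro ⟨l, hl⟩
    let p : U ⟶ pullback (t.eval A) ((ihom Y).map (A.relι R) ≫ powUncurry (L.ar R) Y A.carrier) := l
    have hp : p ≫ pullback.fst _ _ = curry a := hl
    refine ⟨uncurry (p ≫ pullback.snd _ _), ?_⟩
    rw [← key, ← hp, Category.assoc, Category.assoc, pullback.condition]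
  · rintro ⟨l, hl⟩
    refine ⟨pullback.lift (curry a) (curry l) ?_, pullback.lift_fst _ _ _⟩
    rw [key, MonoidalClosed.uncurry_curry, hl]

lemma satP_conj {X : V} {J : Type w} (hJ : Cardinal.mk J < lam) (φ : J → Formula L lam kap X)
    (A : Str S L) {U : V} (a : X ⊗ U ⟶ A.carrier) :
    (conj hJ φ).SatP A a ↔ ∀ j, (φ j).SatP A a := by
  constructor
  · rintro ⟨l, hl⟩ j
    let p : U ⟶ widePullback _ (fun j => ((φ j).interp A).left)
      (fun j => ((φ j).interp A).hom) := l
    have hp : p ≫ WidePullback.base _ = curry a := hl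
    exact ⟨p ≫ WidePullback.π _ j, by rw [Category.assoc, WidePullback.π_arrow, hp]⟩
  · intro h
    choose l hl using h
    exact ⟨WidePullback.lift (curry a) l hl, WidePullback.lift_base _ _ _ _⟩

lemma satP_and {X : V} (φ ψ : Formula L lam kap X) (A : Str S L) {U : V}
    (a : X ⊗ U ⟶ A.carrier) : (φ.and ψ).SatP A a ↔ φ.SatP A a ∧ ψ.SatP A a := by
  rw [Formula.and, satP_conj]
  constructor
  · intro h
    exact ⟨h ⟨true⟩, h ⟨false⟩⟩
  · rintro ⟨h1, h2⟩ ⟨_ | _⟩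
    · exact h2
    · exact h1

lemma satP_subst (hS : S.IsProper) {X : V} {φ : Formula L lam kap X} (hφ : φ.IsConjAtomic)
    {X' : V} (hX : IsCardinalPresentable X lam) (hX' : IsCardinalPresentable X' lam) (f : X ⟶ X')
    (A : Str S L) {U : V} (a : X' ⊗ U ⟶ A.carrier) :
    (φ.subst hX hX' f).SatP A a ↔ φ.SatP A (f ▷ U ≫ a) := by
  induction hφ with
  | eq s t => simp [Formula.subst, satP_eq hS]
  | rel R Y hY t => simp [Formula.subst, satP_rel]
  | conj hJ φ h ih =>
    rw [Formula.subst, satP_conj, satP_conj]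
    exact forall_congr' fun j => ih j

lemma SatP.map (hS : S.IsProper) {X : V} {φ : Formula L lam kap X} (hφ : φ.IsConjAtomic)
    {A B : Str S L} (g : A ⟶ B) {U : V} {a : X ⊗ U ⟶ A.carrier} (h : φ.SatP A a) :
    φ.SatP B (a ≫ Str.Hom.map g) := by
  induction hφ with
  | eq s t =>
    rw [satP_eq hS] at h ⊢
    rw [Term.act_map, Term.act_map, h]
  | rel R Y hY t =>
    rw [satP_rel] at h ⊢
    rw [Term.act_map, ← Category.assoc]
    exact h.map g
  | conj hJ φ _ ih =>
    rw [satP_conj] at h ⊢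
    exact fun j => ih j (h j)

/-- Embeddings reflect the validity of conjunctions of atomic formulas. -/
lemma SatP.of_map (hS : S.IsProper) {X : V} {φ : Formula L lam kap X} (hφ : φ.IsConjAtomic)
    {A B : Str S L} (g : A ⟶ B) [Mono (Str.Hom.map g)]
    (hg : ∀ (R : L.Rel) {U : V} (a : L.ar R ⊗ U ⟶ A.carrier),
      B.RelHolds R (a ≫ Str.Hom.map g) → A.RelHolds R a)
    {U : V} {a : X ⊗ U ⟶ A.carrier} (h : φ.SatP B (a ≫ Str.Hom.map g)) : φ.SatP A a := by
  induction hφ with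
  | eq s t =>
    rw [satP_eq hS] at h ⊢
    rwa [Term.act_map, Term.act_map, cancel_mono] at h
  | rel R Y hY t =>
    rw [satP_rel] at h ⊢
    rw [Term.act_map, ← Category.assoc] at h
    exact hg _ _ h
  | conj hJ φ _ ih =>
    rw [satP_conj] at h ⊢
    exact fun j => ih j (h j)

/-- The class `M` is stable under pullback, powers and intersection, and an equation is interpreted
by an `M`-image by definition. Orthogonality can then be used with the left-hand side of an axiom.
-/
lemma interp_M {X : V} {φ : Formula L lam kap X} (hφ : φ.IsConjAtomic)
    (A : Str S L) : S.M (φ.interp A).hom := by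
  induction hφ with
  | eq s t => exact (S.im_spec _).2.1
  | rel R Y hY t =>
    have hiso : IsIso (powUncurry (L.ar R) Y A.carrier) := by
      refine ⟨powCurry _ _ _, ?_, ?_⟩
      · rw [comp_powCurry]
        conv_lhs => rw [← Category.id_comp (powUncurry _ _ _), comp_powUncurry]
        simp [MonoidalClosed.uncurry_curry, MonoidalClosed.curry_uncurry]
      · rw [comp_powUncurry]
        conv_lhs => rw [← Category.id_comp (powCurry _ _ _), comp_powCurry]
        simp [MonoidalClosed.uncurry_curry, MonoidalClosed.curry_uncurry]
    exact S.M_pullback_fst _ (S.M_comp (S.M_ihom_map _ (A.relι_mem R)) (S.M_of_isIso _))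
  | conj hJ φ _ ih => exact S.M_widePullback_base _ _ ih

end Formula

end Sem

/-! ## Powers of structures and presentations -/

lemma Str.compat_iff_exists_lift {V : Type u} [Category.{w} V] [MonoidalCategory V]
    [MonoidalClosed V] [HasLimits V] {S : FactSystem V} {L : Language V} {A B : Str S L} {W : V}
    (t : W ⟶ (ihom A.carrier).obj B.carrier) :
    Compat A B t ↔ ∃ s : W ⟶ homObj A B, s ≫ homι A B = t := by
  refine ⟨Compat.exists_lift, ?_⟩
  rintro ⟨s, rfl⟩
  have h := homι_compat A B
  refine ⟨fun f => by simp only [Category.assoc, h.func f], fun R => ?_⟩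
  obtain ⟨l, hl⟩ := h.rel R
  exact ⟨s ≫ l, by simp only [Category.assoc, hl]⟩

section Points

variable {V : Type u} [Category.{w} V] [MonoidalCategory V] [MonoidalClosed V]
  {S : FactSystem V} {L : Language V}

namespace Str

/-- Both composites into the hom-object of powers are transposed twice and compared at the generic
`dom f`-ary element. -/
lemma compat_func_iff {A B : Str S L} {W : V} (t : W ⟶ (ihom A.carrier).obj B.carrier)
    (f : L.Func) : (t ≫ powAct (L.dom f) A.carrier B.carrier ≫ (ihom _).map (B.func f) =
      t ≫ powAct (L.cod f) A.carrier B.carrier ≫ (MonoidalClosed.pre (A.func f)).app _) ↔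
      actOf (B.func f) (app t (evE (L.dom f) A.carrier)) =
        app t (actOf (A.func f) (evE (L.dom f) A.carrier)) := by
  have h1 : uncurry (t ≫ powAct (L.dom f) A.carrier B.carrier ≫ (ihom _).map (B.func f)) =
      curry (actOf (B.func f) (app t (evE (L.dom f) A.carrier))) := by
    rw [← Category.assoc, MonoidalClosed.uncurry_natural_right, uncurry_comp_powAct, curry_actOf]
  have h2 : uncurry (t ≫ powAct (L.cod f) A.carrier B.carrier ≫
      (MonoidalClosed.pre (A.func f)).app _) =
      curry (app t (actOf (A.func f) (evE (L.dom f) A.carrier))) := by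
    rw [← Category.assoc, MonoidalClosed.uncurry_pre_app, uncurry_comp_powAct,
      ← MonoidalClosed.curry_natural_left, ← app_whiskerLeft, actOf_evE, whisker_evE]
  rw [← MonoidalClosed.uncurry_injective.eq_iff, h1, h2,
    MonoidalClosed.curry_injective.eq_iff]

lemma compat_rel_iff {A B : Str S L} {W : V} (t : W ⟶ (ihom A.carrier).obj B.carrier)
    (R : L.Rel) : (∃ l : W ⟶ (ihom (A.rel R)).obj (B.rel R),
      l ≫ (ihom (A.rel R)).map (B.relι R) =
        t ≫ powAct (L.ar R) A.carrier B.carrier ≫ (MonoidalClosed.pre (A.relι R)).app _) ↔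
      B.RelHolds R (app t (uncurry (A.relι R))) := by
  have h2 : uncurry (t ≫ powAct (L.ar R) A.carrier B.carrier ≫
      (MonoidalClosed.pre (A.relι R)).app _) =
      curry (app t (uncurry (A.relι R))) := by
    rw [← Category.assoc, MonoidalClosed.uncurry_pre_app, uncurry_comp_powAct,
      ← MonoidalClosed.curry_natural_left, ← app_whiskerLeft, whisker_evE]
  constructor
  · rintro ⟨l, hl⟩
    refine ⟨uncurry l, ?_⟩
    rw [← h2, ← hl, MonoidalClosed.uncurry_natural_right]
  · rintro ⟨l, hl⟩
    refine ⟨curry l, ?_⟩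
    apply MonoidalClosed.uncurry_injective
    rw [h2, ← hl, MonoidalClosed.uncurry_natural_right, MonoidalClosed.uncurry_curry]

/-- Points of the hom-object are ordinary morphisms; this links enriched with ordinary
presentability. -/
lemma exists_point_iff [HasLimits V] {A B : Str S L} (g : A.carrier ⟶ B.carrier) :
    (∃ s : 𝟙_ V ⟶ homObj A B, s ≫ homι A B = curry ((ρ_ _).hom ≫ g)) ↔
      ∃ h : A ⟶ B, Hom.map h = g := by
  have key {X U : V} (a : X ⊗ U ⟶ A.carrier) :
      app (curry ((ρ_ A.carrier).hom ≫ g)) a = X ◁ (ρ_ U).hom ≫ a ≫ g := by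
    simp [app]
  have hf (f : L.Func) := compat_func_iff (curry ((ρ_ A.carrier).hom ≫ g)) f
  have hR (R : L.Rel) := compat_rel_iff (curry ((ρ_ A.carrier).hom ≫ g)) R
  simp only [key, actOf_whisker, cancel_epi, relHolds_whisker_iff] at hf hR
  have hR' (R : L.Rel) : B.RelHolds R (uncurry (A.relι R) ≫ g) ↔
      ∃ l : A.rel R ⟶ B.rel R, l ≫ B.relι R = A.relι R ≫ (ihom (L.ar R)).map g := by
    rw [RelHolds, curry_comp_map, MonoidalClosed.curry_uncurry]
  rw [← compat_iff_exists_lift]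
  constructor
  · intro h
    exact ⟨⟨g, fun f => comm_of_actOf ((hf f).1 (h.func f)),
      fun R => (hR' R).1 ((hR R).1 (h.rel R))⟩, rfl⟩
  · rintro ⟨h, rfl⟩
    exact ⟨fun f => (hf f).2 (actOf_natural (Hom.func_comm h f) _),
      fun R => (hR R).2 ((hR' R).2 (Hom.rel_comm h R))⟩

end Str

end Points

section Pow

variable {V : Type u} [Category.{w} V] [MonoidalCategory V] [SymmetricCategory V]
  [MonoidalClosed V] {S : FactSystem V} {L : Language V}

namespace Str

/-- The inclusion of the relation `R` of the power `A^W`. -/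
noncomputable def powRelι (W : V) (A : Str S L) (R : L.Rel) :
    (ihom W).obj (A.rel R) ⟶ (ihom (L.ar R)).obj ((ihom W).obj A.carrier) :=
  curry (unflat (uncurry ((ihom.ev W).app (A.rel R) ≫ A.relι R)))

/-- Relations in `A^W` are pointwise: an element of `A^W` is related exactly when its flattening is
related in `A`. -/
lemma comp_powRelι_iff (W : V) (A : Str S L) (R : L.Rel) {U : V}
    (l : U ⟶ (ihom W).obj (A.rel R)) (a : L.ar R ⊗ U ⟶ (ihom W).obj A.carrier) :
    l ≫ powRelι W A R = curry a ↔ uncurry l ≫ A.relι R = curry (flat a) := by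
  have h1 : l ≫ powRelι W A R = curry (unflat (uncurry (uncurry l ≫ A.relι R))) := by
    rw [powRelι, ← MonoidalClosed.curry_natural_left, ← unflat_whiskerLeft,
      ← MonoidalClosed.uncurry_natural_left, MonoidalClosed.uncurry_eq l, Category.assoc]
  rw [h1, MonoidalClosed.curry_injective.eq_iff, MonoidalClosed.eq_curry_iff]
  constructor
  · intro h
    rw [← h, flat_unflat]
  · intro h
    rw [h, unflat_flat]

/-- A lifting problem for `e` transposes to one for `W ◁ e` against the relation of `A`; this is
where `E` must be closed under tensoring. -/
lemma powRelι_mem (W : V) (A : Str S L) (R : L.Rel) : S.M (powRelι W A R) := by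
  have hR := A.relι_mem R
  have := S.M_mono _ hR
  have : Mono (powRelι W A R) := by
    refine ⟨fun {U} l l' h => MonoidalClosed.uncurry_injective ?_⟩
    rw [← cancel_mono (A.relι R)]
    have h1 := (comp_powRelι_iff W A R l (uncurry (l ≫ powRelι W A R))).1
      (MonoidalClosed.curry_uncurry _).symm
    have h2 := (comp_powRelι_iff W A R l' (uncurry (l ≫ powRelι W A R))).1
      (by rw [MonoidalClosed.curry_uncurry, h])
    exact h1.trans h2.symm
  refine S.M_of_lift _ fun {P Q} e he a b hab => ?_
  have h1 := (comp_powRelι_iff W A R a (uncurry (e ≫ b))).1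
    (by rw [MonoidalClosed.curry_uncurry, hab])
  rw [MonoidalClosed.uncurry_natural_left, flat_whiskerLeft,
    MonoidalClosed.curry_natural_left] at h1
  obtain ⟨d, -, hd⟩ := S.exists_lift (S.E_tensor W e he) hR _ _ h1
  refine ⟨curry d, ?_⟩
  rw [← MonoidalClosed.curry_uncurry b, comp_powRelι_iff, MonoidalClosed.uncurry_curry, hd]

/-- The function symbol `f` of the power `A^W`. -/
noncomputable def powFunc (W : V) (A : Str S L) (f : L.Func) :
    (ihom (L.dom f)).obj ((ihom W).obj A.carrier) ⟶
      (ihom (L.cod f)).obj ((ihom W).obj A.carrier) :=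
  curry (unflat (actOf (A.func f) (flat (evE _ _))))

/-- The power `A^W` in the `V`-category of structures. -/
noncomputable abbrev power (W : V) (A : Str S L) : Str S L where
  carrier := (ihom W).obj A.carrier
  func f := powFunc W A f
  rel R := (ihom W).obj (A.rel R)
  relι R := powRelι W A R
  relι_mem R := powRelι_mem W A R

lemma flat_actOf_powFunc (W : V) (A : Str S L) (f : L.Func) {U : V}
    (a : L.dom f ⊗ U ⟶ (ihom W).obj A.carrier) :
    flat (actOf (powFunc W A f) a) = actOf (A.func f) (flat a) := by
  rw [actOf_eq, flat_whiskerLeft, actOf_evE, powFunc, MonoidalClosed.uncurry_curry,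
    flat_unflat, ← actOf_whisker, ← flat_whiskerLeft, whisker_curry_evE]

lemma relHolds_power_iff (W : V) (A : Str S L) (R : L.Rel) {U : V}
    (a : L.ar R ⊗ U ⟶ (ihom W).obj A.carrier) :
    (power W A).RelHolds R a ↔ A.RelHolds R (flat a) := by
  constructor
  · rintro ⟨l, hl⟩
    exact ⟨uncurry l, (comp_powRelι_iff W A R l a).1 hl⟩
  · rintro ⟨l, hl⟩
    exact ⟨curry l, (comp_powRelι_iff W A R (curry l) a).2
      (by rw [MonoidalClosed.uncurry_curry, hl])⟩

/-- Both conditions say the same at the generic element once the parameter `W` is moved by the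
symmetry; `flat` is injective, so nothing is lost. -/
lemma powFunc_comm_iff {A B : Str S L} {W : V} (t : W ⟶ (ihom A.carrier).obj B.carrier)
    (f : L.Func) : (t ≫ powAct (L.dom f) A.carrier B.carrier ≫ (ihom _).map (B.func f) =
      t ≫ powAct (L.cod f) A.carrier B.carrier ≫ (MonoidalClosed.pre (A.func f)).app _) ↔
      A.func f ≫ (ihom (L.cod f)).map (swapHom t) =
        (ihom (L.dom f)).map (swapHom t) ≫ powFunc W B f := by
  rw [compat_func_iff]
  have h3 : flat (actOf (powFunc W B f) (evE (L.dom f) A.carrier ≫ swapHom t)) =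
      L.cod f ◁ (β_ _ _).hom ≫ actOf (B.func f) (app t (evE (L.dom f) A.carrier)) := by
    rw [flat_actOf_powFunc, flat_comp_swapHom, actOf_whisker]
  have h4 : flat (actOf (A.func f) (evE (L.dom f) A.carrier) ≫ swapHom t) =
      L.cod f ◁ (β_ _ _).hom ≫ app t (actOf (A.func f) (evE (L.dom f) A.carrier)) := by
    rw [flat_comp_swapHom]
  constructor
  · intro h
    exact comm_of_actOf (flat_injective (by rw [h3, h4, h]))
  · intro h
    have := congrArg flat (actOf_natural h (evE (L.dom f) A.carrier))
    rw [h4, h3] at this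
    exact (cancel_epi _).1 this

lemma powRel_comm_iff {A B : Str S L} {W : V} (t : W ⟶ (ihom A.carrier).obj B.carrier)
    (R : L.Rel) : (∃ l : W ⟶ (ihom (A.rel R)).obj (B.rel R),
      l ≫ (ihom (A.rel R)).map (B.relι R) =
        t ≫ powAct (L.ar R) A.carrier B.carrier ≫ (MonoidalClosed.pre (A.relι R)).app _) ↔
      ∃ l : A.rel R ⟶ (ihom W).obj (B.rel R),
        l ≫ powRelι W B R = A.relι R ≫ (ihom (L.ar R)).map (swapHom t) := by
  have h3 : (∃ l : A.rel R ⟶ (ihom W).obj (B.rel R),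
      l ≫ powRelι W B R = A.relι R ≫ (ihom (L.ar R)).map (swapHom t)) ↔
      B.RelHolds R (flat (uncurry (A.relι R) ≫ swapHom t)) := by
    rw [← relHolds_power_iff, ← MonoidalClosed.curry_uncurry (A.relι R), ← curry_comp_map,
      MonoidalClosed.curry_uncurry]
    rfl
  rw [h3, flat_comp_swapHom, relHolds_whisker_iff, compat_rel_iff]

lemma compat_iff_exists_hom [HasLimits V] {A B : Str S L} {W : V}
    (t : W ⟶ (ihom A.carrier).obj B.carrier) :
    Compat A B t ↔ ∃ g : A ⟶ power W B, Hom.map g = swapHom t := by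
  constructor
  · intro h
    exact ⟨⟨swapHom t, fun f => (powFunc_comm_iff t f).1 (h.func f),
      fun R => (powRel_comm_iff t R).1 (h.rel R)⟩, rfl⟩
  · rintro ⟨g, hg⟩
    exact ⟨fun f => (powFunc_comm_iff t f).2 (hg ▸ Hom.func_comm g f),
      fun R => (powRel_comm_iff t R).2 (hg ▸ Hom.rel_comm g R)⟩

/-- Maps `W ⟶ Str(L)(A, B)` correspond to morphisms `A ⟶ B^W`. -/
lemma exists_lift_iff_exists_hom [HasLimits V] {A B : Str S L} {W : V}
    (t : W ⟶ (ihom A.carrier).obj B.carrier) :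
    (∃ s : W ⟶ homObj A B, s ≫ homι A B = t) ↔ ∃ g : A ⟶ power W B, Hom.map g = swapHom t := by
  rw [← compat_iff_exists_lift, compat_iff_exists_hom]

end Str

variable [HasColimits V] {lam : Cardinal.{w}} [Fact lam.IsRegular] {kap : WithTop Cardinal.{w}}

/-- Operations of `A^W` are pointwise by construction, and each way of forming terms is compatible
with changing parameters. -/
lemma Term.flat_act_power {X Y : V} (t : Term L lam X Y) (W : V) (A : Str S L) {U : V}
    (a : X ⊗ U ⟶ (ihom W).obj A.carrier) :
    flat (t.act (Str.power W A) a) = t.act A (flat a) := by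
  induction t generalizing U with
  | ofHom hX hY g =>
    rw [act_ofHom, act_ofHom, ← flat_whiskerRight]
  | symb f => exact Str.flat_actOf_powFunc W A f a
  | pow Z hZ t ih =>
    rw [act_pow, act_pow]
    refine (flat_assoc_hom _).trans ?_
    refine congrArg _ ?_
    refine (congrArg _ (ih _)).trans ?_
    rw [← act_whisker, flat_assoc_inv]
  | comp t s iht ihs =>
    rw [act_comp, act_comp]
    exact (ihs _).trans (congrArg _ (iht _))
  | tuple hJ Y t ih =>
    refine tensor_sigma_hom_ext fun j => ?_
    rw [ι_act_tuple, ← ih]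
    refine (flat_whiskerRight _ _).symm.trans (congrArg flat ?_)
    exact ι_act_tuple hJ Y t (Str.power W A) a j

/-- The value of a term at an element. -/
noncomputable def Term.val {X Y : V} (t : Term L lam X Y) (A : Str S L) (x : X ⟶ A.carrier) :
    Y ⟶ A.carrier :=
  (ρ_ Y).inv ≫ t.act A ((ρ_ X).hom ≫ x)

lemma Term.act_eq_val {X Y : V} (t : Term L lam X Y) (A : Str S L) (x : X ⟶ A.carrier) :
    t.act A ((ρ_ X).hom ≫ x) = (ρ_ Y).hom ≫ t.val A x := by
  simp [val]

lemma Term.val_map {X Y : V} (t : Term L lam X Y) {A B : Str S L} (g : A ⟶ B)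
    (x : X ⟶ A.carrier) : t.val B (x ≫ Str.Hom.map g) = t.val A x ≫ Str.Hom.map g := by
  rw [val, ← Category.assoc (ρ_ X).hom, act_map, val, Category.assoc]

lemma Term.val_ofHom {X Y : V} (hX : IsCardinalPresentable X lam)
    (hY : IsCardinalPresentable Y lam) (g : Y ⟶ X) (A : Str S L) (x : X ⟶ A.carrier) :
    (ofHom hX hY g : Term L lam X Y).val A x = g ≫ x := by
  simp [val]

lemma Term.val_comp {X Y Z : V} (t : Term L lam X Y) (s : Term L lam Y Z)
    (A : Str S L) (x : X ⟶ A.carrier) : (comp t s).val A x = s.val A (t.val A x) := by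
  rw [val, act_comp, act_eq_val]
  rfl

/-- Powers of a symbol apply it to elements with parameters in `Z`, so terms reach the whole map
`A.func f` and not only its effect on global elements. -/
lemma Term.val_pow_symb (f : L.Func) {Z : V} (hZ : IsCardinalPresentable Z lam) (A : Str S L)
    (y : L.dom f ⊗ Z ⟶ A.carrier) :
    (pow Z hZ (symb f) : Term L lam _ _).val A y = actOf (A.func f) y := by
  have : (α_ (L.dom f) Z (𝟙_ V)).inv ≫ (ρ_ (L.dom f ⊗ Z)).hom = L.dom f ◁ (ρ_ Z).hom := by simp
  rw [val, act_pow, act_symb, reassoc_of% this, actOf_whisker]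
  simp

lemma Term.ι_val_tuple {X : V} {J : Type w} (hJ : Cardinal.mk J < lam) (Y : J → V)
    (t : ∀ j, Term L lam X (Y j)) (A : Str S L) (x : X ⟶ A.carrier) (j : J) :
    Sigma.ι Y j ≫ (tuple hJ Y t).val A x = (t j).val A x := by
  rw [val, rightUnitor_inv_naturality_assoc, ι_act_tuple]
  rfl

variable [HasLimits V]

namespace Formula

lemma satP_power_iff (hS : S.IsProper) {X : V} {φ : Formula L lam kap X} (hφ : φ.IsConjAtomic)
    (W : V) (A : Str S L) {U : V} (a : X ⊗ U ⟶ (ihom W).obj A.carrier) :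
    φ.SatP (Str.power W A) a ↔ φ.SatP A (flat a) := by
  induction hφ with
  | eq s t =>
    rw [satP_eq hS, satP_eq hS, ← Term.flat_act_power, ← Term.flat_act_power]
    exact ⟨fun h => congrArg flat h, fun h => flat_injective h⟩
  | rel R Y hY t =>
    rw [satP_rel, satP_rel, ← Term.flat_act_power]
    refine (Str.relHolds_power_iff _ _ _ _).trans ?_
    rw [← flat_assoc_inv, Str.relHolds_whisker_iff (midSwap Y W U)]
  | conj hJ φ _ ih =>
    rw [satP_conj, satP_conj]
    exact forall_congr' fun j => ih j

/-- Satisfaction of a formula at an element. -/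
def Sat {X : V} (φ : Formula L lam kap X) (A : Str S L) (x : X ⟶ A.carrier) : Prop :=
  φ.SatP A ((ρ_ X).hom ≫ x)

/-- The bridge from ordinary to enriched statements: by Yoneda in `W`, plain satisfaction in all
powers of `A` recovers the subobject `φ.interp A`. -/
lemma sat_power_iff (hS : S.IsProper) {X : V} {φ : Formula L lam kap X} (hφ : φ.IsConjAtomic)
    (W : V) (A : Str S L) (t : W ⟶ (ihom X).obj A.carrier) :
    φ.Sat (Str.power W A) (swapHom t) ↔ ∃ l : W ⟶ (φ.interp A).left, l ≫ (φ.interp A).hom = t := by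
  have hl : (α_ X (𝟙_ V) W).inv ≫ (ρ_ X).hom ▷ W ≫ uncurry t = X ◁ (λ_ W).hom ≫ uncurry t := by
    rw [triangle_assoc_comp_right_assoc]
  rw [Sat, satP_power_iff hS hφ, flat_comp_swapHom, app, hl,
    satP_whisker_iff, satP_whisker_iff, SatP, MonoidalClosed.curry_uncurry]

lemma Sat.map (hS : S.IsProper) {X : V} {φ : Formula L lam kap X} (hφ : φ.IsConjAtomic)
    {A B : Str S L} (g : A ⟶ B) {x : X ⟶ A.carrier} (h : φ.Sat A x) :
    φ.Sat B (x ≫ Str.Hom.map g) := by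
  rw [Sat, ← Category.assoc]
  exact SatP.map hS hφ g h

lemma sat_subst (hS : S.IsProper) {X : V} {φ : Formula L lam kap X} (hφ : φ.IsConjAtomic)
    {X' : V} (hX : IsCardinalPresentable X lam) (hX' : IsCardinalPresentable X' lam) (f : X ⟶ X')
    (A : Str S L) (x : X' ⟶ A.carrier) :
    (φ.subst hX hX' f).Sat A x ↔ φ.Sat A (f ≫ x) := by
  rw [Sat, satP_subst hS hφ, rightUnitor_naturality_assoc]
  rfl

lemma sat_conj {X : V} {J : Type w} (hJ : Cardinal.mk J < lam) (φ : J → Formula L lam kap X)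
    (A : Str S L) (x : X ⟶ A.carrier) : (conj hJ φ).Sat A x ↔ ∀ j, (φ j).Sat A x :=
  satP_conj _ _ _ _

lemma sat_and {X : V} (φ ψ : Formula L lam kap X) (A : Str S L) (x : X ⟶ A.carrier) :
    (φ.and ψ).Sat A x ↔ φ.Sat A x ∧ ψ.Sat A x :=
  satP_and _ _ _ _

end Formula

lemma Formula.sat_eq (hS : S.IsProper) {X Y : V} (s t : Term L lam X Y) (A : Str S L)
    (x : X ⟶ A.carrier) : (eq s t : Formula L lam kap X).Sat A x ↔ s.val A x = t.val A x := by
  rw [Sat, satP_eq hS, Term.act_eq_val, Term.act_eq_val, cancel_epi]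

lemma Formula.sat_rel {Z : V} (R : L.Rel) (Y : V) (hY : IsCardinalPresentable Y lam)
    (t : Term L lam Z (L.ar R ⊗ Y)) (A : Str S L) (x : Z ⟶ A.carrier) :
    (rel R Y hY t : Formula L lam kap Z).Sat A x ↔ A.RelHolds R (t.val A x) := by
  have : (α_ (L.ar R) Y (𝟙_ V)).inv ≫ (ρ_ (L.ar R ⊗ Y)).hom = L.ar R ◁ (ρ_ Y).hom := by simp
  rw [Sat, satP_rel, Term.act_eq_val, reassoc_of% this, Str.relHolds_whisker_iff]

/-- The structure `B` is presented by the formula `φ` and the generic element `x`. -/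
structure IsPres {X : V} (φ : Formula L lam kap X) (B : Str S L) (x : X ⟶ B.carrier) : Prop where
  sat : φ.Sat B x
  exists_hom : ∀ (K : Str S L) (y : X ⟶ K.carrier), φ.Sat K y →
    ∃ g : B ⟶ K, x ≫ Str.Hom.map g = y
  hom_ext : ∀ {K : Str S L} {g g' : B ⟶ K}, x ≫ Str.Hom.map g = x ≫ Str.Hom.map g' → g = g'

/-- A presentation of `B` by `φ` identifies `Str(L)(B, K)` with the interpretation of `φ`. -/
lemma IsPres.exists_iso (hS : S.IsProper) {X : V} {φ : Formula L lam kap X} (hφ : φ.IsConjAtomic)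
    {B : Str S L} {x : X ⟶ B.carrier} (h : IsPres φ B x) (K : Str S L) :
    ∃ e : Str.homObj B K ≅ (φ.interp K).left, e.hom ≫ (φ.interp K).hom =
      Str.homι B K ≫ (MonoidalClosed.pre x).app K.carrier := by
  have hm := S.M_mono _ (φ.interp_M hφ K)
  -- A `W`-element of the hom-object is a morphism from `B` to `K^W`, and a `W`-element of the
  -- interpretation is an element of `K^W` satisfying `φ`. The ordinary universal property of `B` at
  -- `K^W` matches the two.
  have h1 {W : V} (s : W ⟶ Str.homObj B K) : ∃ l : W ⟶ (φ.interp K).left,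
      l ≫ (φ.interp K).hom = (s ≫ Str.homι B K) ≫ (MonoidalClosed.pre x).app K.carrier := by
    obtain ⟨g, hg⟩ := (Str.exists_lift_iff_exists_hom _).1 ⟨s, rfl⟩
    rw [← Formula.sat_power_iff hS hφ, swapHom_comp_pre, ← hg]
    exact h.sat.map hS hφ g
  have h2 {W : V} (l : W ⟶ (φ.interp K).left) : ∃ s : W ⟶ Str.homObj B K,
      (s ≫ Str.homι B K) ≫ (MonoidalClosed.pre x).app K.carrier = l ≫ (φ.interp K).hom := by
    have := (Formula.sat_power_iff hS hφ W K (l ≫ (φ.interp K).hom)).2 ⟨l, rfl⟩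
    obtain ⟨g, hg⟩ := h.exists_hom _ _ this
    obtain ⟨s, hs⟩ := (Str.exists_lift_iff_exists_hom (swapHom (Str.Hom.map g))).2
      ⟨g, (swapHom_swapHom _).symm⟩
    refine ⟨s, ?_⟩
    rw [hs, ← swapHom_swapHom (_ ≫ (MonoidalClosed.pre x).app K.carrier), swapHom_comp_pre,
      swapHom_swapHom]
    exact (congrArg swapHom hg).trans (swapHom_swapHom _)
  have h3 {W : V} {s s' : W ⟶ Str.homObj B K}
      (hs : (s ≫ Str.homι B K) ≫ (MonoidalClosed.pre x).app K.carrier =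
        (s' ≫ Str.homι B K) ≫ (MonoidalClosed.pre x).app K.carrier) : s = s' := by
    obtain ⟨g, hg⟩ := (Str.exists_lift_iff_exists_hom _).1 ⟨s, rfl⟩
    obtain ⟨g', hg'⟩ := (Str.exists_lift_iff_exists_hom _).1 ⟨s', rfl⟩
    have := congrArg swapHom hs
    rw [swapHom_comp_pre, swapHom_comp_pre, ← hg, ← hg'] at this
    rw [← cancel_mono (Str.homι B K), ← swapHom_swapHom (s ≫ _), ← hg, h.hom_ext this, hg',
      swapHom_swapHom]
  -- The two mutually inverse maps are the images of the universal elements.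
  obtain ⟨e, he⟩ := h1 (𝟙 _)
  obtain ⟨d, hd⟩ := h2 (𝟙 _)
  rw [Category.id_comp] at he hd
  refine ⟨⟨e, d, ?_, ?_⟩, he⟩
  · apply h3
    rw [Category.assoc e d, Category.assoc e, hd, he, Category.id_comp]
  · rw [← cancel_mono (φ.interp K).hom, Category.assoc, he, ← Category.assoc, hd,
      Category.id_comp]

end Pow

/-! ## Filtered colimits -/

section Base

variable {V : Type u} [Category.{w} V] {lam : Cardinal.{w}} [Fact lam.IsRegular]
  [IsCardinalLocallyPresentable V lam]

lemma isStrongGenerator_isCardinalPresentable :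
    (isCardinalPresentable V lam).IsStrongGenerator :=
  (isCardinalFilteredGenerator_isCardinalPresentable V lam).isStrongGenerator

variable (lam) in
/-- `lam`-presentable objects detect isomorphisms. -/
lemma isIso_of_presentable {X Y : V} (f : X ⟶ Y)
    (inj : ∀ (G : V), IsCardinalPresentable G lam → ∀ a b : G ⟶ X, a ≫ f = b ≫ f → a = b)
    (surj : ∀ (G : V), IsCardinalPresentable G lam → ∀ b : G ⟶ Y, ∃ a, a ≫ f = b) : IsIso f := by
  have hG := isStrongGenerator_isCardinalPresentable (V := V) (lam := lam)
  have : Mono f := by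
    rw [hG.isSeparating.mono_iff]
    exact fun G hG a b h => inj G hG a b h
  exact hG.isIso_of_mono f fun G hG b => surj G hG b

variable (lam) in
-- The pullback of `m` along `g` is mono and, by hypothesis, surjective on presentable elements,
-- hence invertible.
lemma exists_factor_of_presentable [HasPullbacks V] {D' D Z : V} (m : D' ⟶ D) [Mono m]
    (g : Z ⟶ D)
    (h : ∀ (G : V), IsCardinalPresentable G lam → ∀ p : G ⟶ Z, ∃ q, q ≫ m = p ≫ g) :
    ∃ q, q ≫ m = g := by
  have : IsIso (pullback.fst g m) := by
    refine isIso_of_presentable lam _ (fun G _ a b hab => (cancel_mono _).1 hab) fun G hG b => ?_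
    obtain ⟨q, hq⟩ := h G hG b
    exact ⟨pullback.lift b q hq.symm, pullback.lift_fst _ _ _⟩
  exact ⟨inv (pullback.fst g m) ≫ pullback.snd g m, by
    rw [Category.assoc, ← pullback.condition, IsIso.inv_hom_id_assoc]⟩

variable {J : Type w} [SmallCategory J] [IsCardinalFiltered J lam]

variable (lam) in
/-- A criterion for being a `lam`-filtered colimit, in terms of elements with
`lam`-presentable domain. -/
lemma nonempty_isColimit_of_presentable {F : J ⥤ V} (c : Cocone F)
    (surj : ∀ (G : V), IsCardinalPresentable G lam → ∀ f : G ⟶ c.pt,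
      ∃ (j : J) (f' : G ⟶ F.obj j), f' ≫ c.ι.app j = f)
    (inj : ∀ (G : V), IsCardinalPresentable G lam → ∀ (j : J) (f g : G ⟶ F.obj j),
      f ≫ c.ι.app j = g ≫ c.ι.app j → ∃ (k : J) (u : j ⟶ k), f ≫ F.map u = g ≫ F.map u) :
    Nonempty (IsColimit c) := by
  have := isFiltered_of_isCardinalFiltered J lam
  have : IsIso ((colimit.isColimit F).desc c) := by
    refine isIso_of_presentable lam _ (fun G hG a b hab => ?_) fun G hG b => ?_
    · obtain ⟨j₁, a, rfl⟩ := IsCardinalPresentable.exists_hom_of_isColimit lam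
        (colimit.isColimit F) a
      obtain ⟨j₂, b, rfl⟩ := IsCardinalPresentable.exists_hom_of_isColimit lam
        (colimit.isColimit F) b
      let j := IsFiltered.max j₁ j₂
      obtain ⟨k, u, hu⟩ := inj G hG j (a ≫ F.map (IsFiltered.leftToMax j₁ j₂))
        (b ≫ F.map (IsFiltered.rightToMax j₁ j₂)) (by simpa using hab)
      have h1 : a ≫ (colimit.cocone F).ι.app j₁ =
          ((a ≫ F.map (IsFiltered.leftToMax j₁ j₂)) ≫ F.map u) ≫ colimit.ι F k := by simp
      have h2 : b ≫ (colimit.cocone F).ι.app j₂ =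
          ((b ≫ F.map (IsFiltered.rightToMax j₁ j₂)) ≫ F.map u) ≫ colimit.ι F k := by simp
      rw [h1, h2, hu]
    · obtain ⟨j, f, rfl⟩ := surj G hG b
      exact ⟨f ≫ colimit.ι F j, by simp⟩
  exact ⟨IsColimit.ofPointIso (colimit.isColimit F)⟩

variable [MonoidalCategory V] [MonoidalClosed V]

/-- Maps `G ⟶ [X, A]` are maps `X ⊗ G ⟶ A`, and `X ⊗ G` is presentable when `X` and `G` are. -/
lemma isCardinalAccessible_ihom
    (hT : ∀ X Y : V, IsCardinalPresentable X lam → IsCardinalPresentable Y lam →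
      IsCardinalPresentable (X ⊗ Y) lam) (X : V) (hX : IsCardinalPresentable X lam) :
    (ihom X).IsCardinalAccessible lam where
  preservesColimitOfShape J _ _ := ⟨fun {F} => ⟨fun {c} hc => by
    refine nonempty_isColimit_of_presentable lam _ (fun G hG f => ?_) fun G hG j f g h => ?_
    · have := hT X G hX hG
      obtain ⟨j, f', hf'⟩ := IsCardinalPresentable.exists_hom_of_isColimit lam hc (uncurry f)
      refine ⟨j, curry f', ?_⟩
      dsimp
      rw [← MonoidalClosed.curry_natural_right, hf', MonoidalClosed.curry_uncurry]
    · have := hT X G hX hG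
      obtain ⟨k, u, hu⟩ := IsCardinalPresentable.exists_eq_of_isColimit' lam hc
        (uncurry f) (uncurry g) (by
          rw [← MonoidalClosed.uncurry_natural_right, ← MonoidalClosed.uncurry_natural_right]
          exact congrArg uncurry h)
      refine ⟨k, u, MonoidalClosed.uncurry_injective ?_⟩
      dsimp
      rw [MonoidalClosed.uncurry_natural_right, MonoidalClosed.uncurry_natural_right, hu]⟩⟩

end Base

namespace Str

section

variable {V : Type u} [Category.{w} V] [MonoidalCategory V] [MonoidalClosed V]
  {S : FactSystem V} {L : Language V}

variable (S L) in
/-- The functor sending a structure to its underlying object. -/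
abbrev forget : Str S L ⥤ V where
  obj A := A.carrier
  map g := Hom.map g

/-- The map between the relations induced by a morphism of structures. -/
noncomputable def relMap {A B : Str S L} (g : A ⟶ B) (R : L.Rel) : A.rel R ⟶ B.rel R :=
  (Hom.rel_comm g R).choose

lemma relMap_relι {A B : Str S L} (g : A ⟶ B) (R : L.Rel) :
    relMap g R ≫ B.relι R = A.relι R ≫ (ihom (L.ar R)).map (Hom.map g) :=
  (Hom.rel_comm g R).choose_spec

instance (A : Str S L) (R : L.Rel) : Mono (A.relι R) := S.M_mono _ (A.relι_mem R)

variable (S) in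
/-- The functor sending a structure to its relation `R`. -/
noncomputable abbrev relFunctor (R : L.Rel) : Str S L ⥤ V where
  obj A := A.rel R
  map g := relMap g R
  map_id A := by simp [← cancel_mono (A.relι R), relMap_relι]
  map_comp {A B C} g h := by
    rw [← cancel_mono (C.relι R), relMap_relι, Category.assoc, relMap_relι, ← Category.assoc,
      relMap_relι]
    simp

lemma func_comm_of_comp_eq {A B C : Str S L} (g : A ⟶ B) (h : A ⟶ C) {d : B.carrier ⟶ C.carrier}
    (hd : Hom.map g ≫ d = Hom.map h) (f : L.Func) :
    (ihom (L.dom f)).map (Hom.map g) ≫ B.func f ≫ (ihom (L.cod f)).map d =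
      (ihom (L.dom f)).map (Hom.map g) ≫ (ihom (L.dom f)).map d ≫ C.func f := by
  have h1 := Hom.func_comm g f
  have h2 := Hom.func_comm h f
  rw [← hd, Functor.map_comp, Functor.map_comp, reassoc_of% h1, Category.assoc] at h2
  exact h2

lemma relMap_comp_of_comp_eq {A B C : Str S L} (g : A ⟶ B) (h : A ⟶ C)
    {d : B.carrier ⟶ C.carrier} (hd : Hom.map g ≫ d = Hom.map h) (R : L.Rel) :
    relMap h R ≫ C.relι R = relMap g R ≫ B.relι R ≫ (ihom (L.ar R)).map d := by
  have h1 := relMap_relι g R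
  rw [relMap_relι, ← hd, Functor.map_comp, reassoc_of% h1]

lemma func_comp_of_comp_eq {A B : Str S L} (g : A ⟶ B) {Z : V} {a : A.carrier ⟶ Z}
    {b : B.carrier ⟶ Z} (h : Hom.map g ≫ b = a) (f : L.Func) :
    (ihom (L.dom f)).map (Hom.map g) ≫ B.func f ≫ (ihom (L.cod f)).map b =
      A.func f ≫ (ihom (L.cod f)).map a := by
  have h1 := Hom.func_comm g f
  rw [← reassoc_of% h1, ← Functor.map_comp, h]

lemma relMap_comp_relι {A B : Str S L} (g : A ⟶ B) {Z : V} {a : A.carrier ⟶ Z}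
    {b : B.carrier ⟶ Z} (h : Hom.map g ≫ b = a) (R : L.Rel) :
    relMap g R ≫ B.relι R ≫ (ihom (L.ar R)).map b = A.relι R ≫ (ihom (L.ar R)).map a := by
  have h1 := relMap_relι g R
  rw [reassoc_of% h1, ← Functor.map_comp, h]

variable {lam : Cardinal.{w}} [Fact lam.IsRegular]
  {J : Type w} [SmallCategory J] [IsCardinalFiltered J lam]

variable (lam) in
/-- A cocone of structures over a `lam`-filtered category is a colimit as soon as its underlying
objects and its relations form colimits. -/
def isColimitOfForget
    (hX : ∀ f : L.Func, (ihom (L.dom f)).IsCardinalAccessible lam)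
    {D : J ⥤ Str S L} (c : Cocone D) (hc : IsColimit ((forget S L).mapCocone c))
    (hR : ∀ R : L.Rel, IsColimit ((relFunctor S R).mapCocone c)) : IsColimit c where
  desc s :=
    { map := hc.desc ((forget S L).mapCocone s)
      func_comm := fun f => by
        have := Functor.preservesColimitsOfShape_of_isCardinalAccessible (ihom (L.dom f)) lam J
        refine (isColimitOfPreserves (ihom (L.dom f)) hc).hom_ext fun j => ?_
        have h (j : J) : Hom.map (c.ι.app j) ≫ hc.desc ((forget S L).mapCocone s) =
            Hom.map (s.ι.app j) := hc.fac ((forget S L).mapCocone s) j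
        exact func_comm_of_comp_eq (c.ι.app j) (s.ι.app j) (h j) f
      rel_comm := fun R => by
        refine ⟨(hR R).desc ((relFunctor S R).mapCocone s), (hR R).hom_ext fun j => ?_⟩
        have h : Hom.map (c.ι.app j) ≫ hc.desc ((forget S L).mapCocone s) =
            Hom.map (s.ι.app j) := hc.fac ((forget S L).mapCocone s) j
        rw [(hR R).fac_assoc]
        exact relMap_comp_of_comp_eq (c.ι.app j) (s.ι.app j) h R }
  fac s j := Hom.ext (hc.fac ((forget S L).mapCocone s) j)
  uniq s m hm := Hom.ext (hc.uniq ((forget S L).mapCocone s) (Hom.map m)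
    fun j => congrArg Hom.map (hm j))

variable (lam) in
/-- `lam`-filtered colimits of structures are computed on underlying objects and relations. -/
lemma exists_isColimit_of_filtered [HasColimits V]
    (hX : ∀ f : L.Func, (ihom (L.dom f)).IsCardinalAccessible lam)
    (hR : ∀ R : L.Rel, (ihom (L.ar R)).IsCardinalAccessible lam)
    (hM : S.ClosedUnderFiltered lam) (D : J ⥤ Str S L) :
    ∃ (c : Cocone D) (_ : IsColimit c), Nonempty (IsColimit ((forget S L).mapCocone c)) ∧
      ∀ R : L.Rel, Nonempty (IsColimit ((relFunctor S R).mapCocone c)) := by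
  have hX' (f : L.Func) :=
    Functor.preservesColimitsOfShape_of_isCardinalAccessible (ihom (L.dom f)) lam J
  have hR' (R : L.Rel) :=
    Functor.preservesColimitsOfShape_of_isCardinalAccessible (ihom (L.ar R)) lam J
  have hM' := hM J
  let hc := colimit.isColimit (D ⋙ forget S L)
  let hf (f : L.Func) := isColimitOfPreserves (ihom (L.dom f)) hc
  let hr (R : L.Rel) := colimit.isColimit (D ⋙ relFunctor S R)
  let funcD (f : L.Func) : Cocone ((D ⋙ forget S L) ⋙ ihom (L.dom f)) :=
    { pt := (ihom (L.cod f)).obj (colimit (D ⋙ forget S L))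
      ι :=
        { app := fun j => (D.obj j).func f ≫ (ihom (L.cod f)).map (colimit.ι (D ⋙ forget S L) j)
          naturality := fun i j u => by
            exact (func_comp_of_comp_eq (D.map u) (colimit.w (D ⋙ forget S L) u) f).trans
              (Category.comp_id _).symm } }
  let relD (R : L.Rel) : Cocone (D ⋙ relFunctor S R) :=
    { pt := (ihom (L.ar R)).obj (colimit (D ⋙ forget S L))
      ι :=
        { app := fun j => (D.obj j).relι R ≫ (ihom (L.ar R)).map (colimit.ι (D ⋙ forget S L) j)
          naturality := fun i j u => by
            exact (relMap_comp_relι (D.map u) (colimit.w (D ⋙ forget S L) u) R).trans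
              (Category.comp_id _).symm } }
  let K : Str S L :=
    { carrier := colimit (D ⋙ forget S L)
      func := fun f => (hf f).desc (funcD f)
      rel := fun R => colimit (D ⋙ relFunctor S R)
      relι := fun R => (hr R).desc (relD R)
      -- The power functor preserves this colimit, so the new relation is a filtered colimit of maps
      -- in `M` in the arrow category.
      relι_mem := fun R => MorphismProperty.colimitsOfShape_le _
        (.mk' _ _ _ _ (hr R) (isColimitOfPreserves (ihom (L.ar R)) hc)
          { app := fun j => (D.obj j).relι R
            naturality := fun i j u => relMap_relι (D.map u) R }
          (fun j => (D.obj j).relι_mem R) _ fun j => (hr R).fac (relD R) j) }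
  let c : Cocone D :=
    { pt := K
      ι :=
        { app := fun j =>
            { map := colimit.ι (D ⋙ forget S L) j
              func_comm := fun f => ((hf f).fac (funcD f) j).symm
              rel_comm := fun R => ⟨colimit.ι (D ⋙ relFunctor S R) j, (hr R).fac (relD R) j⟩ }
          naturality := fun i j u => Hom.ext ((colimit.cocone (D ⋙ forget S L)).ι.naturality u) } }
  have h1 : IsColimit ((forget S L).mapCocone c) := hc
  have h2 (R : L.Rel) : IsColimit ((relFunctor S R).mapCocone c) := by
    refine IsColimit.ofIsoColimit (hr R) (Cocone.ext (Iso.refl _) fun j => ?_)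
    have : Mono (K.relι R) := S.M_mono _ (K.relι_mem R)
    refine (Category.comp_id _).trans ((cancel_mono (K.relι R)).1 ?_)
    exact ((hr R).fac (relD R) j).trans (relMap_relι (c.ι.app j) R).symm
  exact ⟨c, isColimitOfForget lam hX c h1 h2, ⟨h1⟩, fun R => ⟨h2 R⟩⟩

end

end Str

/-! ## Partial structures -/

section Generalities

/-- A small skeleton of the presentable objects; it keeps the set of localizing maps and the
generator of structures small. -/
lemma exists_presentable_family (V : Type u) [Category.{w} V] (lam : Cardinal.{w})
    [Fact lam.IsRegular] [IsCardinalLocallyPresentable V lam] :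
    ∃ (ι : Type w) (G : ι → V), (∀ i, IsCardinalPresentable (G i) lam) ∧
      ∀ X : V, IsCardinalPresentable X lam → ∃ i, Nonempty (X ≅ G i) := by
  obtain ⟨P, _, hP⟩ := HasCardinalFilteredGenerator.exists_small_generator V lam
  have := hP.essentiallySmall_isPresentable
  obtain ⟨Q, _, hQ, hQ'⟩ := ObjectProperty.EssentiallySmall.exists_small_le.{w}
    (isCardinalPresentable V lam)
  refine ⟨Shrink.{w} (Subtype Q), fun i => ((equivShrink _).symm i).1,
    fun i => hQ _ ((equivShrink _).symm i).2, fun X hX => ?_⟩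
  obtain ⟨Y, hY, ⟨e⟩⟩ := hQ' X hX
  exact ⟨equivShrink _ ⟨Y, hY⟩, ⟨e ≪≫ eqToIso (by simp)⟩⟩

/-- Homs out of `Z` are homs from `G` after `F`, a composite of accessible functors. -/
lemma isCardinalPresentable_of_universal {C D : Type*} [Category.{w} C] [Category.{w} D]
    {lam : Cardinal.{w}} [Fact lam.IsRegular] (F : C ⥤ D) [F.IsCardinalAccessible lam]
    {G : D} (hG : IsCardinalPresentable G lam) {Z : C} (z : G ⟶ F.obj Z)
    (hz : ∀ (T : C) (y : G ⟶ F.obj T), ∃! h : Z ⟶ T, z ≫ F.map h = y) :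
    IsCardinalPresentable Z lam := by
  let e : coyoneda.obj (Opposite.op Z) ≅ F ⋙ coyoneda.obj (Opposite.op G) :=
    NatIso.ofComponents (fun T => (Equiv.ofBijective (fun h : Z ⟶ T => z ≫ F.map h)
      ⟨fun a b h => (hz T _).unique rfl h.symm, fun y => (hz T y).exists⟩).toIso)
      (fun f => by
        ext h
        change z ≫ F.map (h ≫ f) = (z ≫ F.map h) ≫ F.map f
        simp)
  have : (F ⋙ coyoneda.obj (Opposite.op G)).IsCardinalAccessible lam := inferInstance
  exact Functor.isCardinalAccessible_of_natIso e.symm lam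

end Generalities

section Pi

variable {I : Type w} {C : I → Type*} [∀ i, Category.{w} (C i)] {J : Type w} [SmallCategory J]

instance Pi.hasColimitsOfShape [∀ i, HasColimitsOfShape J (C i)] :
    HasColimitsOfShape J (∀ i, C i) where
  has_colimit _ := pi.hasColimit_of_hasColimit_comp_eval

instance Pi.preservesColimitsOfShape_eval [∀ i, HasColimitsOfShape J (C i)] (i : I) :
    PreservesColimitsOfShape J (Pi.eval C i) where
  preservesColimit {F} := preservesColimit_of_preserves_colimit_cocone
    (pi.coconeOfCoconeEvalIsColimit fun i => colimit.isColimit (F ⋙ Pi.eval C i))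
    (colimit.isColimit (F ⋙ Pi.eval C i))

end Pi

section

variable {V : Type u} [Category.{w} V]

/-- The arities used to describe `L`-structures as partial structures. -/
noncomputable abbrev Language.wt [HasBinaryCoproducts V] (L : Language V) : L.Func ⊕ L.Rel → V :=
  Sum.elim (fun f => L.dom f ⨿ L.cod f) L.ar

variable [MonoidalCategory V] [MonoidalClosed V] [HasBinaryCoproducts V]

/-- The functor sending `A` to the family of all `A^X`, with `X = L.wt s`. -/
noncomputable def Language.powers (L : Language V) : V ⥤ (L.Func ⊕ L.Rel → V) :=
  Functor.pi' fun s => ihom (L.wt s)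

/-- Partial `L`-structures: an object `A` with maps `P_f ⟶ A^(dom f ⨿ cod f)` for all function
symbols and `P_R ⟶ A^(ar R)` for all relation symbols. -/
abbrev Pre (L : Language V) := Comma (𝟭 (L.Func ⊕ L.Rel → V)) L.powers

namespace Pre

variable {L : Language V}

/-- The structure map of a partial structure. -/
noncomputable def op (Z : Pre L) (s : L.Func ⊕ L.Rel) :
    Z.left s ⟶ (ihom (L.wt s)).obj Z.right := Z.hom s

lemma op_comm {Z T : Pre L} (h : Z ⟶ T) (s : L.Func ⊕ L.Rel) :
    h.left s ≫ T.op s = Z.op s ≫ (ihom (L.wt s)).map h.right :=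
  congrFun h.w s

/-- The structure map of a partial structure at a function symbol. -/
noncomputable def opFunc (Z : Pre L) (f : L.Func) :
    Z.left (Sum.inl f) ⟶ (ihom (L.dom f ⨿ L.cod f)).obj Z.right :=
  Z.op (Sum.inl f)

lemma opFunc_comm {Z T : Pre L} (h : Z ⟶ T) (f : L.Func) :
    h.left (Sum.inl f) ≫ T.opFunc f = Z.opFunc f ≫ (ihom (L.dom f ⨿ L.cod f)).map h.right :=
  op_comm h (Sum.inl f)

/-- The structure map of a partial structure at a relation symbol. -/
noncomputable def opRel (Z : Pre L) (R : L.Rel) :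
    Z.left (Sum.inr R) ⟶ (ihom (L.ar R)).obj Z.right :=
  Z.op (Sum.inr R)

/-- The map `P_f ⟶ A^(dom f)` of a partial structure. -/
noncomputable def src (Z : Pre L) (f : L.Func) :
    Z.left (Sum.inl f) ⟶ (ihom (L.dom f)).obj Z.right :=
  Z.opFunc f ≫ (MonoidalClosed.pre coprod.inl).app Z.right

/-- The map `P_f ⟶ A^(cod f)` of a partial structure. -/
noncomputable def tgt (Z : Pre L) (f : L.Func) :
    Z.left (Sum.inl f) ⟶ (ihom (L.cod f)).obj Z.right :=
  Z.opFunc f ≫ (MonoidalClosed.pre coprod.inr).app Z.right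

lemma src_comm {Z T : Pre L} (h : Z ⟶ T) (f : L.Func) :
    h.left (Sum.inl f) ≫ T.src f = Z.src f ≫ (ihom (L.dom f)).map h.right := by
  rw [src, src, Category.assoc, MonoidalClosed.pre_comm_ihom_map, reassoc_of% opFunc_comm h f]

lemma tgt_comm {Z T : Pre L} (h : Z ⟶ T) (f : L.Func) :
    h.left (Sum.inl f) ≫ T.tgt f = Z.tgt f ≫ (ihom (L.cod f)).map h.right := by
  rw [tgt, tgt, Category.assoc, MonoidalClosed.pre_comm_ihom_map, reassoc_of% opFunc_comm h f]

/-- Constructor for morphisms of partial structures. -/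
def homMk {Z T : Pre L} (r : Z.right ⟶ T.right) (l : ∀ s, Z.left s ⟶ T.left s)
    (w : ∀ s, l s ≫ T.op s = Z.op s ≫ (ihom (L.wt s)).map r) : Z ⟶ T :=
  ⟨l, r, funext w⟩

@[simp] lemma homMk_right {Z T : Pre L} (r : Z.right ⟶ T.right) (l : ∀ s, Z.left s ⟶ T.left s)
    (w : ∀ s, l s ≫ T.op s = Z.op s ≫ (ihom (L.wt s)).map r) : (homMk r l w).right = r := rfl

@[simp] lemma homMk_left {Z T : Pre L} (r : Z.right ⟶ T.right) (l : ∀ s, Z.left s ⟶ T.left s)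
    (w : ∀ s, l s ≫ T.op s = Z.op s ≫ (ihom (L.wt s)).map r) (s : L.Func ⊕ L.Rel) :
    (homMk r l w).left s = l s := rfl

lemma hom_ext {Z T : Pre L} {g h : Z ⟶ T} (hr : g.right = h.right)
    (hl : ∀ s, g.left s = h.left s) : g = h :=
  CommaMorphism.ext (funext hl) hr

variable [HasColimits V]

lemma exists_free_carrier (X : V) : ∃ (Z : Pre L) (η : X ⟶ Z.right),
    ∀ (T : Pre L) (y : X ⟶ T.right), ∃! h : Z ⟶ T, η ≫ h.right = y := by
  refine ⟨⟨fun _ => ⊥_ V, X, fun _ => initial.to _⟩, 𝟙 X, fun T y => ?_⟩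
  refine ⟨homMk y (fun _ => initial.to _) fun s => initial.hom_ext _ _, Category.id_comp y,
    fun h hh => hom_ext ((Category.id_comp _).symm.trans hh) fun s => initial.hom_ext _ _⟩

/-- The free object has `G` at sort `s`, the initial object at the other sorts, and carrier `L.wt s
⊗ G`, so that the structure map is the unit of the tensor-hom adjunction. -/
lemma exists_free_sort (s : L.Func ⊕ L.Rel) (G : V) : ∃ (Z : Pre L) (z : G ⟶ Z.left s),
    ∀ (T : Pre L) (y : G ⟶ T.left s), ∃! h : Z ⟶ T, z ≫ h.left s = y := by
  -- A coproduct over the proofs of `t = s`: it is `G` when `t = s` and initial otherwise, with no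
  -- case distinction.
  let P (t : L.Func ⊕ L.Rel) : V := ∐ fun _ : PLift (t = s) => G
  let p (t : L.Func ⊕ L.Rel) : P t ⟶ (ihom (L.wt t)).obj (L.wt s ⊗ G) :=
    Sigma.desc fun h => curry (eqToHom (by rw [h.down]))
  refine ⟨⟨P, L.wt s ⊗ G, p⟩, Sigma.ι (fun _ : PLift (s = s) => G) ⟨rfl⟩, fun T y => ?_⟩
  let l (t : L.Func ⊕ L.Rel) : P t ⟶ T.left t := Sigma.desc fun h => y ≫ eqToHom (by rw [h.down])
  refine ⟨homMk (uncurry (y ≫ T.op s)) l fun t => Sigma.hom_ext _ _ ?_, ?_, fun h hh => ?_⟩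
  · rintro ⟨rfl⟩
    simp only [l, op, p, colimit.ι_desc_assoc, Cofan.mk_ι_app, eqToHom_refl, Category.comp_id]
    have h : Sigma.ι (fun _ : PLift (t = t) => G) ⟨rfl⟩ ≫ (Sigma.desc fun _ => y) ≫ T.op t =
        curry (𝟙 (L.wt t ⊗ G)) ≫ (ihom (L.wt t)).map (uncurry (y ≫ T.op t)) := by
      rw [← curry_natural_right, Category.id_comp, MonoidalClosed.curry_uncurry,
        colimit.ι_desc_assoc]
      rfl
    exact h
  · simp [l]
  · have hl (t) : h.left t = l t := Sigma.hom_ext _ _ (by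
      rintro ⟨rfl⟩
      simp only [l, colimit.ι_desc, Cofan.mk_ι_app, eqToHom_refl, Category.comp_id]
      exact hh)
    refine hom_ext ?_ hl
    have h1 := op_comm h s
    have h2 : Sigma.ι (fun _ : PLift (s = s) => G) ⟨rfl⟩ ≫ p s = curry (𝟙 _) := by
      simp [p]
    have h3 : Sigma.ι (fun _ : PLift (s = s) => G) ⟨rfl⟩ ≫ h.left s ≫ T.op s =
        (Sigma.ι (fun _ : PLift (s = s) => G) ⟨rfl⟩ ≫ p s) ≫ (ihom (L.wt s)).map h.right :=
      (congrArg (_ ≫ ·) h1).trans (Category.assoc _ _ _).symm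
    rw [h2, ← curry_natural_right, ← Category.assoc] at h3
    refine (Category.id_comp _).symm.trans (MonoidalClosed.curry_injective (h3.symm.trans ?_))
    exact (congrArg (· ≫ T.op s) hh).trans (MonoidalClosed.curry_uncurry _).symm

instance : HasColimitsOfSize.{w, w} (Pre L) where
  has_colimits_of_shape _ _ := inferInstance

variable (L) in
/-- The functor sending a partial structure to its underlying object. -/
noncomputable abbrev carrier : Pre L ⥤ V := Comma.snd _ _

/-- The functor sending a partial structure to its object of sort `s`. -/
noncomputable abbrev sort (s : L.Func ⊕ L.Rel) : Pre L ⥤ V := Comma.fst _ _ ⋙ Pi.eval _ s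

instance (lam : Cardinal.{w}) [Fact lam.IsRegular] : (carrier L).IsCardinalAccessible lam where
  preservesColimitOfShape _ _ _ := inferInstance

instance (s : L.Func ⊕ L.Rel) (lam : Cardinal.{w}) [Fact lam.IsRegular] :
    (sort s).IsCardinalAccessible lam where
  preservesColimitOfShape _ _ _ := inferInstance

variable {lam : Cardinal.{w}} [Fact lam.IsRegular]

/-- The map `T.src f` is invertible when it is bijective on `G`-elements for presentable `G`.
Elements of `P_f` and of `A^(dom f)` are represented by free partial structures, `src` is
represented by a map `m` between these, and bijectivity is locality at `m`. -/
lemma exists_isLocal_iff (hV : LocPresentableAsClosed V lam)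
    (hL : L.IsAry lam) : ∃ W : MorphismProperty (Pre L), MorphismProperty.IsSmall.{w} W ∧
      (∀ ⦃X Y : Pre L⦄ (f : X ⟶ Y), W f →
        IsCardinalPresentable X lam ∧ IsCardinalPresentable Y lam) ∧
      ∀ T : Pre L, W.isLocal T ↔ ∀ f, IsIso (T.src f) := by
  have := hV.locallyPresentable
  obtain ⟨ι, G, hG, hG'⟩ := exists_presentable_family V lam
  choose Z₁ η hη using fun p : L.Func × ι => exists_free_carrier (L := L) (L.dom p.1 ⊗ G p.2)
  choose Z₂ z hz using fun p : L.Func × ι => exists_free_sort (L := L) (Sum.inl p.1) (G p.2)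
  choose m hm using fun p : L.Func × ι => (hη p (Z₂ p) (uncurry (z p ≫ (Z₂ p).src p.1))).exists
  have key (p : L.Func × ι) (T : Pre L) (h : Z₂ p ⟶ T) : η p ≫ (m p ≫ h).right =
      uncurry ((z p ≫ h.left (Sum.inl p.1)) ≫ T.src p.1) := by
    rw [Category.assoc, src_comm, ← Category.assoc, MonoidalClosed.uncurry_natural_right, ← hm,
      Category.assoc]
    rfl
  refine ⟨.ofHoms m, inferInstance, ?_, fun T => ⟨fun h f => ?_, ?_⟩⟩
  · rintro _ _ _ ⟨p⟩
    exact ⟨isCardinalPresentable_of_universal (carrier L)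
      (hV.tensor _ _ (hL.dom p.1) (hG p.2)) (η p) (hη p),
      isCardinalPresentable_of_universal (sort (Sum.inl p.1)) (hG p.2) (z p) (hz p)⟩
  · have h' (i : ι) : Function.Bijective fun y : G i ⟶ T.left (Sum.inl f) => y ≫ T.src f := by
      obtain ⟨inj, surj⟩ := h _ (.mk (f, i))
      refine ⟨fun a b hab => ?_, fun b => ?_⟩
      · obtain ⟨a', rfl, -⟩ := hz (f, i) T a
        obtain ⟨b', rfl, -⟩ := hz (f, i) T b
        have : a' = b' := inj ((hη (f, i) T _).unique (key (f, i) T a')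
          ((key (f, i) T b').trans (congrArg uncurry hab.symm)))
        rw [this]
      · obtain ⟨k, hk, -⟩ := hη (f, i) T (uncurry b)
        obtain ⟨a, rfl⟩ := surj k
        exact ⟨_, MonoidalClosed.uncurry_injective ((key (f, i) T a).symm.trans hk)⟩
    refine isIso_of_presentable lam _ (fun X hX a b hab => ?_) fun X hX b => ?_
    · obtain ⟨i, ⟨e⟩⟩ := hG' X hX
      rw [← cancel_epi e.inv]
      exact (h' i).1 (by simp [hab])
    · obtain ⟨i, ⟨e⟩⟩ := hG' X hX
      obtain ⟨a, ha⟩ := (h' i).2 (e.inv ≫ b)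
      exact ⟨e.hom ≫ a, by simpa using congrArg (e.hom ≫ ·) ha⟩
  · rintro h _ _ _ ⟨⟨f, i⟩⟩
    have := h f
    refine ⟨fun a b hab => (hz (f, i) T _).unique rfl ?_, fun k => ?_⟩
    · have h1 := key (f, i) T a
      have h2 := key (f, i) T b
      rw [show m (f, i) ≫ a = m (f, i) ≫ b from hab, h2] at h1
      exact (cancel_mono (T.src f)).1 (MonoidalClosed.uncurry_injective h1)
    · obtain ⟨a, ha, -⟩ := hz (f, i) T (curry (η (f, i) ≫ k.right) ≫ inv (T.src f))
      refine ⟨a, (hη (f, i) T _).unique (key (f, i) T a) ?_⟩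
      rw [ha, Category.assoc, IsIso.inv_hom_id, Category.comp_id, MonoidalClosed.uncurry_curry]

end Pre

end

/-! ## Structures as a reflective subcategory of partial structures -/

section

variable {V : Type u} [Category.{w} V] [MonoidalCategory V] [SymmetricCategory V]
  [MonoidalClosed V] [HasBinaryCoproducts V]

lemma pow_coprod_hom_ext {W X Y A : V} {g h : W ⟶ (ihom (X ⨿ Y)).obj A}
    (h1 : g ≫ (MonoidalClosed.pre coprod.inl).app A = h ≫ (MonoidalClosed.pre coprod.inl).app A)
    (h2 : g ≫ (MonoidalClosed.pre coprod.inr).app A = h ≫ (MonoidalClosed.pre coprod.inr).app A) :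
    g = h := by
  have : swapHom g = swapHom h := by
    refine coprod.hom_ext ?_ ?_
    · rw [← swapHom_comp_pre, ← swapHom_comp_pre, h1]
    · rw [← swapHom_comp_pre, ← swapHom_comp_pre, h2]
  rw [← swapHom_swapHom g, this, swapHom_swapHom]

/-- The map `W ⟶ A^(X ⨿ Y)` with components `a` and `b`. -/
noncomputable def powPair {W X Y A : V} (a : W ⟶ (ihom X).obj A) (b : W ⟶ (ihom Y).obj A) :
    W ⟶ (ihom (X ⨿ Y)).obj A :=
  swapHom (coprod.desc (swapHom a) (swapHom b))

lemma powPair_inl {W X Y A : V} (a : W ⟶ (ihom X).obj A) (b : W ⟶ (ihom Y).obj A) :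
    powPair a b ≫ (MonoidalClosed.pre coprod.inl).app A = a := by
  rw [← swapHom_swapHom (_ ≫ _), swapHom_comp_pre, powPair, swapHom_swapHom, coprod.inl_desc,
    swapHom_swapHom]

lemma powPair_inr {W X Y A : V} (a : W ⟶ (ihom X).obj A) (b : W ⟶ (ihom Y).obj A) :
    powPair a b ≫ (MonoidalClosed.pre coprod.inr).app A = b := by
  rw [← swapHom_swapHom (_ ≫ _), swapHom_comp_pre, powPair, swapHom_swapHom, coprod.inr_desc,
    swapHom_swapHom]

variable {S : FactSystem V} {L : Language V}

namespace Str

/-- A structure as a partial structure. -/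
noncomputable def toPreObj (A : Str S L) : Pre L where
  left := Sum.rec (fun f => (ihom (L.dom f)).obj A.carrier) A.rel
  right := A.carrier
  hom := Sum.rec (fun f => powPair (𝟙 _) (A.func f)) A.relι

lemma src_toPreObj (A : Str S L) (f : L.Func) : A.toPreObj.src f = 𝟙 _ := powPair_inl _ _

lemma tgt_toPreObj (A : Str S L) (f : L.Func) : A.toPreObj.tgt f = A.func f := powPair_inr _ _

/-- A morphism from a partial structure to a structure. -/
lemma exists_hom_toPreObj {Z : Pre L} {A : Str S L} (g : Z.right ⟶ A.carrier)
    (hf : ∀ f, Z.src f ≫ (ihom (L.dom f)).map g ≫ A.func f = Z.tgt f ≫ (ihom (L.cod f)).map g)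
    (hR : ∀ R, ∃ l : Z.left (Sum.inr R) ⟶ A.rel R,
      l ≫ A.relι R = Z.opRel R ≫ (ihom (L.ar R)).map g) :
    ∃ h : Z ⟶ A.toPreObj, h.right = g := by
  choose l hl using hR
  refine ⟨Pre.homMk g (Sum.rec (fun f => Z.src f ≫ (ihom (L.dom f)).map g) l)
    (Sum.rec (fun f => pow_coprod_hom_ext ?_ ?_) hl), rfl⟩
  · have h1 : A.toPreObj.opFunc f ≫ (MonoidalClosed.pre coprod.inl).app A.carrier = 𝟙 _ :=
      src_toPreObj A f
    have h2 : Z.src f ≫ (ihom (L.dom f)).map g =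
        (Z.opFunc f ≫ (ihom _).map g) ≫ (MonoidalClosed.pre coprod.inl).app A.carrier := by
      rw [Pre.src, Category.assoc, Category.assoc, MonoidalClosed.pre_comm_ihom_map]
    refine Eq.trans ?_ h2
    exact (Category.assoc _ _ _).trans ((congrArg (_ ≫ ·) h1).trans (Category.comp_id _))
  · have h1 : A.toPreObj.opFunc f ≫ (MonoidalClosed.pre coprod.inr).app A.carrier =
        A.func f := tgt_toPreObj A f
    have h2 : Z.tgt f ≫ (ihom (L.cod f)).map g =
        (Z.opFunc f ≫ (ihom _).map g) ≫ (MonoidalClosed.pre coprod.inr).app A.carrier := by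
      rw [Pre.tgt, Category.assoc, Category.assoc, MonoidalClosed.pre_comm_ihom_map]
    refine Eq.trans ?_ h2
    exact (Category.assoc _ _ _).trans ((congrArg (_ ≫ ·) h1).trans
      ((Category.assoc _ _ _).trans (hf f)))

lemma left_toPreObj {Z : Pre L} {A : Str S L} (g : Z ⟶ A.toPreObj) (f : L.Func) :
    g.left (Sum.inl f) = Z.src f ≫ (ihom (L.dom f)).map g.right :=
  (Category.comp_id _).symm.trans
    ((congrArg (_ ≫ ·) (src_toPreObj A f)).symm.trans (Pre.src_comm g f))

/-- In a structure the function sorts are identified with powers of the carrier, and the relation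
sorts are subobjects of such powers, so the underlying map determines everything. -/
lemma hom_toPreObj_ext {Z : Pre L} {A : Str S L} {g h : Z ⟶ A.toPreObj}
    (e : g.right = h.right) : g = h := by
  refine Pre.hom_ext e (Sum.rec (fun f => ?_) fun R => ?_)
  · rw [left_toPreObj, left_toPreObj, e]
  · have h1 := Pre.op_comm g (Sum.inr R)
    have h2 := Pre.op_comm h (Sum.inr R)
    have : Mono (A.toPreObj.op (Sum.inr R)) := S.M_mono _ (A.relι_mem R)
    rw [← cancel_mono (A.toPreObj.op (Sum.inr R)), h1, h2, e]

end Str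

variable {lam : Cardinal.{w}} [Fact lam.IsRegular]

namespace Str

/-- The underlying map of a morphism from a partial structure to a structure. -/
def preMap {Z : Pre L} {A : Str S L} (h : Z ⟶ A.toPreObj) : Z.right ⟶ A.carrier := h.right

lemma preMap_injective {Z : Pre L} {A : Str S L} {g h : Z ⟶ A.toPreObj}
    (e : preMap g = preMap h) : g = h := hom_toPreObj_ext e

lemma preMap_func {Z : Pre L} {A : Str S L} (h : Z ⟶ A.toPreObj) (f : L.Func) :
    Z.src f ≫ (ihom (L.dom f)).map (preMap h) ≫ A.func f =
      Z.tgt f ≫ (ihom (L.cod f)).map (preMap h) := by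
  have h1 := Pre.tgt_comm h f
  rw [tgt_toPreObj, left_toPreObj] at h1
  exact (Category.assoc _ _ _).symm.trans h1

lemma preMap_rel {Z : Pre L} {A : Str S L} (h : Z ⟶ A.toPreObj) (R : L.Rel) :
    ∃ l : Z.left (Sum.inr R) ⟶ A.rel R,
      l ≫ A.relι R = Z.opRel R ≫ (ihom (L.ar R)).map (preMap h) :=
  ⟨h.left (Sum.inr R), Pre.op_comm h (Sum.inr R)⟩

end Str

/-- The reflection of a partial structure whose maps `P_f ⟶ A^(dom f)` are isomorphisms. -/
lemma Str.exists_reflection_of_isIso (S : FactSystem V) (T : Pre L) (hT : ∀ f, IsIso (T.src f)) :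
    ∃ (K : Str S L) (η : T ⟶ K.toPreObj), ∀ (A : Str S L) (h : T ⟶ A.toPreObj),
      ∃! g : K ⟶ A, preMap η ≫ Hom.map g = preMap h := by
  let K : Str S L :=
    { carrier := T.right
      func := fun f => inv (T.src f) ≫ T.tgt f
      -- Orthogonality extends a map from `P_R` into a relation of any structure to this image.
      rel := fun R => S.im (T.opRel R)
      relι := fun R => S.imι (T.opRel R)
      relι_mem := fun R => (S.im_spec _).2.1 }
  obtain ⟨η, hη⟩ : ∃ η : T ⟶ K.toPreObj, preMap η = 𝟙 T.right :=
    exists_hom_toPreObj _ (fun f => by simp [K]) fun R =>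
      ⟨S.toIm _, (S.im_spec (T.opRel R)).2.2.trans (by simp)⟩
  refine ⟨K, η, fun A h => ⟨⟨preMap h, fun f => ?_, fun R => ?_⟩, ?_, fun g hg => ?_⟩⟩
  · change (inv (T.src f) ≫ T.tgt f) ≫ _ = _
    rw [Category.assoc, IsIso.inv_comp_eq]
    exact (preMap_func h f).symm
  · obtain ⟨l, hl⟩ := preMap_rel h R
    obtain ⟨d, ⟨-, hd⟩, -⟩ := S.orth (S.toIm (T.opRel R)) (A.relι R) (S.im_spec _).1
      (A.relι_mem R) l (S.imι (T.opRel R) ≫ (ihom (L.ar R)).map (preMap h))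
      (by rw [hl, reassoc_of% (S.im_spec (T.opRel R)).2.2])
    exact ⟨d, hd⟩
  · change preMap η ≫ preMap h = preMap h
    exact (congrArg (· ≫ preMap h) hη).trans (Category.id_comp _)
  · exact Hom.ext (((Category.id_comp _).symm.trans
      (congrArg (· ≫ Hom.map g) hη).symm).trans hg)

/-- A morphism of structures as a morphism of partial structures. -/
lemma Str.exists_preMap_eq {A B : Str S L} (g : A ⟶ B) :
    ∃ h : A.toPreObj ⟶ B.toPreObj, preMap h = Hom.map g := by
  refine exists_hom_toPreObj (Z := A.toPreObj) (Hom.map g) (fun f => ?_) fun R => Hom.rel_comm g R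
  rw [src_toPreObj, tgt_toPreObj]
  exact (Category.id_comp _).trans (Hom.func_comm g f).symm

lemma Str.exists_preMap_eq_comp {Z : Pre L} {A B : Str S L} (h : Z ⟶ A.toPreObj) (g : A ⟶ B) :
    ∃ h' : Z ⟶ B.toPreObj, preMap h' = preMap h ≫ Hom.map g := by
  obtain ⟨g', hg'⟩ := exists_preMap_eq g
  exact ⟨h ≫ g', congrArg (preMap h ≫ ·) hg'⟩

/-- Two reflections in succession: orthogonal localization makes all partial operations total, then
images turn the relation sorts into relations. -/
lemma Str.exists_reflection [HasColimits V] (hV : LocPresentableAsClosed V lam) (hL : L.IsAry lam)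
    (S : FactSystem V) (Z : Pre L) :
    ∃ (K : Str S L) (η : Z ⟶ K.toPreObj), ∀ (A : Str S L) (h : Z ⟶ A.toPreObj),
      ∃! g : K ⟶ A, preMap η ≫ Hom.map g = preMap h := by
  obtain ⟨W, _, hW, hW'⟩ := Pre.exists_isLocal_iff hV hL
  have := MorphismProperty.isRightAdjoint_ι_isLocal W lam hW
  let adj := Adjunction.ofIsRightAdjoint W.isLocal.ι
  let T := W.isLocal.ι.leftAdjoint.obj Z
  let u : Z ⟶ T.obj := adj.unit.app Z
  obtain ⟨K, η, hη⟩ := exists_reflection_of_isIso S T.obj ((hW' _).1 T.property)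
  have hu {A : Str S L} (h : Z ⟶ A.toPreObj) : ∃! h' : T.obj ⟶ A.toPreObj, u ≫ h' = h := by
    have hA : W.isLocal A.toPreObj := (hW' _).2 fun f => by
      rw [src_toPreObj]
      exact inferInstanceAs (IsIso (𝟙 ((ihom (L.dom f)).obj A.carrier)))
    let e := adj.homEquiv Z ⟨A.toPreObj, hA⟩
    have he (k) : e k = u ≫ k.hom := adj.homEquiv_unit _ _ _
    refine ⟨(e.symm h).hom, (he _).symm.trans (e.apply_symm_apply h), fun k hk => ?_⟩
    have : ObjectProperty.homMk k = e.symm h := by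
      rw [Equiv.eq_symm_apply, he]
      exact hk
    exact congrArg (fun t => t.hom) this
  refine ⟨K, u ≫ η, fun A h => ?_⟩
  obtain ⟨h', rfl, -⟩ := hu h
  obtain ⟨g, hg, hg'⟩ := hη A h'
  refine ⟨g, (Category.assoc _ _ _).trans (congrArg (u.right ≫ ·) hg), fun k hk => hg' k ?_⟩
  obtain ⟨k', hk'⟩ := exists_preMap_eq_comp η k
  have : k' = h' := (hu (u ≫ h')).unique (preMap_injective (((congrArg (u.right ≫ ·) hk').trans
    (Category.assoc _ _ _).symm).trans hk)) rfl
  exact hk'.symm.trans (congrArg preMap this)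

namespace Str

variable (S L) in
/-- The embedding of structures into partial structures. -/
noncomputable def toPre : Str S L ⥤ Pre L where
  obj := toPreObj
  map g := (exists_preMap_eq g).choose
  map_id A := preMap_injective (exists_preMap_eq (𝟙 A)).choose_spec
  map_comp g h := preMap_injective ((exists_preMap_eq (g ≫ h)).choose_spec.trans
    (congrArg₂ (· ≫ ·) (exists_preMap_eq g).choose_spec (exists_preMap_eq h).choose_spec).symm)

lemma preMap_toPre {A B : Str S L} (g : A ⟶ B) : preMap ((toPre S L).map g) = Hom.map g :=
  (exists_preMap_eq g).choose_spec

instance : (toPre S L).Faithful where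
  map_injective {A B g h} e := Hom.ext (by rw [← preMap_toPre, e, preMap_toPre])

instance : (toPre S L).Full where
  map_surjective {A B} h := by
    refine ⟨⟨preMap h, fun f => ?_, fun R => preMap_rel h R⟩, preMap_injective (preMap_toPre _)⟩
    have := preMap_func (Z := A.toPreObj) h f
    rw [src_toPreObj, tgt_toPreObj] at this
    exact this.symm.trans (Category.id_comp _)

lemma isRightAdjoint_toPre [HasColimits V] (hV : LocPresentableAsClosed V lam) (hL : L.IsAry lam) :
    (toPre S L).IsRightAdjoint := by
  rw [Functor.isRightAdjoint_iff_leftAdjointObjIsDefined_eq_top]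
  ext Z
  obtain ⟨K, η, hη⟩ := exists_reflection hV hL S Z
  have h (A : Str S L) : Function.Bijective fun g : K ⟶ A => η ≫ (toPre S L).map g := by
    have hp (g : K ⟶ A) : preMap (η ≫ (toPre S L).map g) = preMap η ≫ Hom.map g :=
      congrArg (preMap η ≫ ·) (preMap_toPre g)
    refine ⟨fun a b hab => (hη A _).unique (hp a).symm ((hp b).symm.trans ?_), fun k => ?_⟩
    · exact congrArg preMap hab.symm
    · obtain ⟨g, hg, -⟩ := hη A k
      exact ⟨g, preMap_injective ((hp g).trans hg)⟩
  have e : (toPre S L ⋙ coyoneda.obj (Opposite.op Z)).CorepresentableBy K :=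
    { homEquiv := Equiv.ofBijective _ (h _)
      homEquiv_comp := fun g f => by
        change η ≫ (toPre S L).map (f ≫ g) = (η ≫ (toPre S L).map f) ≫ (toPre S L).map g
        rw [Functor.map_comp]
        exact (Category.assoc _ _ _).symm }
  simpa using! e.isCorepresentable

/-- A reflective full subcategory of the cocomplete comma category of partial structures. -/
lemma hasColimits [HasColimits V] (hV : LocPresentableAsClosed V lam) (hL : L.IsAry lam) :
    HasColimitsOfSize.{w, w} (Str S L) := by
  have := isRightAdjoint_toPre (S := S) hV hL
  have : Reflective (toPre S L) := { L := _, adj := Adjunction.ofIsRightAdjoint _ }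
  exact hasColimits_of_reflective (toPre S L)

/-- Free structures. -/
lemma exists_free [HasColimits V] (hV : LocPresentableAsClosed V lam) (hL : L.IsAry lam)
    (S : FactSystem V) (X : V) : ∃ (F : Str S L) (η : X ⟶ F.carrier),
      ∀ (K : Str S L) (y : X ⟶ K.carrier), ∃! g : F ⟶ K, η ≫ Hom.map g = y := by
  obtain ⟨Z, ζ, hζ⟩ := Pre.exists_free_carrier (L := L) X
  obtain ⟨F, η, hη⟩ := exists_reflection hV hL S Z
  refine ⟨F, ζ ≫ preMap η, fun K y => ?_⟩
  obtain ⟨h, hh, -⟩ := hζ K.toPreObj y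
  obtain ⟨g, hg, hg'⟩ := hη K h
  refine ⟨g, ((Category.assoc _ _ _).trans (congrArg (ζ ≫ ·) hg)).trans hh, fun k hk => hg' k ?_⟩
  obtain ⟨k', hk'⟩ := exists_preMap_eq_comp η k
  have : k' = h := (hζ K.toPreObj y).unique (((congrArg (ζ ≫ ·) hk').trans
    (Category.assoc _ _ _).symm).trans hk) hh
  exact hk'.symm.trans (congrArg preMap this)

/-- Structures freely generated by an element of a relation. -/
lemma exists_free_rel [HasColimits V] (hV : LocPresentableAsClosed V lam) (hL : L.IsAry lam)
    (S : FactSystem V) (R : L.Rel) (G : V) : ∃ (F : Str S L) (η : G ⟶ F.rel R),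
      ∀ (K : Str S L) (y : G ⟶ K.rel R), ∃! g : F ⟶ K, η ≫ relMap g R = y := by
  obtain ⟨Z, ζ, hζ⟩ := Pre.exists_free_sort (L := L) (Sum.inr R) G
  obtain ⟨F, η, hη⟩ := exists_reflection hV hL S Z
  let η' : Z.left (Sum.inr R) ⟶ F.rel R := η.left (Sum.inr R)
  have hη' {K : Str S L} (g : F ⟶ K) (h : Z ⟶ K.toPreObj) (e : preMap η ≫ Hom.map g = preMap h) :
      η' ≫ relMap g R = h.left (Sum.inr R) := by
    have h1 : η' ≫ F.relι R = Z.opRel R ≫ (ihom (L.ar R)).map (preMap η) :=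
      Pre.op_comm η (Sum.inr R)
    refine (cancel_mono (K.relι R)).1 (Eq.trans ?_ (Pre.op_comm h (Sum.inr R)).symm)
    rw [Category.assoc, relMap_relι, reassoc_of% h1, ← Functor.map_comp, e]
    rfl
  refine ⟨F, ζ ≫ η', fun K y => ?_⟩
  obtain ⟨h, hh, -⟩ := hζ K.toPreObj y
  obtain ⟨g, hg, hg'⟩ := hη K h
  refine ⟨g, ((Category.assoc _ _ _).trans (congrArg (ζ ≫ ·) (hη' g h hg))).trans hh,
    fun k hk => hg' k ?_⟩
  obtain ⟨k', hk'⟩ := exists_preMap_eq_comp η k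
  have : k' = h := (hζ K.toPreObj y).unique ((congrArg (ζ ≫ ·) (hη' k k' hk'.symm)).symm.trans
    ((Category.assoc _ _ _).symm.trans hk)) hh
  exact hk'.symm.trans (congrArg preMap this)

end Str

end

/-! ## Presentations and presentable structures -/

namespace Str

section

variable {V : Type u} [Category.{w} V] [MonoidalCategory V] [MonoidalClosed V]
  {S : FactSystem V} {L : Language V} {lam : Cardinal.{w}} [Fact lam.IsRegular]
  {J : Type w} [SmallCategory J] [IsCardinalFiltered J lam] {D : J ⥤ Str S L} {c : Cocone D}

lemma isColimit_forget_and_rel [HasColimits V] (hV : LocPresentableAsClosed V lam) (hL : L.IsAry lam)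
    (hM : S.ClosedUnderFiltered lam) (hc : IsColimit c) :
    Nonempty (IsColimit ((forget S L).mapCocone c)) ∧
      ∀ R : L.Rel, Nonempty (IsColimit ((relFunctor S R).mapCocone c)) := by
  have := hV.locallyPresentable
  obtain ⟨c', hc', ⟨h1⟩, h2⟩ := exists_isColimit_of_filtered lam
    (fun f => isCardinalAccessible_ihom hV.tensor _ (hL.dom f))
    (fun R => isCardinalAccessible_ihom hV.tensor _ (hL.ar R)) hM D
  let e := hc'.uniqueUpToIso hc
  exact ⟨⟨h1.ofIsoColimit ((Cocone.functoriality D (forget S L)).mapIso e)⟩, fun R =>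
    ⟨(h2 R).some.ofIsoColimit ((Cocone.functoriality D (relFunctor S R)).mapIso e)⟩⟩

lemma exists_stage_hom (hc : IsColimit ((forget S L).mapCocone c)) {G : V}
    (hG : IsCardinalPresentable G lam) (f : G ⟶ c.pt.carrier) :
    ∃ (j : J) (f' : G ⟶ (D.obj j).carrier), f' ≫ Hom.map (c.ι.app j) = f :=
  IsCardinalPresentable.exists_hom_of_isColimit lam hc f

lemma exists_stage_eq (hc : IsColimit ((forget S L).mapCocone c)) {G : V}
    (hG : IsCardinalPresentable G lam) {j : J} {f g : G ⟶ (D.obj j).carrier}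
    (h : f ≫ Hom.map (c.ι.app j) = g ≫ Hom.map (c.ι.app j)) :
    ∃ (k : J) (u : j ⟶ k), f ≫ Hom.map (D.map u) = g ≫ Hom.map (D.map u) :=
  IsCardinalPresentable.exists_eq_of_isColimit' lam hc f g h

lemma map_comp_map_ι {j k : J} (u : j ⟶ k) :
    Hom.map (D.map u) ≫ Hom.map (c.ι.app k) = Hom.map (c.ι.app j) :=
  congrArg Hom.map (c.w u)

/-- A witness that the relation holds lifts to some stage, but there its underlying element agrees
with `a` only in the colimit. Since `L.ar R ⊗ G` is presentable, a later stage makes them equal. -/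
lemma exists_stage_relHolds (hT : ∀ X Y : V, IsCardinalPresentable X lam →
      IsCardinalPresentable Y lam → IsCardinalPresentable (X ⊗ Y) lam)
    (hL : L.IsAry lam) (hc : IsColimit ((forget S L).mapCocone c)) (R : L.Rel)
    (hR : IsColimit ((relFunctor S R).mapCocone c)) {G : V} (hG : IsCardinalPresentable G lam)
    {j : J} {a : L.ar R ⊗ G ⟶ (D.obj j).carrier}
    (h : c.pt.RelHolds R (a ≫ Hom.map (c.ι.app j))) :
    ∃ (k : J) (u : j ⟶ k), (D.obj k).RelHolds R (a ≫ Hom.map (D.map u)) := by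
  have := isFiltered_of_isCardinalFiltered J lam
  obtain ⟨l, hl⟩ := h
  obtain ⟨j', l', hl'⟩ : ∃ (j' : J) (l' : G ⟶ (D.obj j').rel R),
      l' ≫ relMap (c.ι.app j') R = l :=
    IsCardinalPresentable.exists_hom_of_isColimit lam hR l
  let m := IsFiltered.max j j'
  let u : j ⟶ m := IsFiltered.leftToMax j j'
  let v : j' ⟶ m := IsFiltered.rightToMax j j'
  have e : (a ≫ Hom.map (D.map u)) ≫ Hom.map (c.ι.app m) =
      (uncurry (l' ≫ (D.obj j').relι R) ≫ Hom.map (D.map v)) ≫ Hom.map (c.ι.app m) := by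
    rw [Category.assoc, Category.assoc, map_comp_map_ι, map_comp_map_ι,
      ← MonoidalClosed.uncurry_natural_right, Category.assoc, ← relMap_relι, reassoc_of% hl']
    exact ((congrArg uncurry hl).trans (MonoidalClosed.uncurry_curry _)).symm
  obtain ⟨k, p, hp⟩ := exists_stage_eq hc (hT _ _ (hL.ar R) hG) e
  refine ⟨k, u ≫ p, l' ≫ relMap (D.map v ≫ D.map p) R, ?_⟩
  rw [Functor.map_comp, comp_map, ← Category.assoc a, hp, Category.assoc l', relMap_relι,
    Category.assoc (uncurry _), comp_map, curry_natural_right, MonoidalClosed.curry_uncurry,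
    Category.assoc]

end

end Str

section

variable {V : Type u} [Category.{w} V] [MonoidalCategory V] [MonoidalClosed V] [HasLimits V]
  {S : FactSystem V} {L : Language V} {lam : Cardinal.{w}} [Fact lam.IsRegular]

/-- A presentable structure is presentable in the underlying ordinary category. -/
lemma Str.IsPresentable.isCardinalPresentable (hI : IsCardinalPresentable (𝟙_ V) lam)
    {B : Str S L} (hB : B.IsPresentable lam) : IsCardinalPresentable B lam := by
  have : (homFunctor B).IsCardinalAccessible lam := hB
  -- The point of `homObj B B` naming the identity is the universal element for `B`.
  obtain ⟨z, hz⟩ := (exists_point_iff (𝟙 B.carrier)).2 ⟨𝟙 B, rfl⟩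
  have hz' {T : Str S L} (h : B ⟶ T) : (z ≫ (compat_post B h).lift) ≫ homι B T =
      curry ((ρ_ B.carrier).hom ≫ Hom.map h) := by
    rw [Category.assoc, Compat.lift_ι, reassoc_of% hz, ← curry_natural_right]
  have hy {T : Str S L} (y : 𝟙_ V ⟶ homObj B T) :
      ∃! h : B ⟶ T, z ≫ (compat_post B h).lift = y := by
    obtain ⟨h, hh⟩ := (exists_point_iff ((ρ_ B.carrier).inv ≫ uncurry (y ≫ homι B T))).1
      ⟨y, by simp⟩
    refine ⟨h, (cancel_mono (homι B T)).1 ((hz' h).trans ?_), fun h' hh' => Hom.ext ?_⟩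
    · rw [hh]
      simp
    · rw [hh, ← hh', hz']
      simp
  exact isCardinalPresentable_of_universal (homFunctor B) hI z fun T y => hy y

end

section

variable {V : Type u} [Category.{w} V] [MonoidalCategory V] [SymmetricCategory V]
  [MonoidalClosed V] [HasLimits V] [HasColimits V] {S : FactSystem V} {L : Language V}
  {lam : Cardinal.{w}} [Fact lam.IsRegular] {kap : WithTop Cardinal.{w}}

/-- Satisfaction of a conjunction of atomic formulas in a `lam`-filtered colimit is witnessed at
some stage. -/
lemma Formula.SatP.exists_stage (hV : LocPresentableAsClosed V lam) (hL : L.IsAry lam)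
    (hS : S.IsProper) {J : Type w} [SmallCategory J] [IsCardinalFiltered J lam]
    {D : J ⥤ Str S L} {c : Cocone D} (hc : IsColimit ((Str.forget S L).mapCocone c))
    (hR : ∀ R, Nonempty (IsColimit ((Str.relFunctor S R).mapCocone c))) {X : V}
    {φ : Formula L lam kap X} (hφ : φ.IsConjAtomic) {G : V} (hG : IsCardinalPresentable G lam)
    {j : J} {a : X ⊗ G ⟶ (D.obj j).carrier} (h : φ.SatP c.pt (a ≫ Str.Hom.map (c.ι.app j))) :
    ∃ (k : J) (u : j ⟶ k), φ.SatP (D.obj k) (a ≫ Str.Hom.map (D.map u)) := by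
  induction hφ with
  | eq s t =>
    rw [satP_eq hS, Term.act_map, Term.act_map] at h
    obtain ⟨k, u, hu⟩ := Str.exists_stage_eq hc
      (hV.tensor _ _ (t.isCardinalPresentable hL hV.tensor) hG) h
    exact ⟨k, u, by rw [satP_eq hS, Term.act_map, Term.act_map, hu]⟩
  | rel R Y hY t =>
    rw [satP_rel, Term.act_map, ← Category.assoc] at h
    obtain ⟨k, u, hu⟩ := Str.exists_stage_relHolds hV.tensor hL hc R (hR R).some
      (hV.tensor _ _ hY hG) h
    exact ⟨k, u, by rwa [satP_rel, Term.act_map, ← Category.assoc]⟩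
  | conj hI φ hφ ih =>
    rw [satP_conj] at h
    choose k u hu using fun i => ih i (h i)
    -- Fewer than `lam` conjuncts give fewer than `lam` stages over `j`, which have a common
    -- refinement.
    obtain ⟨m, v, b, hb⟩ := IsCardinalFiltered.wideSpan (κ := lam) u
      (by rwa [hasCardinalLT_iff_cardinal_mk_lt])
    refine ⟨m, b, (satP_conj _ _ _ _).2 fun i => ?_⟩
    rw [← hb i, Functor.map_comp, Str.comp_map, ← Category.assoc]
    exact (hu i).map hS (hφ i) _

/-- A `G`-element of `homObj B K` is an element `X ⊗ G ⟶ K.carrier` satisfying `φ`. For presentable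
`G` such an element, its satisfaction of `φ`, and any equality between two of them all appear at a
stage of a filtered colimit. -/
lemma IsPres.isPresentable (hV : LocPresentableAsClosed V lam) (hL : L.IsAry lam)
    (hS : S.IsProper) (hM : S.ClosedUnderFiltered lam) {X : V} (hX : IsCardinalPresentable X lam)
    {φ : Formula L lam kap X} (hφ : φ.IsConjAtomic) {B : Str S L} {x : X ⟶ B.carrier}
    (h : IsPres φ B x) : B.IsPresentable lam where
  preservesColimitOfShape J _ _ := ⟨fun {D} => ⟨fun {c} hc => by
    have := hV.locallyPresentable
    have := isFiltered_of_isCardinalFiltered J lam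
    obtain ⟨⟨hc⟩, hR⟩ := Str.isColimit_forget_and_rel hV hL hM hc
    -- Evaluation at the generic element `x`.
    let val {G : V} {K : Str S L} (s : G ⟶ Str.homObj B K) : X ⊗ G ⟶ K.carrier :=
      uncurry ((s ≫ Str.homι B K) ≫ (MonoidalClosed.pre x).app K.carrier)
    have val_sat {G : V} {K : Str S L} (s : G ⟶ Str.homObj B K) : φ.SatP K (val s) := by
      obtain ⟨e, he⟩ := h.exists_iso hS hφ K
      exact ⟨s ≫ e.hom, by rw [MonoidalClosed.curry_uncurry, Category.assoc, he, Category.assoc]⟩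
    have val_inj {G : V} {K : Str S L} {s t : G ⟶ Str.homObj B K} (hst : val s = val t) :
        s = t := by
      obtain ⟨e, he⟩ := h.exists_iso hS hφ K
      have := S.M_mono _ (φ.interp_M hφ K)
      have h1 := MonoidalClosed.uncurry_injective hst
      rw [Category.assoc, Category.assoc, ← he, ← Category.assoc, ← Category.assoc,
        cancel_mono, cancel_mono] at h1
      exact h1
    have val_surj {G : V} {K : Str S L} {a : X ⊗ G ⟶ K.carrier} (ha : φ.SatP K a) :
        ∃ s : G ⟶ Str.homObj B K, val s = a := by
      obtain ⟨e, he⟩ := h.exists_iso hS hφ K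
      obtain ⟨l, hl⟩ := ha
      refine ⟨l ≫ e.inv, ?_⟩
      change uncurry _ = a
      rw [Category.assoc, Category.assoc, ← he, e.inv_hom_id_assoc, hl,
        MonoidalClosed.uncurry_curry]
    have val_map {G : V} {K K' : Str S L} (s : G ⟶ Str.homObj B K) (g : K ⟶ K') :
        val (s ≫ (Str.homFunctor B).map g) = val s ≫ Str.Hom.map g := by
      change uncurry _ = uncurry _ ≫ _
      rw [← MonoidalClosed.uncurry_natural_right, Str.homFunctor_map, Category.assoc s,
        Str.Compat.lift_ι, Category.assoc, Category.assoc, Category.assoc, Category.assoc,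
        MonoidalClosed.pre_comm_ihom_map]
    refine nonempty_isColimit_of_presentable lam _ (fun G hG f => ?_) fun G hG j f g hfg => ?_
    · obtain ⟨j, a, ha⟩ := Str.exists_stage_hom hc (hV.tensor _ _ hX hG) (val (K := c.pt) f)
      obtain ⟨k, u, hu⟩ := Formula.SatP.exists_stage hV hL hS hc hR hφ hG (j := j) (a := a)
        (ha ▸ val_sat f)
      obtain ⟨s, hs⟩ := val_surj hu
      refine ⟨k, s, val_inj (K := c.pt) ((val_map s (c.ι.app k)).trans ?_)⟩
      rw [hs, Category.assoc, Str.map_comp_map_ι, ha]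
    · have e : val (K := D.obj j) f ≫ Str.Hom.map (c.ι.app j) =
          val (K := D.obj j) g ≫ Str.Hom.map (c.ι.app j) :=
        (val_map f (c.ι.app j)).symm.trans ((congrArg val hfg).trans (val_map g (c.ι.app j)))
      obtain ⟨k, u, hu⟩ := Str.exists_stage_eq hc (hV.tensor _ _ hX hG) e
      exact ⟨k, u, val_inj (K := D.obj k) ((val_map f (D.map u)).trans
        (hu.trans (val_map g (D.map u)).symm))⟩⟩⟩

/-- Every conjunction of atomic formulas presents a structure. -/
lemma Formula.IsConjAtomic.exists_isPres (hV : LocPresentableAsClosed V lam) (hL : L.IsAry lam)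
    (hS : S.IsProper) {X : V} {φ : Formula L lam kap X} (hφ : φ.IsConjAtomic) :
    ∃ (B : Str S L) (x : X ⟶ B.carrier), IsPres φ B x := by
  have := Str.hasColimits (S := S) hV hL
  induction hφ with
  | @eq Y s t =>
    rename_i X
    obtain ⟨F, η, hη⟩ := Str.exists_free hV hL S X
    obtain ⟨G, θ, hθ⟩ := Str.exists_free hV hL S Y
    -- An equation is imposed by coequalizing the two maps that classify the values of `s` and `t`
    -- at the free element.
    obtain ⟨a, ha, -⟩ := hθ F (s.val F η)
    obtain ⟨b, hb, -⟩ := hθ F (t.val F η)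
    refine ⟨coequalizer a b, η ≫ Str.Hom.map (coequalizer.π a b), ?_, fun K y hy => ?_,
      fun {K g g'} h => coequalizer.hom_ext ((hη K _).unique rfl ?_)⟩
    · rw [sat_eq hS, Term.val_map, Term.val_map, ← ha, ← hb, Category.assoc, Category.assoc,
        ← Str.comp_map, ← Str.comp_map, coequalizer.condition]
    · obtain ⟨g, hg, -⟩ := hη K y
      have h : a ≫ g = b ≫ g := by
        refine (hθ K _).unique rfl ?_
        rw [sat_eq hS, ← hg, Term.val_map, Term.val_map, ← ha, ← hb] at hy
        simpa using hy.symm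
      refine ⟨coequalizer.desc g h, ?_⟩
      rw [Category.assoc, ← Str.comp_map, coequalizer.π_desc, hg]
    · simpa using h.symm
  | rel R Y hY t =>
    obtain ⟨F, η, hη⟩ := Str.exists_free hV hL S X
    obtain ⟨G, θ, hθ⟩ := Str.exists_free hV hL S (L.ar R ⊗ Y)
    obtain ⟨Q, q, hq⟩ := Str.exists_free_rel hV hL S R Y
    -- The relation is imposed by a pushout: the value of `t` at the free element is identified with
    -- the element underlying the generic member of `R`.
    obtain ⟨a, ha, -⟩ := hθ F (t.val F η)
    obtain ⟨b, hb, -⟩ := hθ Q (uncurry (q ≫ Q.relι R))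
    have hQ : Q.RelHolds R (uncurry (q ≫ Q.relι R)) :=
      ⟨q, (MonoidalClosed.curry_uncurry _).symm⟩
    have hq' {K : Str S L} (g : Q ⟶ K) : curry (θ ≫ Str.Hom.map (b ≫ g)) =
        (q ≫ Str.relMap g R) ≫ K.relι R := by
      rw [Str.comp_map, ← Category.assoc, hb, ← MonoidalClosed.uncurry_natural_right,
        MonoidalClosed.curry_uncurry, Category.assoc, Category.assoc, Str.relMap_relι]
    refine ⟨pushout a b, η ≫ Str.Hom.map (pushout.inl a b), ?_, fun K y hy => ?_,
      fun {K g g'} h => ?_⟩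
    · rw [sat_rel, Term.val_map, ← ha, Category.assoc, ← Str.comp_map, pushout.condition,
        Str.comp_map, ← Category.assoc, hb]
      exact hQ.map _
    · obtain ⟨g, hg, -⟩ := hη K y
      rw [sat_rel, ← hg, Term.val_map, ← ha] at hy
      obtain ⟨l, hl⟩ := hy
      obtain ⟨g', hg', -⟩ := hq K l
      have h : a ≫ g = b ≫ g' := by
        refine (hθ K _).unique rfl (MonoidalClosed.curry_injective ?_)
        rw [hq', hg', hl, Category.assoc, Str.comp_map]
      refine ⟨pushout.desc g g' h, ?_⟩
      rw [Category.assoc, ← Str.comp_map, pushout.inl_desc, hg]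
    · have h1 : pushout.inl a b ≫ g = pushout.inl a b ≫ g' := by
        refine (hη K _).unique rfl ?_
        simpa using h.symm
      refine pushout.hom_ext h1 ((hq K _).unique rfl ?_)
      rw [← cancel_mono (K.relι R), ← hq', ← hq', ← pushout.condition_assoc,
        ← pushout.condition_assoc, h1]
  | conj hI φ hφ ih =>
    obtain ⟨F, η, hη⟩ := Str.exists_free hV hL S X
    choose B x hx using ih
    -- A conjunction is presented by the wide pushout of the presented structures under the free
    -- one.
    choose d hd _ using fun i => hη (B i) (x i)
    have hd' (i) : η ≫ Str.Hom.map (WidePushout.head d) =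
        x i ≫ Str.Hom.map (WidePushout.ι d i) := by
      rw [← hd, Category.assoc, ← Str.comp_map, WidePushout.arrow_ι]
    refine ⟨widePushout F B d, η ≫ Str.Hom.map (WidePushout.head d),
      (sat_conj _ _ _ _).2 fun i => ?_, fun K y hy => ?_, fun {K g g'} h => ?_⟩
    · rw [hd' i]
      exact (hx i).sat.map hS (hφ i) _
    · obtain ⟨g, hg, -⟩ := hη K y
      rw [sat_conj] at hy
      choose k hk using fun i => (hx i).exists_hom K y (hy i)
      have h (i) : d i ≫ k i = g := by
        refine (hη K _).unique ?_ hg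
        rw [← hk i, ← hd, Str.comp_map, Category.assoc]
      refine ⟨WidePushout.desc g k h, ?_⟩
      rw [Category.assoc, ← Str.comp_map, WidePushout.head_desc, hg]
    · refine WidePushout.hom_ext _ _ _ (fun i => (hx i).hom_ext ?_) ((hη K _).unique rfl ?_)
      · rw [Str.comp_map, Str.comp_map, ← Category.assoc, ← Category.assoc, ← hd', h]
      · simpa using h.symm

end

/-! ## Axioms and cones -/

section

variable {V : Type u} [Category.{w} V] [MonoidalCategory V] [HasColimits V] {L : Language V}
  {lam : Cardinal.{w}} [Fact lam.IsRegular] {kap : WithTop Cardinal.{w}}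

/-- The formula `ψ_j(x, y_j) ∧ φ(x)`. -/
noncomputable def ConeAxiom.body (a : ConeAxiom L lam kap) (j : a.J) :
    Formula L lam kap (a.X ⨿ a.Y j) :=
  (a.ψ j).and (a.φ.subst a.hX (presentable_coprod a.hX (a.hY j)) coprod.inl)

lemma ConeAxiom.isConjAtomic_body (a : ConeAxiom L lam kap) (j : a.J) :
    (a.body j).IsConjAtomic :=
  (a.hψ j).and (a.hφ.subst _ _ _)

end

section

variable {V : Type u} [Category.{w} V] [MonoidalCategory V] [SymmetricCategory V]
  [MonoidalClosed V] [HasLimits V] [HasColimits V] {S : FactSystem V} {L : Language V}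
  {lam : Cardinal.{w}} [Fact lam.IsRegular] {kap : WithTop Cardinal.{w}}

lemma ConeAxiom.sat_body_iff (hS : S.IsProper) (a : ConeAxiom L lam kap) (j : a.J) (K : Str S L)
    (z : a.X ⨿ a.Y j ⟶ K.carrier) :
    (a.body j).Sat K z ↔ (a.ψ j).Sat K z ∧ a.φ.Sat K (coprod.inl ≫ z) := by
  rw [body, Formula.sat_and, Formula.sat_subst hS a.hφ]

/-- Over `K^X`, the cone map is a map into the `M`-subobject `φ`, and its domain has the right-hand
side of the axiom as its image; orthogonality then turns membership in `E` into containment. -/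
lemma ConeAxiom.injective_iff (hS : S.IsProper) (a : ConeAxiom L lam kap) {B : Str S L}
    {x : a.X ⟶ B.carrier} (hx : IsPres a.φ B x) {B' : a.J → Str S L}
    {x' : ∀ j, a.X ⨿ a.Y j ⟶ (B' j).carrier} (hx' : ∀ j, IsPres (a.body j) (B' j) (x' j))
    (h : ∀ j, B ⟶ B' j) (hh : ∀ j, x ≫ Str.Hom.map (h j) = coprod.inl ≫ x' j) (K : Str S L) :
    S.E (Sigma.desc fun j => Str.homPre (h j) K) ↔ K.Satisfies a.φ a.rhs := by
  obtain ⟨e, he⟩ := hx.exists_iso hS a.hφ K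
  choose e' he' using fun j => (hx' j).exists_iso hS (a.isConjAtomic_body j) K
  let k (j : a.J) : ((a.body j).interp K).left ⟶ (ihom a.X).obj K.carrier :=
    ((a.body j).interp K).hom ≫ (MonoidalClosed.pre coprod.inl).app K.carrier
  let i : ∐ (fun j => S.im (k j)) ⟶ (ihom a.X).obj K.carrier := Sigma.desc fun j => S.imι (k j)
  have hm : S.M (Str.homι B K ≫ (MonoidalClosed.pre x).app K.carrier) := by
    rw [← he]
    exact S.M_comp (S.M_of_isIso _) (a.φ.interp_M a.hφ K)
  -- The right-hand side is an image of a sum of images: first for each existential quantifier, then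
  -- for the disjunction. Both `E`-parts compose.
  have hE : S.E (Limits.Sigma.map (fun j => (e' j).hom ≫ S.toIm (k j)) ≫ S.toIm i) :=
    S.E_comp (S.E_sigmaMap _ fun j => S.E_comp (S.E_of_isIso _) (S.im_spec _).1) (S.im_spec _).1
  rw [S.E_iff_factors (p := Sigma.desc fun j => Str.homPre (h j) K) hm hE (S.im_spec i).2.1]
  · constructor
    · rintro ⟨d, hd⟩
      exact ⟨Over.homMk (e.inv ≫ d) ((Category.assoc _ _ _).trans
        ((Iso.inv_comp_eq e).2 (hd.trans he.symm)))⟩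
    · rintro ⟨d⟩
      refine ⟨e.hom ≫ d.left, ?_⟩
      rw [← he, ← Over.w d]
      exact Category.assoc _ _ _
  · refine Sigma.hom_ext _ _ fun j => ?_
    have h1 : Str.homPre (h j) K ≫ Str.homι B K ≫ (MonoidalClosed.pre x).app K.carrier =
        Str.homι (B' j) K ≫ (MonoidalClosed.pre (x' j)).app K.carrier ≫
          (MonoidalClosed.pre coprod.inl).app K.carrier := by
      rw [Str.homPre, ← Category.assoc, Str.Compat.lift_ι, Category.assoc, ← NatTrans.comp_app,
        ← MonoidalClosed.pre_map, hh, MonoidalClosed.pre_map, NatTrans.comp_app]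
    have h2 : (e' j).hom ≫ k j = Str.homι (B' j) K ≫
        (MonoidalClosed.pre (x' j)).app K.carrier ≫
          (MonoidalClosed.pre coprod.inl).app K.carrier :=
      (Category.assoc _ _ _).symm.trans ((congrArg (· ≫ _) (he' j)).trans (Category.assoc _ _ _))
    simp only [Category.assoc, colimit.ι_desc_assoc, Cofan.mk_ι_app,
      (S.im_spec i).2.2]
    rw [h1, ← h2]
    simp [i, (S.im_spec (k j)).2.2]

lemma IsConeAxiomatizable.isConeInjectivityClass (hV : LocPresentableAsClosed V lam)
    (hL : L.IsAry lam) (hS : S.IsProper) (hM : S.ClosedUnderFiltered lam)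
    {𝒜 : ObjectProperty (Str S L)} (h : IsConeAxiomatizable lam kap 𝒜) :
    IsConeInjectivityClass lam kap 𝒜 := by
  obtain ⟨ι, T, hT⟩ := h
  have key (a : ConeAxiom L lam kap) : ∃ c : StrCone S L lam kap,
      ∀ K : Str S L, c.Injective K ↔ K.Satisfies a.φ a.rhs := by
    obtain ⟨B, x, hx⟩ := a.hφ.exists_isPres hV hL hS
    choose B' x' hx' using fun j => (a.isConjAtomic_body j).exists_isPres hV hL hS
    -- The conjunct `φ(x)` on the right-hand side of the axiom is what yields the legs of the cone.
    choose h hh using fun j => hx.exists_hom (B' j) (coprod.inl ≫ x' j)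
      ((a.sat_body_iff hS j _ _).1 (hx' j).sat).2
    exact ⟨⟨B, hx.isPresentable hV hL hS hM a.hX a.hφ, a.J, a.hJ, B', fun j =>
      (hx' j).isPresentable hV hL hS hM (presentable_coprod a.hX (a.hY j))
        (a.isConjAtomic_body j), h⟩, fun K => a.injective_iff hS hx hx' h hh K⟩
  choose c hc using fun i => key (T i)
  exact ⟨ι, c, fun K => (hT K).trans (forall_congr' fun i => (hc i K).symm)⟩

end

/-! ## Presentability implies having a presentation formula -/

lemma isCardinalPresentable_sigma {V : Type u} [Category.{w} V] [HasColimits V]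
    {lam : Cardinal.{w}} [Fact lam.IsRegular] {J : Type w} (hJ : Cardinal.mk J < lam) (X : J → V)
    (hX : ∀ j, IsCardinalPresentable (X j) lam) : IsCardinalPresentable (∐ X) lam := by
  have (k : Discrete J) : IsCardinalPresentable ((Discrete.functor X).obj k) lam := hX k.as
  exact isCardinalPresentable_of_isColimit _ (coproductIsCoproduct X) lam (by
    rwa [hasCardinalLT_arrow_discrete_iff, hasCardinalLT_iff_cardinal_mk_lt])

namespace Str

section

variable {V : Type u} [Category.{w} V] [MonoidalCategory V] [MonoidalClosed V]
  {S : FactSystem V} {L : Language V}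

lemma isIso_of_isIso_map {A B : Str S L} (g : A ⟶ B) [IsIso (Hom.map g)]
    [∀ R, IsIso (relMap g R)] : IsIso g := by
  let k : B ⟶ A :=
    { map := inv (Hom.map g)
      func_comm := fun f => by
        rw [Functor.map_inv, Functor.map_inv, IsIso.comp_inv_eq, Category.assoc,
          Hom.func_comm, IsIso.inv_hom_id_assoc]
      rel_comm := fun R => ⟨inv (relMap g R), by
        rw [Functor.map_inv, IsIso.inv_comp_eq, ← Category.assoc, relMap_relι, Category.assoc,
          IsIso.hom_inv_id, Category.comp_id]⟩ }
  exact ⟨k, Hom.ext (IsIso.hom_inv_id (Hom.map g)), Hom.ext (IsIso.inv_hom_id (Hom.map g))⟩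

end

end Str

section

variable {V : Type u} [Category.{w} V] [MonoidalCategory V] [SymmetricCategory V]
  [MonoidalClosed V] [HasLimits V] [HasColimits V] {S : FactSystem V} {L : Language V}
  {lam : Cardinal.{w}} [Fact lam.IsRegular] {kap : WithTop Cardinal.{w}}

variable (S L lam kap) in
/-- The structures which are presented by a conjunction of atomic formulas whose variable is
`lam`-presentable. -/
def HasPres : ObjectProperty (Str S L) := fun B =>
  ∃ (X : V) (φ : Formula L lam kap X) (x : X ⟶ B.carrier), IsCardinalPresentable X lam ∧
    φ.IsConjAtomic ∧ IsPres φ B x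

variable (S L lam kap) in
/-- A class of `lam`-presentable objects which covers all of them, such that each structure with a
presentation has a presentation in terms of which all elements with domain in the class are values
of terms. -/
structure IsTermCover (𝒬 : ObjectProperty V) : Prop where
  presentable : ∀ Q, 𝒬 Q → IsCardinalPresentable Q lam
  exists_cover : ∀ X : V, IsCardinalPresentable X lam → ∃ Q, 𝒬 Q ∧ ∃ q : Q ⟶ X, Epi q
  exists_term : ∀ B : Str S L, HasPres S L lam kap B →
    ∃ (X : V) (φ : Formula L lam kap X) (x : X ⟶ B.carrier), IsCardinalPresentable X lam ∧
      φ.IsConjAtomic ∧ IsPres φ B x ∧ ∀ Q, 𝒬 Q → ∀ z : Q ⟶ B.carrier,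
        ∃ t : Term L lam X Q, t.val B x = z

lemma IsPres.ofIso (hS : S.IsProper) {X : V} {φ : Formula L lam kap X} (hφ : φ.IsConjAtomic)
    {B B' : Str S L} {x : X ⟶ B.carrier} (h : IsPres φ B x) (e : B ≅ B') :
    IsPres φ B' (x ≫ Str.Hom.map e.hom) where
  sat := h.sat.map hS hφ _
  exists_hom K y hy := by
    obtain ⟨g, hg⟩ := h.exists_hom K y hy
    refine ⟨e.inv ≫ g, ?_⟩
    rw [Category.assoc, ← Str.comp_map, e.hom_inv_id_assoc, hg]
  hom_ext {K g g'} hg := by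
    rw [Category.assoc, Category.assoc, ← Str.comp_map, ← Str.comp_map] at hg
    exact (cancel_epi e.hom).1 (h.hom_ext hg)

lemma HasPres.isClosedUnderIsomorphisms (hS : S.IsProper) :
    (HasPres S L lam kap).IsClosedUnderIsomorphisms where
  of_iso := by
    rintro B B' e ⟨X, φ, x, hX, hφ, h⟩
    exact ⟨X, φ, _, hX, hφ, h.ofIso hS hφ e⟩

/-- The colimit is presented on the coproduct of the variables of all `D j`, by the formulas of the
`D j` together with one equation per arrow `u : j ⟶ k`. The equation says that the generator of `D
j` equals the term in the generator of `D k` that describes its image under `D u`. -/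
lemma IsTermCover.isClosedUnderColimitsOfShape (hS : S.IsProper) {𝒬 : ObjectProperty V}
    (h𝒬 : IsTermCover S L lam kap 𝒬) {J : Type w} [SmallCategory J]
    (hJ : HasCardinalLT (Arrow J) lam) :
    (HasPres S L lam kap).IsClosedUnderColimitsOfShape J where
  colimitsOfShape_le := by
    rintro B ⟨⟨D, i, hc⟩, hD⟩
    choose X φ x hX hφ hx ht using fun j => h𝒬.exists_term (D.obj j) (hD j)
    choose Q hQ q hq using fun j => h𝒬.exists_cover (X j) (hX j)
    -- Elements are known to be term values only over the cover `q`; since `q` is epi, the equation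
    -- for `u` still determines the image of the whole generator.
    choose t ht using fun u : Arrow J =>
      ht u.right (Q u.left) (hQ u.left) (q u.left ≫ x u.left ≫ Str.Hom.map (D.map u.hom))
    have hJ' : Cardinal.mk J < lam :=
      (hasCardinalLT_iff_cardinal_mk_lt _ _).1 (hasCardinalLT_of_hasCardinalLT_arrow hJ)
    have hJ'' : Cardinal.mk (Arrow J) < lam := (hasCardinalLT_iff_cardinal_mk_lt _ _).1 hJ
    have hXX := isCardinalPresentable_sigma hJ' X hX
    let ψ : Formula L lam kap (∐ X) :=
      (Formula.conj hJ' fun j => (φ j).subst (hX j) hXX (Sigma.ι X j)).and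
        (Formula.conj hJ'' fun u => .eq
          (.ofHom hXX (h𝒬.presentable _ (hQ u.left)) (q u.left ≫ Sigma.ι X u.left))
          (.comp (.ofHom hXX (hX u.right) (Sigma.ι X u.right)) (t u)))
    have hψ (K : Str S L) (y : ∐ X ⟶ K.carrier) : ψ.Sat K y ↔
        (∀ j, (φ j).Sat K (Sigma.ι X j ≫ y)) ∧
          ∀ u : Arrow J, q u.left ≫ Sigma.ι X u.left ≫ y =
            (t u).val K (Sigma.ι X u.right ≫ y) := by
      simp only [ψ, Formula.sat_and, Formula.sat_conj, Formula.sat_subst hS (hφ _),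
        Formula.sat_eq hS, Term.val_ofHom, Term.val_comp, Category.assoc]
    have hi {j k : J} (u : j ⟶ k) :
        Str.Hom.map (D.map u) ≫ Str.Hom.map (i.app k) = Str.Hom.map (i.app j) :=
      congrArg Str.Hom.map ((Cocone.mk B i).w u)
    let z : ∐ X ⟶ B.carrier := Sigma.desc fun j => x j ≫ Str.Hom.map (i.app j)
    have hz (j) : Sigma.ι X j ≫ z = x j ≫ Str.Hom.map (i.app j) := by simp [z]
    refine ⟨∐ X, ψ, z, hXX, ?_, ⟨(hψ _ _).2 ⟨fun j => ?_, fun u => ?_⟩, fun K y hy => ?_,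
      fun {K g g'} h => hc.hom_ext fun j => (hx j).hom_ext ?_⟩⟩
    · exact (Formula.IsConjAtomic.conj _ _ fun j => (hφ j).subst _ _ _).and
        (.conj _ _ fun u => .eq _ _)
    · rw [hz]
      exact (hx j).sat.map hS (hφ j) _
    · rw [hz, hz]
      refine Eq.trans ?_ (Term.val_map _ (i.app u.right) _).symm
      rw [ht, Category.assoc, Category.assoc, hi]
    · obtain ⟨h1, h2⟩ := (hψ K y).1 hy
      choose g hg using fun j => (hx j).exists_hom K _ (h1 j)
      have hg' {j k : J} (u : j ⟶ k) : D.map u ≫ g k = g j := by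
        have := hq j
        refine (hx j).hom_ext ((cancel_epi (q j)).1 ?_)
        have h3 : q j ≫ Sigma.ι X j ≫ y = (t (Arrow.mk u)).val K (Sigma.ι X k ≫ y) :=
          h2 (Arrow.mk u)
        have h4 : (t (Arrow.mk u)).val (D.obj k) (x k) = q j ≫ x j ≫ Str.Hom.map (D.map u) :=
          ht (Arrow.mk u)
        have h5 := Term.val_map (t (Arrow.mk u)) (g k) (x k)
        rw [hg, h4] at h5
        rw [hg, h3]
        refine Eq.trans ?_ h5.symm
        rw [Str.comp_map, Category.assoc, Category.assoc]
      let c : Cocone D := ⟨K, ⟨g, fun j k u => (hg' u).trans (Category.comp_id _).symm⟩⟩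
      refine ⟨hc.desc c, Sigma.hom_ext _ _ fun j => ?_⟩
      rw [← Category.assoc, hz, Category.assoc, ← hg]
      exact congrArg (x j ≫ ·) (congrArg Str.Hom.map (hc.fac c j))
    · have h' : Sigma.ι X j ≫ z ≫ Str.Hom.map g = Sigma.ι X j ≫ z ≫ Str.Hom.map g' :=
        congrArg (Sigma.ι X j ≫ ·) h
      rw [← Category.assoc, ← Category.assoc, hz, Category.assoc, Category.assoc] at h'
      exact h'

/-- The empty conjunction presents a free structure. -/
lemma HasPres.of_free {F : Str S L} {X : V} (hX : IsCardinalPresentable X lam)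
    (η : X ⟶ F.carrier)
    (h : ∀ (K : Str S L) (y : X ⟶ K.carrier), ∃! g : F ⟶ K, η ≫ Str.Hom.map g = y) :
    HasPres S L lam kap F := by
  have h0 : Cardinal.mk PEmpty.{w + 1} < lam := by
    have h : lam.IsRegular := Fact.out
    simpa using h.pos
  exact ⟨X, .conj h0 PEmpty.elim, η, hX, .conj _ _ fun j => j.elim,
    (Formula.sat_conj _ _ _ _).2 fun j => j.elim, fun K y _ => (h K y).exists,
    fun {K g g'} e => (h K _).unique e rfl⟩

/-- Presented by the single atomic formula `R^Y(x)`, with `x` of arity `L.ar R ⊗ Y`. -/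
lemma HasPres.of_free_rel (hV : LocPresentableAsClosed V lam) (hL : L.IsAry lam) (R : L.Rel)
    {Q : Str S L} {Y : V} (hY : IsCardinalPresentable Y lam) (q : Y ⟶ Q.rel R)
    (h : ∀ (K : Str S L) (y : Y ⟶ K.rel R), ∃! g : Q ⟶ K, q ≫ Str.relMap g R = y) :
    HasPres S L lam kap Q := by
  have hX := hV.tensor _ _ (hL.ar R) hY
  have key {K : Str S L} (g : Q ⟶ K) :
      curry (uncurry (q ≫ Q.relι R) ≫ Str.Hom.map g) = (q ≫ Str.relMap g R) ≫ K.relι R := by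
    rw [curry_natural_right, MonoidalClosed.curry_uncurry, Category.assoc, Category.assoc,
      Str.relMap_relι]
  refine ⟨L.ar R ⊗ Y, .rel R Y hY (.ofHom hX hX (𝟙 _)), uncurry (q ≫ Q.relι R), hX,
    .rel _ _ _ _, ?_, fun K y hy => ?_, fun {K g g'} e => (h K _).unique rfl ?_⟩
  · rw [Formula.sat_rel, Term.val_ofHom, Category.id_comp]
    exact ⟨q, (MonoidalClosed.curry_uncurry _).symm⟩
  · rw [Formula.sat_rel, Term.val_ofHom, Category.id_comp] at hy
    obtain ⟨l, hl⟩ := hy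
    obtain ⟨g, hg, -⟩ := h K l
    exact ⟨g, MonoidalClosed.curry_injective (by rw [key, hg, hl])⟩
  · rw [← cancel_mono (K.relι R), ← key, ← key, e]

/-- Free structures and the structures freely generated by an element of a relation form a strong
generator. -/
lemma Str.exists_isStrongGenerator (hV : LocPresentableAsClosed V lam) (hL : L.IsAry lam) :
    ∃ P : ObjectProperty (Str S L), ObjectProperty.Small.{w} P ∧ P.IsStrongGenerator ∧
      P ≤ HasPres S L lam kap := by
  have := hV.locallyPresentable
  obtain ⟨ι, G, hG, hG'⟩ := exists_presentable_family V lam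
  choose F η hη using fun i => exists_free hV hL S (G i)
  choose Q q hq using fun p : L.Rel × ι => exists_free_rel hV hL S p.1 (G p.2)
  let P : ObjectProperty (Str S L) := .ofObj (Sum.elim F Q)
  have hF (i : ι) : P (F i) := ObjectProperty.ofObj_apply (Sum.elim F Q) (Sum.inl i)
  have hQ (p : L.Rel × ι) : P (Q p) := ObjectProperty.ofObj_apply (Sum.elim F Q) (Sum.inr p)
  have hom_ext {A B : Str S L} {a b : A ⟶ B}
      (h : ∀ i (k : F i ⟶ A), k ≫ a = k ≫ b) : a = b := by
    refine Hom.ext ((isStrongGenerator_isCardinalPresentable (lam := lam)).isSeparating _ _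
      fun X hX y => ?_)
    obtain ⟨i, ⟨e⟩⟩ := hG' X hX
    obtain ⟨k, hk, -⟩ := hη i A (e.inv ≫ y)
    have h1 := congrArg (fun g => η i ≫ Hom.map g) (h i k)
    simp only [comp_map, reassoc_of% hk] at h1
    exact (cancel_epi e.inv).1 (by simpa using h1)
  refine ⟨P, inferInstance, ObjectProperty.isStrongGenerator_iff.2
    ⟨fun A B a b h => hom_ext fun i k => h _ (hF i) k, fun A B m _ h => ?_⟩, ?_⟩
  · have : IsIso (Hom.map m) := by
      refine isIso_of_presentable lam _ (fun X hX a b hab => ?_) fun X hX b => ?_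
      · obtain ⟨i, ⟨e⟩⟩ := hG' X hX
        obtain ⟨a', ha, -⟩ := hη i A (e.inv ≫ a)
        obtain ⟨b', hb, -⟩ := hη i A (e.inv ≫ b)
        have h1 : a' ≫ m = b' ≫ m := (hη i B _).unique rfl (by
          simp only [comp_map, reassoc_of% ha, reassoc_of% hb, hab])
        rw [cancel_mono] at h1
        rw [← cancel_epi e.inv, ← ha, h1, hb]
      · obtain ⟨i, ⟨e⟩⟩ := hG' X hX
        obtain ⟨b', hb, -⟩ := hη i B (e.inv ≫ b)
        obtain ⟨a, ha⟩ := h _ (hF i) b'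
        refine ⟨e.hom ≫ η i ≫ Hom.map a, ?_⟩
        have h1 : η i ≫ Hom.map a ≫ Hom.map m = e.inv ≫ b := by
          rw [← hb, ← ha]
          rfl
        simp [h1]
    -- Injectivity is inherited from the carriers; surjectivity is where the generators `Q`, free on
    -- an element of a relation, are needed.
    have (R : L.Rel) : IsIso (relMap m R) := by
      refine isIso_of_presentable lam _ (fun X hX a b hab => ?_) fun X hX b => ?_
      · rw [← cancel_mono (A.relι R), ← cancel_mono ((ihom (L.ar R)).map (Hom.map m)),
          Category.assoc, Category.assoc, ← relMap_relι, reassoc_of% hab]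
      · obtain ⟨i, ⟨e⟩⟩ := hG' X hX
        obtain ⟨b', hb, -⟩ := hq (R, i) B (e.inv ≫ b)
        obtain ⟨a, ha⟩ := h _ (hQ (R, i)) b'
        refine ⟨e.hom ≫ q (R, i) ≫ relMap a R, ?_⟩
        have h1 : q (R, i) ≫ relMap a R ≫ relMap m R = e.inv ≫ b := by
          rw [← hb, ← ha]
          exact congrArg (q (R, i) ≫ ·) ((relFunctor S R).map_comp a m).symm
        simp [h1]
    exact isIso_of_isIso_map m
  · rw [ObjectProperty.ofObj_le_iff]
    rintro (i | ⟨R, i⟩)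
    · exact .of_free (hG i) (η i) (hη i)
    · exact .of_free_rel hV hL R (hG i) (q (R, i)) (hq (R, i))

/-- The presentable objects are the closure of a strong generator of presentable objects under
colimits of size less than `lam`, and having a presentation passes through these colimits. -/
lemma IsTermCover.hasPres (hV : LocPresentableAsClosed V lam) (hL : L.IsAry lam)
    (hS : S.IsProper) (hM : S.ClosedUnderFiltered lam) {𝒬 : ObjectProperty V}
    (h𝒬 : IsTermCover S L lam kap 𝒬) {B : Str S L} (hB : B.IsPresentable lam) :
    HasPres S L lam kap B := by
  have := Str.hasColimits (S := S) hV hL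
  obtain ⟨P, _, hP, hP'⟩ := Str.exists_isStrongGenerator (kap := kap) hV hL
  have hpres : P ≤ CategoryTheory.isCardinalPresentable (Str S L) lam := by
    intro A hA
    obtain ⟨X, φ, x, hX, hφ, h⟩ := hP' A hA
    exact (h.isPresentable hV hL hS hM hX hφ).isCardinalPresentable hV.unit
  have := HasPres.isClosedUnderIsomorphisms (S := S) (L := L) (lam := lam) (kap := kap) hS
  have h1 : CategoryTheory.isCardinalPresentable (Str S L) lam B := hB.isCardinalPresentable hV.unit
  rw [IsStrongGenerator.colimitsCardinalClosure_eq_isCardinalPresentable hP hpres] at h1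
  exact P.colimitsCardinalClosure_le lam
    (fun J _ hJ => h𝒬.isClosedUnderColimitsOfShape hS hJ) hP' _ h1

/-- Each `B_j` has to be presented again in the variables `x, y_j`. This is done by its own formula
in `y_j` and an equation expressing `x`, over a cover, as a term in `y_j`; the conjunct `φ(x)`
required by the form of the axiom then imposes nothing new. -/
lemma IsTermCover.isConeAxiomatizable (hV : LocPresentableAsClosed V lam) (hL : L.IsAry lam)
    (hS : S.IsProper) (hM : S.ClosedUnderFiltered lam) {𝒬 : ObjectProperty V}
    (h𝒬 : IsTermCover S L lam kap 𝒬) {𝒜 : ObjectProperty (Str S L)}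
    (h : IsConeInjectivityClass lam kap 𝒜) : IsConeAxiomatizable lam kap 𝒜 := by
  obtain ⟨ι, c, hc⟩ := h
  have key (c : StrCone S L lam kap) : ∃ a : ConeAxiom L lam kap,
      ∀ K : Str S L, c.Injective K ↔ K.Satisfies a.φ a.rhs := by
    obtain ⟨X, φ, x, hX, hφ, hx⟩ := h𝒬.hasPres hV hL hS hM c.hA
    choose Y ψ y hY hψ hy ht using fun j =>
      h𝒬.exists_term (c.B j) (h𝒬.hasPres hV hL hS hM (c.hB j))
    obtain ⟨Q, hQ, q, hq⟩ := h𝒬.exists_cover X hX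
    choose t ht using fun j => ht j Q hQ (q ≫ x ≫ Str.Hom.map (c.h j))
    have hXY (j) := presentable_coprod hX (hY j)
    let a : ConeAxiom L lam kap :=
      { X := X
        hX := hX
        φ := φ
        hφ := hφ
        J := c.J
        hJ := c.hJ
        Y := Y
        hY := hY
        ψ := fun j => ((ψ j).subst (hY j) (hXY j) coprod.inr).and
          (.eq (.ofHom (hXY j) (h𝒬.presentable Q hQ) (q ≫ coprod.inl))
            (.comp (.ofHom (hXY j) (hY j) coprod.inr) (t j)))
        hψ := fun j => ((hψ j).subst _ _ _).and (.eq _ _) }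
    have ha (j : c.J) (K : Str S L) (z : X ⨿ Y j ⟶ K.carrier) : (a.body j).Sat K z ↔
        ((ψ j).Sat K (coprod.inr ≫ z) ∧ q ≫ coprod.inl ≫ z = (t j).val K (coprod.inr ≫ z)) ∧
          φ.Sat K (coprod.inl ≫ z) := by
      rw [a.sat_body_iff hS, Formula.sat_and, Formula.sat_subst hS (hψ j), Formula.sat_eq hS,
        Term.val_ofHom, Term.val_comp, Term.val_ofHom, Category.assoc]
    refine ⟨a, fun K => a.injective_iff hS hx
      (x' := fun j => coprod.desc (x ≫ Str.Hom.map (c.h j)) (y j)) (fun j => ?_) c.h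
      (fun j => (coprod.inl_desc _ _).symm) K⟩
    refine ⟨(ha _ _ _).2 ⟨⟨?_, ?_⟩, ?_⟩, fun K z hz => ?_, fun {K g g'} h => (hy j).hom_ext ?_⟩
    · rw [coprod.inr_desc]
      exact (hy j).sat
    · rw [coprod.inr_desc, coprod.inl_desc, ht]
    · rw [coprod.inl_desc]
      exact hx.sat.map hS hφ _
    · obtain ⟨⟨h1, h2⟩, -⟩ := (ha _ _ _).1 hz
      obtain ⟨g, hg⟩ := (hy j).exists_hom K _ h1
      refine ⟨g, coprod.hom_ext ((cancel_epi q).1 ?_) ?_⟩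
      · rw [coprod.desc_comp, coprod.inl_desc, h2, ← hg, Term.val_map, ht]
        simp
      · rw [coprod.desc_comp, coprod.inr_desc, hg]
    · have h' : coprod.inr ≫ coprod.desc (x ≫ Str.Hom.map (c.h j)) (y j) ≫ Str.Hom.map g =
          coprod.inr ≫ coprod.desc (x ≫ Str.Hom.map (c.h j)) (y j) ≫ Str.Hom.map g' :=
        congrArg (coprod.inr ≫ ·) h
      rwa [← Category.assoc, ← Category.assoc, coprod.inr_desc] at h'
  choose a ha using fun i => key (c i)
  exact ⟨ι, a, fun K => (hc K).trans (forall_congr' fun i => ha i K)⟩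

end

/-! ## Existence of term covers -/

section Base

variable {V : Type u} [Category.{w} V] [HasColimits V] {lam : Cardinal.{w}} [Fact lam.IsRegular]
  {C : V}

open CardinalDirectedPoset in
/-- A family of maps with `lam`-presentable domains and codomain `C`, which is closed under
precomposition and under coproducts of fewer than `lam` maps, consists of the maps factoring
through a fixed one. -/
lemma exists_factors_iff (hV : IsCardinalLocallyPresentable V lam) (P : ∀ ⦃Z : V⦄, (Z ⟶ C) → Prop)
    (hcomp : ∀ {Z Z' : V}, IsCardinalPresentable Z lam → IsCardinalPresentable Z' lam →
      ∀ (g : Z' ⟶ Z) (z : Z ⟶ C), P z → P (g ≫ z))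
    (hdesc : ∀ {J : Type w} (Y : J → V), Cardinal.mk J < lam →
      ∀ z : ∀ j, Y j ⟶ C, (∀ j, P (z j)) → P (Sigma.desc z)) :
    ∃ (T : V) (m : T ⟶ C), ∀ Z : V, IsCardinalPresentable Z lam → ∀ z : Z ⟶ C,
      P z ↔ ∃ p, p ≫ m = z := by
  obtain ⟨ι, G, hG, hG'⟩ := exists_presentable_family V lam
  -- All maps satisfying `P`, up to isomorphism of their domains. The fixed map is the colimit, over
  -- subsets of size less than `lam`, of their coproducts.
  let J : Type w := Σ i, {z : G i ⟶ C // P z}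
  let F : SetCardinalLT lam J ⥤ V :=
    { obj := fun s => ∐ fun a : s.1 => G a.1.1
      map := fun {s t} u => Sigma.desc fun a =>
        Sigma.ι (fun a : t.1 => G a.1.1) ⟨a.1, leOfHom u a.2⟩
      map_id := fun s => Sigma.hom_ext _ _ fun a => by simp
      map_comp := fun u v => Sigma.hom_ext _ _ fun a => by simp }
  let c : Cocone F :=
    { pt := C
      ι := { app := fun s => Sigma.desc fun a => a.1.2.1
             naturality := fun s t u => Sigma.hom_ext _ _ fun a => by simp [F] } }
  refine ⟨colimit F, colimit.desc F c, fun Z hZ z => ⟨fun hz => ?_, ?_⟩⟩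
  · obtain ⟨i, ⟨e⟩⟩ := hG' Z hZ
    let a : J := ⟨i, e.inv ≫ z, hcomp hZ (hG i) _ _ hz⟩
    let s : SetCardinalLT lam J := .singleton lam a
    refine ⟨e.hom ≫ Sigma.ι (fun a : s.1 => G a.1.1) ⟨a, rfl⟩ ≫ colimit.ι F s, ?_⟩
    have h1 : colimit.ι F s ≫ colimit.desc F c = Sigma.desc fun a : s.1 => a.1.2.1 :=
      colimit.ι_desc c s
    rw [Category.assoc, Category.assoc, h1, Sigma.ι_desc]
    exact e.hom_inv_id_assoc z
  · rintro ⟨p, rfl⟩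
    -- The subsets are `lam`-directed, so a map from a presentable object factors through a
    -- coproduct of fewer than `lam` maps satisfying `P`.
    obtain ⟨s, p', hp⟩ := IsCardinalPresentable.exists_hom_of_isColimit lam (colimit.isColimit F) p
    have h1 : colimit.ι F s ≫ colimit.desc F c = Sigma.desc fun a : s.1 => a.1.2.1 :=
      colimit.ι_desc c s
    have h2 : p ≫ colimit.desc F c = p' ≫ Sigma.desc fun a : s.1 => a.1.2.1 := by
      rw [← h1, ← Category.assoc]
      exact congrArg (· ≫ colimit.desc F c) hp.symm
    have hs : Cardinal.mk s.1 < lam := (hasCardinalLT_iff_cardinal_mk_lt _ _).1 s.2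
    rw [h2]
    exact hcomp (isCardinalPresentable_sigma hs _ fun a => hG _) hZ _ _
      (hdesc _ hs _ fun a => a.1.2.2)

end Base

/-! ### Inverse image structures and chaotic structures -/

namespace Str

variable {V : Type u} [Category.{w} V] [MonoidalCategory V] [MonoidalClosed V]
  {S : FactSystem V} {L : Language V}

section Substructure

variable [HasPullbacks V] (B : Str S L) {A : V} (m : A ⟶ B.carrier)
  (q : ∀ f : L.Func, (ihom (L.dom f)).obj A ⟶ (ihom (L.cod f)).obj A)

/-- The structure on `A` whose function symbols are given and whose relations are inverse images
along `m`. -/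
noncomputable abbrev comap : Str S L where
  carrier := A
  func := q
  rel R := pullback ((ihom (L.ar R)).map m) (B.relι R)
  relι _ := pullback.fst _ _
  relι_mem R := S.M_pullback_fst _ (B.relι_mem R)

variable {q} (hq : ∀ f, q f ≫ (ihom (L.cod f)).map m = (ihom (L.dom f)).map m ≫ B.func f)

/-- The morphism from the inverse image structure. -/
abbrev comapι : B.comap m q ⟶ B where
  map := m
  func_comm := hq
  rel_comm _ := ⟨pullback.snd _ _, pullback.condition.symm⟩

lemma relHolds_comap (R : L.Rel) {U : V} (a : L.ar R ⊗ U ⟶ A) (h : B.RelHolds R (a ≫ m)) :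
    (B.comap m q).RelHolds R a := by
  obtain ⟨l, hl⟩ := h
  exact ⟨pullback.lift (curry a) l (by rw [hl, curry_comp_map]), pullback.lift_fst _ _ _⟩

end Substructure

section Chaotic

variable [IsEmpty L.Func]

variable (S L) in
/-- Over a relational language, every object carries a structure in which all relations hold. -/
abbrev chaotic : V ⥤ Str S L where
  obj A :=
    { carrier := A
      func := isEmptyElim
      rel := fun R => (ihom (L.ar R)).obj A
      relι := fun R => 𝟙 _
      relι_mem := fun R => S.M_of_isIso _ }
  map g :=
    { map := g
      func_comm := isEmptyElim
      rel_comm := fun R => ⟨(ihom (L.ar R)).map g, by simp⟩ }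

/-- The chaotic structure is right adjoint to the underlying object; uniqueness is immediate, as
morphisms are determined by their underlying map. -/
lemma existsUnique_hom_chaotic (B : Str S L) {T : V} (a : B.carrier ⟶ T) :
    ∃ g : B ⟶ (chaotic S L).obj T, Hom.map g = a :=
  ⟨{ map := a
     func_comm := isEmptyElim
     rel_comm := fun R => ⟨B.relι R ≫ (ihom (L.ar R)).map a, Category.comp_id _⟩ }, rfl⟩

/-- Its relations are powers with presentable exponent. Accessibility of this right adjoint makes
the carrier of a presentable structure presentable. -/
lemma isCardinalAccessible_chaotic {lam : Cardinal.{w}} [Fact lam.IsRegular]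
    (hV : LocPresentableAsClosed V lam) (hL : L.IsAry lam) :
    (chaotic S L).IsCardinalAccessible lam where
  preservesColimitOfShape J _ _ := ⟨fun {F} => ⟨fun {c} hc => by
    have := hV.locallyPresentable
    refine ⟨isColimitOfForget lam isEmptyElim _ hc fun R => ?_⟩
    have := isCardinalAccessible_ihom hV.tensor (L.ar R) (hL.ar R)
    have e : chaotic S L ⋙ relFunctor S R ≅ ihom (L.ar R) :=
      NatIso.ofComponents (fun A => Iso.refl _) fun {A B} g => by
        have h := relMap_relι ((chaotic S L).map g) R
        simpa using h
    have : (chaotic S L ⋙ relFunctor S R).IsCardinalAccessible lam :=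
      Functor.isCardinalAccessible_of_natIso e.symm lam
    have := Functor.preservesColimitsOfShape_of_isCardinalAccessible
      (chaotic S L ⋙ relFunctor S R) lam J
    exact isColimitOfPreserves (chaotic S L ⋙ relFunctor S R) hc⟩⟩

end Chaotic

end Str

section

variable {V : Type u} [Category.{w} V] [MonoidalCategory V] [SymmetricCategory V]
  [MonoidalClosed V] [HasLimits V] [HasColimits V] {S : FactSystem V} {L : Language V}
  {lam : Cardinal.{w}} [Fact lam.IsRegular] {kap : WithTop Cardinal.{w}}

/-- The carrier of a presented structure is presentable and the generic element is epi. The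
presentation can therefore be moved to the identity of the carrier, and then every element with
presentable domain is a term of the form `ofHom`. -/
lemma isTermCover_of_isEmpty [IsEmpty L.Func] (hV : LocPresentableAsClosed V lam)
    (hL : L.IsAry lam) (hS : S.IsProper) (hM : S.ClosedUnderFiltered lam) :
    IsTermCover S L lam kap (isCardinalPresentable V lam) where
  presentable _ hQ := hQ
  exists_cover X hX := ⟨X, hX, 𝟙 X, inferInstance⟩
  exists_term := by
    rintro B ⟨X, φ, x, hX, hφ, h⟩
    -- Any two maps out of the carrier are morphisms into a chaotic structure, where the
    -- presentation applies.
    have hx : Epi x := ⟨fun {T} a b hab => by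
      obtain ⟨a', rfl⟩ := B.existsUnique_hom_chaotic a
      obtain ⟨b', rfl⟩ := B.existsUnique_hom_chaotic b
      rw [h.hom_ext hab]⟩
    have := Str.isCardinalAccessible_chaotic (S := S) hV hL
    have hB : IsCardinalPresentable B lam :=
      (h.isPresentable hV hL hS hM hX hφ).isCardinalPresentable hV.unit
    obtain ⟨z, hz⟩ := B.existsUnique_hom_chaotic (𝟙 B.carrier)
    have hB' : IsCardinalPresentable B.carrier lam :=
      isCardinalPresentable_of_universal (Str.chaotic S L) hB z fun T y =>
        ⟨Str.Hom.map y, Str.Hom.ext (by rw [Str.comp_map, hz, Category.id_comp]), fun a ha => by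
          rw [← ha, Str.comp_map, hz, Category.id_comp]⟩
    refine ⟨B.carrier, φ.subst hX hB' x, 𝟙 _, hB', hφ.subst _ _ _, ⟨?_, fun K y hy => ?_, ?_⟩,
      fun Q hQ z => ⟨.ofHom hB' hQ z, (Term.val_ofHom hB' hQ z B _).trans (Category.comp_id z)⟩⟩
    · rw [Formula.sat_subst hS hφ, Category.comp_id]
      exact h.sat
    · rw [Formula.sat_subst hS hφ] at hy
      obtain ⟨g, hg⟩ := h.exists_hom K _ hy
      exact ⟨g, by rw [Category.id_comp, (cancel_epi x).1 hg]⟩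
    · intro K g g' e
      rw [Category.id_comp, Category.id_comp] at e
      exact Str.Hom.ext e

/-- Term values with presentable domain are the elements factoring through one map `m`. Its
`S₀`-image is a substructure of `B` containing `x`, so the universal property gives a section of the
inclusion, and a projective `Q` lifts from the image to the domain of `m`. -/
lemma IsPres.exists_term (hV : LocPresentableAsClosed V lam) (hL : L.IsAry lam) (hS : S.IsProper)
    {S₀ : FactSystem V} (hst : ∀ f, S₀.Stable (L.dom f)) {X : V} {φ : Formula L lam kap X}
    (hX : IsCardinalPresentable X lam) (hφ : φ.IsConjAtomic) {B : Str S L} {x : X ⟶ B.carrier}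
    (h : IsPres φ B x) {Q : V} (hQ : IsCardinalPresentable Q lam) (hQ' : S₀.Projective Q)
    (z : Q ⟶ B.carrier) : ∃ t : Term L lam X Q, t.val B x = z := by
  have := hV.locallyPresentable
  obtain ⟨T, m, hm⟩ := exists_factors_iff hV.locallyPresentable
    (fun Z z => ∃ t : Term L lam X Z, t.val B x = z)
    (by
      rintro Z Z' hZ hZ' g z ⟨t, rfl⟩
      exact ⟨.comp t (.ofHom hZ hZ' g), by rw [Term.val_comp, Term.val_ofHom]⟩)
    (by
      intro J Y hJ z hz
      choose t ht using hz
      exact ⟨.tuple hJ Y t, Sigma.hom_ext _ _ fun j => by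
        rw [Term.ι_val_tuple, ht, Sigma.ι_desc]⟩)
  obtain ⟨he, hm₀, hem⟩ := S₀.im_spec m
  have := S₀.M_mono _ hm₀
  have lift {Z : V} (hZ : IsCardinalPresentable Z lam) (t : Term L lam X Z) :
      ∃ p, p ≫ S₀.imι m = t.val B x := by
    obtain ⟨p, hp⟩ := (hm Z hZ _).1 ⟨t, rfl⟩
    exact ⟨p ≫ S₀.toIm m, by rw [Category.assoc, hem, hp]⟩
  have hq (f : L.Func) : ∃ q : (ihom (L.dom f)).obj (S₀.im m) ⟶ (ihom (L.cod f)).obj (S₀.im m),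
      q ≫ (ihom (L.cod f)).map (S₀.imι m) = (ihom (L.dom f)).map (S₀.imι m) ≫ B.func f := by
    have hcod := S₀.M_ihom_map (L.cod f) hm₀
    have := S₀.M_mono _ hcod
    -- Applying `f` to a parametrised term value gives another one, through the power term `f^G`.
    -- Hence `f` maps powers of the domain of `m` into powers of the image.
    obtain ⟨a, ha⟩ := exists_factor_of_presentable lam ((ihom (L.cod f)).map (S₀.imι m))
      ((ihom (L.dom f)).map m ≫ B.func f) fun G hG p => by
        obtain ⟨t, ht⟩ := (hm _ (hV.tensor _ _ (hL.dom f) hG) (uncurry p ≫ m)).2 ⟨_, rfl⟩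
        obtain ⟨r, hr⟩ := lift (hV.tensor _ _ (hL.cod f) hG) (.comp t (.pow G hG (.symb f)))
        refine ⟨curry r, ?_⟩
        rw [Term.val_comp, ht, Term.val_pow_symb] at hr
        rw [← curry_comp_map, hr, curry_actOf, curry_comp_map, MonoidalClosed.curry_uncurry,
          Category.assoc]
    -- Stability of `dom f` keeps the power of the `E₀`-part in `E₀`, so orthogonality extends the
    -- operation to all of the image.
    obtain ⟨d, -, hd⟩ := S₀.exists_lift (hst f _ he) hcod a
      ((ihom (L.dom f)).map (S₀.imι m) ≫ B.func f)
      (by rw [ha, ← Category.assoc, ← Functor.map_comp, hem])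
    exact ⟨d, hd⟩
  choose q hq using hq
  let g : B.comap (S₀.imι m) q ⟶ B := B.comapι _ hq
  have : Mono (Str.Hom.map g) := inferInstanceAs (Mono (S₀.imι m))
  obtain ⟨x', hx'⟩ := lift hX (.ofHom hX hX (𝟙 X))
  rw [Term.val_ofHom, Category.id_comp] at hx'
  -- The relations on the image are inverse images along a monomorphism, so `φ` is reflected from
  -- `B`.
  have hsat : φ.Sat (B.comap (S₀.imι m) q) x' :=
    Formula.SatP.of_map hS hφ g (fun R U a ha => B.relHolds_comap _ R a ha) (by
      have h1 := h.sat
      rw [← hx'] at h1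
      rw [Category.assoc]
      exact h1)
  obtain ⟨k, hk⟩ := h.exists_hom (B.comap (S₀.imι m) q) x' hsat
  have hkg : k ≫ g = 𝟙 B := h.hom_ext (by
    rw [Str.comp_map, reassoc_of% hk, Str.id_map, Category.comp_id]
    exact hx')
  -- The section `k` moves `z` into the image, and projectivity of `Q` lifts it along the `E₀`-part
  -- of `m`.
  obtain ⟨p, hp⟩ := hQ' _ he (z ≫ Str.Hom.map k)
  refine (hm Q hQ z).2 ⟨p, ?_⟩
  rw [← hem, ← Category.assoc, hp, Category.assoc]
  exact (congrArg (z ≫ ·) (congrArg Str.Hom.map hkg)).trans (Category.comp_id z)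

lemma isTermCover_of_hasProjectiveGenerator (hV : LocPresentableAsClosed V lam)
    (hL : L.IsAry lam) (hS : S.IsProper) {S₀ : FactSystem V} (hS₀ : S₀.IsProper)
    (hst : ∀ f, S₀.Stable (L.dom f)) (hG : S₀.HasProjectiveGenerator lam) :
    IsTermCover S L lam kap fun Q => IsCardinalPresentable Q lam ∧ S₀.Projective Q where
  presentable _ hQ := hQ.1
  exists_cover X hX := by
    obtain ⟨G, hG, hG'⟩ := hG
    obtain ⟨Y, hY, e, he⟩ := hG' X hX
    exact ⟨Y, hG Y hY, e, hS₀ e he⟩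
  exists_term := by
    rintro B ⟨X, φ, x, hX, hφ, h⟩
    exact ⟨X, φ, x, hX, hφ, h, fun Q hQ z => h.exists_term hV hL hS hst hX hφ hQ.1 hQ.2 z⟩

lemma PresentationAssumption.exists_isTermCover (h : PresentationAssumption S L lam)
    (hV : LocPresentableAsClosed V lam) (hL : L.IsAry lam) (hS : S.IsProper)
    (hM : S.ClosedUnderFiltered lam) : ∃ 𝒬, IsTermCover S L lam kap 𝒬 := by
  obtain ⟨S₀, hS₀, -, _ | ⟨hst, -, hG⟩, -⟩ := h
  · exact ⟨_, isTermCover_of_isEmpty hV hL hS hM⟩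
  · exact ⟨_, isTermCover_of_hasProjectiveGenerator hV hL hS hS₀ hst hG⟩

end

end EnrLogic

theorem mainTheorem4
    {V : Type u} [Category.{w} V] [MonoidalCategory V] [SymmetricCategory V] [MonoidalClosed V]
    [HasLimits V] [HasColimits V]
    (lam : Cardinal.{w}) [Fact lam.IsRegular] (hV : EnrLogic.LocPresentableAsClosed V lam)
    (S : EnrLogic.FactSystem V) (hS : S.IsProper) (hM : S.ClosedUnderFiltered lam)
    (L : EnrLogic.Language V) (hL : L.IsAry lam)
    (kap : WithTop Cardinal.{w}) (𝒜 : ObjectProperty (EnrLogic.Str S L)) :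
    (EnrLogic.IsConeAxiomatizable lam kap 𝒜 → EnrLogic.IsConeInjectivityClass lam kap 𝒜) ∧
    (EnrLogic.PresentationAssumption S L lam →
      EnrLogic.IsConeInjectivityClass lam kap 𝒜 → EnrLogic.IsConeAxiomatizable lam kap 𝒜) := by
  refine ⟨fun h => h.isConeInjectivityClass hV hL hS hM, fun h h' => ?_⟩
  obtain ⟨𝒬, h𝒬⟩ := h.exists_isTermCover (kap := kap) hV hL hS hM
  exact h𝒬.isConeAxiomatizable hV hL hS hM h'
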